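/- **Theorem 1 (information flow from $x_1$ to $(x_2,\dots,x_n)$).** Let $F:\mathbb R\times\mathbb R^n\to\mathbb R^n$ be $C^1$ and $B=(b_{ik}):\mathbb R\times\mathbb R^n\to\mathbb R^{n\times m}$ be $C^2$, and put $g_{ij}=\sum_{k=1}^m b_{ik}b_{jk}$. Let $X$ be a (weak) solution on $[t_0,t_1]$ of $$dx = F(x,t)\,dt + B(x,t)\,dw ,$$ where $w$ is an $m$-dimensional standard Wiener process. Suppose that for $s\in(t_0,t_1)$ the vector $X(s)$ has a probability density $\rho(s,\cdot)$, that $\rho$ is $C^2$ on $(t_0,t_1)\times\mathbb R^n$, and that all $\rho(s,\cdot)$ vanish outside one common compact set. Write $$\rho_{\mathrm{others}}(s;x_2,\dots,x_n)=\int_{\mathbb R}\rho(s,x)\,dx_1,\qquad H_{\mathrm{others}}(s)=-\int_{\mathbb R^{n-1}}\rho_{\mathrm{others}}\log\rho_{\mathrm{others}}\,dx_2\cdots dx_n .$$ Fix $t\in(t_0,t_1)$ and $\delta>0$, and freeze $x_1$ on $[t,t+\delta]$ as follows. * Let $Z$ be a solution on $[t,t+\delta]$ of the system $dx_1=0$,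 $dx_i=F_i\,dt+\sum_k b_{ik}\,dw_k$ $(i\ge2)$, with $Z(t)$ distributed according to $\rho(t,\cdot)$; let $u(s,\cdot)$ be the density of $Z(s)$. * For each value $a$ in $A=\{a:\rho(t,(a,\cdot))\not\equiv0\}$ let $\rho_{\setminus1}(s,\cdot\,;a)$ be the density at time $s$ of a solution of the system $dx_i=F_i\,dt+\sum_k b_{ik}\,dw_k$ $(i\ge2)$ in $\mathbb R^{n-1}$, with the parameter $x_1=a$, that has density $\rho_{\mathrm{others}}(t;\cdot)$ at time $t$. Assume that $u$ and, uniformly in $a\in A$, $\rho_{\setminus1}(\cdot,\cdot\,;a)$ are $C^2$ in time and space on $[t,t+\delta]$ and rapidly decreasing in space together with their derivatives up to order two, that $\rho_{\setminus1}$ is jointly measurable, and that at the points where $u$ or $\rho_{\setminus1}$ is nonzero (with $x_1\in A$), the $F_i$ with their first and the $b_{ik}$ with their first and second derivatives in $(x_2,\dots,x_n)$ $(i\ge2)$ are bounded by $c(1+|(x_2,\dots,x_n)|)^p$ for some $c,p$. (The decay and growth assumptions hold automatically if these densities, $C^2$ with bounds uniform in $a$, have a common compact support.) The entropy with $x_1$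 frozen is $$H_{\mathrm{others}\setminus1}(s)=-E\big[\log\rho_{\setminus1}\big(s,Z_2(s),\dots,Z_n(s);Z_1(s)\big)\big],$$ and the information flow from $x_1$ to $(x_2,\dots,x_n)$ at time $t$ is $$T_{1\to\mathrm{others}}=\frac{dH_{\mathrm{others}}}{ds}(t)-\frac{d^+H_{\mathrm{others}\setminus1}}{ds}(t).$$ Then the integral defining $H_{\mathrm{others}}$ (for times near $t$) and the expectation defining $H_{\mathrm{others}\setminus1}$ (for times $s\ge t$ near $t$, with $\rho_{\setminus1}>0$ almost surely at the argument) converge, the derivative and the right derivative exist, and $$T_{1\to\mathrm{others}}=-E\Big[\sum_{i=2}^n\frac1{\rho_{\mathrm{others}}}\frac{\partial(F_i\rho_{\mathrm{others}})}{\partial x_i}\Big]+\frac12E\Big[\sum_{i=2}^n\sum_{j=2}^n\frac1{\rho_{\mathrm{others}}}\frac{\partial^2(g_{ij}\rho_{\mathrm{others}})}{\partial x_i\partial x_j}\Big],$$ where both expectations are of integrable functions of $X(t)$ (nats per unit time). -/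

import Mathlib

open MeasureTheory ProbabilityTheory

noncomputable section

/-- The partial derivative `∂ f / ∂ x_i` at the point `x`. -/
def partialD {d : ℕ} (i : Fin d) (f : (Fin d → ℝ) → ℝ) (x : Fin d → ℝ) : ℝ :=
  fderiv ℝ f x (Pi.single i 1)

/-- The matrix `g = B Bᵀ`, that is `g_{ij} = ∑_k b_{ik} b_{jk}`. -/
def diffusionMatrix {d m : ℕ} (B : ℝ → (Fin d → ℝ) → Fin d → Fin m → ℝ)
    (s : ℝ) (x : Fin d → ℝ) (i j : Fin d) : ℝ :=
  ∑ k, B s x i k * B s x j k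

/-- The generator of `dx = F dt + B dw` at time `s`:
`∑_i F_i ∂_i f + (1/2) ∑_{i,j} g_{ij} ∂_i ∂_j f`. -/
def generator {d m : ℕ} (F : ℝ → (Fin d → ℝ) → Fin d → ℝ)
    (B : ℝ → (Fin d → ℝ) → Fin d → Fin m → ℝ)
    (s : ℝ) (f : (Fin d → ℝ) → ℝ) (x : Fin d → ℝ) : ℝ :=
  (∑ i, F s x i * partialD i f x)
    + (1 / 2) * ∑ i, ∑ j, diffusionMatrix B s x i j * partialD i (partialD j f) x

/-- `X` is a weak solution of the stochastic differential equation `dx = F dt + B dw` on the time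
interval `[t₀, t₁]`, in the sense of the martingale problem of Stroock and Varadhan: `X` is adapted
to some filtration, has continuous paths, and for every smooth compactly supported `f` the process
`f(X_s) - ∫_{t₀}^s (L_r f)(X_r) dr` is a martingale on `[t₀, t₁]`. -/
def IsWeakSolution {d m : ℕ} (F : ℝ → (Fin d → ℝ) → Fin d → ℝ)
    (B : ℝ → (Fin d → ℝ) → Fin d → Fin m → ℝ) (t₀ t₁ : ℝ)
    {Ω : Type*} [mΩ : MeasurableSpace Ω] (P : Measure Ω) (X : ℝ → Ω → (Fin d → ℝ)) : Prop :=
  ∃ 𝓕 : Filtration ℝ mΩ,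
    (∀ s ∈ Set.Icc t₀ t₁, Measurable[𝓕 s] (X s)) ∧
    (∀ ω, ContinuousOn (fun s => X s ω) (Set.Icc t₀ t₁)) ∧
    ∀ f : (Fin d → ℝ) → ℝ, ContDiff ℝ ((⊤ : ℕ∞) : WithTop ℕ∞) f → HasCompactSupport f →
      let M : ℝ → Ω → ℝ := fun s ω => f (X s ω) - ∫ r in t₀..s, generator F B r f (X r ω)
      (∀ s ∈ Set.Icc t₀ t₁, StronglyMeasurable[𝓕 s] (M s) ∧ Integrable (M s) P) ∧
      ∀ r ∈ Set.Icc t₀ t₁, ∀ s ∈ Set.Icc t₀ t₁, r ≤ s → P[M s|𝓕 r] =ᵐ[P] M r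

/-- `w` is a probability density function of the random vector `Y` under `P`. -/
def IsPDFOf {d : ℕ} {Ω : Type*} [MeasurableSpace Ω] (P : Measure Ω) (Y : Ω → (Fin d → ℝ))
    (w : (Fin d → ℝ) → ℝ) : Prop :=
  (∀ x, 0 ≤ w x) ∧ P.map Y = volume.withDensity (fun x => ENNReal.ofReal (w x))

/-- `w s`, for `s ∈ [t₀, t₁]`, are the probability density functions of a solution of
`dx = F dt + B dw` on `[t₀, t₁]`. -/
def IsSolutionPDF {d m : ℕ} (F : ℝ → (Fin d → ℝ) → Fin d → ℝ)
    (B : ℝ → (Fin d → ℝ) → Fin d → Fin m → ℝ) (t₀ t₁ : ℝ)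
    (w : ℝ → (Fin d → ℝ) → ℝ) : Prop :=
  ∃ (Ω : Type) (_ : MeasurableSpace Ω) (P : Measure Ω) (Y : ℝ → Ω → (Fin d → ℝ)),
    IsProbabilityMeasure P ∧ IsWeakSolution F B t₀ t₁ P Y ∧
      ∀ s ∈ Set.Icc t₀ t₁, IsPDFOf P (Y s) (w s)

/-- The density of `(x_2, …, x_n)`: the first variable (index `0`) is integrated out. -/
def othersPDF {n : ℕ} (ρ : (Fin (n + 1) → ℝ) → ℝ) (y : Fin n → ℝ) : ℝ :=
  ∫ a : ℝ, ρ (Fin.cons a y)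

/-- The system `dx_1 = 0`, `dx_i = F_i dt + ∑_k b_{ik} dw_k` (`i ≥ 2`): drift. -/
def frozenDrift {n : ℕ} (F : ℝ → (Fin (n + 1) → ℝ) → Fin (n + 1) → ℝ) :
    ℝ → (Fin (n + 1) → ℝ) → Fin (n + 1) → ℝ :=
  fun s x => Fin.cons 0 (fun i => F s x i.succ)

/-- The system `dx_1 = 0`, `dx_i = F_i dt + ∑_k b_{ik} dw_k` (`i ≥ 2`): noise amplitude. -/
def frozenNoise {n m : ℕ} (B : ℝ → (Fin (n + 1) → ℝ) → Fin (n + 1) → Fin m → ℝ) :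
    ℝ → (Fin (n + 1) → ℝ) → Fin (n + 1) → Fin m → ℝ :=
  fun s x => Fin.cons 0 (fun i => B s x i.succ)

/-- The drift of the system for `(x_2, …, x_n)` in which `x_1 = a` is a parameter. -/
def paramDrift {n : ℕ} (F : ℝ → (Fin (n + 1) → ℝ) → Fin (n + 1) → ℝ) (a : ℝ) :
    ℝ → (Fin n → ℝ) → Fin n → ℝ :=
  fun s y i => F s (Fin.cons a y) i.succ

/-- The noise amplitude of the system for `(x_2, …, x_n)` in which `x_1 = a` is a parameter. -/
def paramNoise {n m : ℕ} (B : ℝ → (Fin (n + 1) → ℝ) → Fin (n + 1) → Fin m → ℝ) (a : ℝ) :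
    ℝ → (Fin n → ℝ) → Fin n → Fin m → ℝ :=
  fun s y i => B s (Fin.cons a y) i.succ

/-- `w` is twice continuously differentiable on `[t₀, t₁] × ℝ^d` and is rapidly decreasing in space
together with its derivatives up to order two, with the constants `C N`. -/
def IsRapidlyDecreasing {d : ℕ} (C : ℕ → ℝ) (t₀ t₁ : ℝ) (w : ℝ → (Fin d → ℝ) → ℝ) : Prop :=
  ContDiffOn ℝ 2 (fun z : ℝ × (Fin d → ℝ) => w z.1 z.2) (Set.Icc t₀ t₁ ×ˢ Set.univ) ∧
  ∀ N : ℕ, ∀ k ≤ 2, ∀ s ∈ Set.Icc t₀ t₁, ∀ y : Fin d → ℝ,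
    (1 + ‖y‖) ^ N *
      ‖iteratedFDerivWithin ℝ k (fun z : ℝ × (Fin d → ℝ) => w z.1 z.2)
        (Set.Icc t₀ t₁ ×ˢ Set.univ) (s, y)‖ ≤ C N

/-- At the point `y` and time `s`, the drift and its first derivatives, and the noise amplitude and
its derivatives up to order two, are at most `c (1 + ‖y‖)^p`. -/
def HasPolynomialBoundAt {d m : ℕ} (F : ℝ → (Fin d → ℝ) → Fin d → ℝ)
    (B : ℝ → (Fin d → ℝ) → Fin d → Fin m → ℝ) (c : ℝ) (p : ℕ) (s : ℝ) (y : Fin d → ℝ) : Prop :=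
  (∀ k ≤ 1, ‖iteratedFDeriv ℝ k (F s) y‖ ≤ c * (1 + ‖y‖) ^ p) ∧
  (∀ k ≤ 2, ‖iteratedFDeriv ℝ k (B s) y‖ ≤ c * (1 + ‖y‖) ^ p)

/-- The values of `x_1` that occur under the density `ρ`. -/
def firstRange {n : ℕ} (ρ : (Fin (n + 1) → ℝ) → ℝ) : Set ℝ :=
  {a | ∃ y : Fin n → ℝ, ρ (Fin.cons a y) ≠ 0}

/-- The system with `x_1` frozen from time `t` on, over the time interval `[t, t + δ]`.
`Z` is the state: it starts from the density `ρt` (that of the full state at time `t`), its first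
component does not move, and its other components follow the original equations; `u` is its density.
`q a s` is the density at time `s` of the system for `(x_2, …, x_n)` with the parameter `x_1 = a`,
which equals the density of `(x_2, …, x_n)` at time `t`.
The densities are regular, with bounds that are uniform in the parameter, and the coefficients grow
at most polynomially where these densities live (which is no restriction if they have a common
compact support). -/
structure IsFrozenSystem {n m : ℕ} (F : ℝ → (Fin (n + 1) → ℝ) → Fin (n + 1) → ℝ)
    (B : ℝ → (Fin (n + 1) → ℝ) → Fin (n + 1) → Fin m → ℝ) (t δ : ℝ)
    (ρt : (Fin (n + 1) → ℝ) → ℝ) {Ω : Type*} [MeasurableSpace Ω] (P : Measure Ω)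
    (Z : ℝ → Ω → (Fin (n + 1) → ℝ)) (u : ℝ → (Fin (n + 1) → ℝ) → ℝ)
    (q : ℝ → ℝ → (Fin n → ℝ) → ℝ) : Prop where
  state_solution : IsWeakSolution (frozenDrift F) (frozenNoise B) t (t + δ) P Z
  state_initial : IsPDFOf P (Z t) ρt
  state_pdf : ∀ s ∈ Set.Icc t (t + δ), IsPDFOf P (Z s) (u s)
  state_regular : ∃ C : ℕ → ℝ, IsRapidlyDecreasing C t (t + δ) u
  param_pdf : ∀ a ∈ firstRange ρt,
    IsSolutionPDF (paramDrift F a) (paramNoise B a) t (t + δ) (q a)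
  param_initial : ∀ a ∈ firstRange ρt, ∀ y, q a t y = othersPDF ρt y
  param_regular : ∃ C : ℕ → ℝ, ∀ a ∈ firstRange ρt, IsRapidlyDecreasing C t (t + δ) (q a)
  param_measurable : Measurable (fun z : ℝ × ℝ × (Fin n → ℝ) => q z.1 z.2.1 z.2.2)
  growth : ∃ (c : ℝ) (p : ℕ), ∀ a ∈ firstRange ρt, ∀ s ∈ Set.Icc t (t + δ), ∀ y : Fin n → ℝ,
    (q a s y ≠ 0 ∨ u s (Fin.cons a y) ≠ 0) →
      HasPolynomialBoundAt (paramDrift F a) (paramNoise B a) c p s y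

/-- The joint entropy of `(x_2, …, x_n)` at time `s`, in nats. -/
def othersEntropy {n : ℕ} (ρ : ℝ → (Fin (n + 1) → ℝ) → ℝ) (s : ℝ) : ℝ :=
  -∫ y : Fin n → ℝ, othersPDF (ρ s) y * Real.log (othersPDF (ρ s) y)

/-- The entropy of `(x_2, …, x_n)` at time `s` when `x_1` is frozen: minus the expectation of the
logarithm of the density with parameter `x_1`, evaluated at the state of the frozen system. -/
def frozenEntropy {n : ℕ} {Ω : Type*} [MeasurableSpace Ω] (P : Measure Ω)
    (Z : ℝ → Ω → (Fin (n + 1) → ℝ)) (q : ℝ → ℝ → (Fin n → ℝ) → ℝ) (s : ℝ) : ℝ :=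
  -∫ ω, Real.log (q (Z s ω 0) s (Fin.tail (Z s ω))) ∂P

/-- `T` is the information flow from `x_1` to `(x_2, …, x_n)` at time `t`: the rate of change of the
entropy of `(x_2, …, x_n)` minus the rate (forward from time `t`) with `x_1` frozen at time `t`.
Both entropies are required to be defined by convergent integrals near `t`. -/
def IsInformationFlow {n : ℕ} (ρ : ℝ → (Fin (n + 1) → ℝ) → ℝ)
    {Ω : Type*} [MeasurableSpace Ω] (P : Measure Ω)
    (Z : ℝ → Ω → (Fin (n + 1) → ℝ)) (q : ℝ → ℝ → (Fin n → ℝ) → ℝ) (t T : ℝ) : Prop :=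
  (∀ᶠ s in nhds t, Integrable (fun y : Fin n → ℝ =>
    othersPDF (ρ s) y * Real.log (othersPDF (ρ s) y))) ∧
  (∀ᶠ s in nhdsWithin t (Set.Ici t),
    (∀ᵐ ω ∂P, 0 < q (Z s ω 0) s (Fin.tail (Z s ω))) ∧
    Integrable (fun ω => Real.log (q (Z s ω 0) s (Fin.tail (Z s ω)))) P) ∧
  ∃ r r₁ : ℝ, HasDerivAt (othersEntropy ρ) r t ∧
    HasDerivWithinAt (frozenEntropy P Z q) r₁ (Set.Ici t) t ∧ T = r - r₁

/-- `∑_{i ≥ 2} (1/ρ_others) ∂_i (F_i ρ_others)` at time `t`; `ρt` is the density of the full state. -/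
def driftTerm {n : ℕ} (F : ℝ → (Fin (n + 1) → ℝ) → Fin (n + 1) → ℝ) (t : ℝ)
    (ρt : (Fin (n + 1) → ℝ) → ℝ) (x : Fin (n + 1) → ℝ) : ℝ :=
  ∑ i : Fin n, 1 / othersPDF ρt (Fin.tail x) *
    partialD i.succ (fun z => F t z i.succ * othersPDF ρt (Fin.tail z)) x

/-- `∑_{i,j ≥ 2} (1/ρ_others) ∂_i ∂_j (g_{ij} ρ_others)` at time `t`. -/
def noiseTerm {n m : ℕ} (B : ℝ → (Fin (n + 1) → ℝ) → Fin (n + 1) → Fin m → ℝ) (t : ℝ)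
    (ρt : (Fin (n + 1) → ℝ) → ℝ) (x : Fin (n + 1) → ℝ) : ℝ :=
  ∑ i : Fin n, ∑ j : Fin n, 1 / othersPDF ρt (Fin.tail x) *
    partialD i.succ (partialD j.succ
      (fun z => diffusionMatrix B t z i.succ j.succ * othersPDF ρt (Fin.tail z))) x

end

/-! Let `p₀` be the density of `(x₂, …, xₙ)` at the freezing time `t`, and let `L*` be the
Fokker–Planck operator of the frozen system. It contains no derivative in `x₁`, so on each slice `x₁
= a` it acts as the operator of the system with parameter `a`. Formally `dH_others/ds = -∫ ∂ₛp log
p₀`, because the term that comes from differentiating the logarithm is the derivative of the total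
mass. Formally again, the frozen entropy `-∫∫ u log q` has the right derivative `-(∫∫ ∂ₛu log p₀ +
∫∫ ∂ₛq · ρ / p₀)`, because `u = ρ` and `q = p₀` at time `t`. The generators of the full and of the
frozen system agree on functions of `(x₂, …, xₙ)`, so `∂ₛρ` and `∂ₛu` have the same marginal at time
`t` (`othersPDF_ae_eq_of_weak`). Hence the logarithmic terms cancel in the difference, which is `∫∫
ρ · L*p₀ / p₀`, the asserted formula.

The work lies in the right derivative, since the densities may vanish and the noise may be
degenerate. Three facts tame the singularities. A nonnegative `C²` function satisfies `|∇v|² ≤ C v`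
(`sq_partialD_le`, with decay in `IsDecayingFamily.isWeightedDensity`). The same argument in time
gives `(∂ₛp)² ≤ C p` for the marginal, so `∂ₛp log p` is bounded because `√z log z` is bounded near
zero. Finally, `v / p₀` is integrable over all slices, because `p₀` is the marginal of `v` and has
compact support (`IsFokkerPlanckBundle.integrable_ratio`).

Lower bound for `∫ v log q`, where `v` is a slice of `u`: for `ε > 0` the function `∫ v log (q + ε)`
is differentiable. The divergence theorem and a completion of the square turn its derivative into
the integral of `logRate`, a nonnegative square minus `g(∇v, ∇v) / (2v)` plus a term of order zero
(`sum_partialD_logField`). The last two terms have an integrable bound that does not involve `q` or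
`ε` (`neg_le_logRate`), so `∫ v log (q + ε)` decreases at most at a fixed rate. This makes `v log q`
integrable at later times (`log_integrable`). Fatou's lemma, jointly in time and `ε` and once more
in the parameter, bounds the lower right derivative by the integral of `logRate` at time `t` with `ε
= 0`; that integral is evaluated by letting `ε → 0` (`IsFokkerPlanckBundle.integral_logRate_eq`).

Upper bound: with `σ = s - t`, the inequality `log q ≤ log (p₀ + σ) + q / (p₀ + σ) - 1` dominates
the difference quotient by expressions whose limits follow from Taylor's formula and from dominated
convergence with a majorant built from `v / p₀` and `decayWeight`. Both bounds have the same limit.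
-/

section Calculus

/-! ### Partial derivatives and gradients of nonnegative functions -/

variable {d : ℕ}

theorem partialD_add {i : Fin d} {f g : (Fin d → ℝ) → ℝ} {x : Fin d → ℝ}
    (hf : DifferentiableAt ℝ f x) (hg : DifferentiableAt ℝ g x) :
    partialD i (fun z => f z + g z) x = partialD i f x + partialD i g x := by
  simp [partialD, fderiv_fun_add hf hg]

theorem partialD_sub {i : Fin d} {f g : (Fin d → ℝ) → ℝ} {x : Fin d → ℝ}
    (hf : DifferentiableAt ℝ f x) (hg : DifferentiableAt ℝ g x) :
    partialD i (fun z => f z - g z) x = partialD i f x - partialD i g x := by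
  simp [partialD, fderiv_fun_sub hf hg]

theorem partialD_mul {i : Fin d} {f g : (Fin d → ℝ) → ℝ} {x : Fin d → ℝ}
    (hf : DifferentiableAt ℝ f x) (hg : DifferentiableAt ℝ g x) :
    partialD i (fun z => f z * g z) x = f x * partialD i g x + g x * partialD i f x := by
  simp [partialD, fderiv_fun_mul hf hg]

theorem partialD_const_mul {i : Fin d} {f : (Fin d → ℝ) → ℝ} {x : Fin d → ℝ} (c : ℝ)
    (hf : DifferentiableAt ℝ f x) :
    partialD i (fun z => c * f z) x = c * partialD i f x := by
  simp [partialD, fderiv_const_mul hf]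

theorem partialD_sum {ι : Type*} {s : Finset ι} {i : Fin d} {f : ι → (Fin d → ℝ) → ℝ}
    {x : Fin d → ℝ} (hf : ∀ k ∈ s, DifferentiableAt ℝ (f k) x) :
    partialD i (fun z => ∑ k ∈ s, f k z) x = ∑ k ∈ s, partialD i (f k) x := by
  simp [partialD, fderiv_fun_sum hf]

theorem partialD_const {i : Fin d} {x : Fin d → ℝ} (c : ℝ) :
    partialD i (fun _ => c) x = 0 := by
  simp [partialD]

theorem HasDerivAt.partialD_comp {i : Fin d} {f : (Fin d → ℝ) → ℝ} {x : Fin d → ℝ} {φ : ℝ → ℝ}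
    {φ' : ℝ} (hφ : HasDerivAt φ φ' (f x)) (hf : DifferentiableAt ℝ f x) :
    partialD i (fun z => φ (f z)) x = φ' * partialD i f x := by
  have := hφ.comp_hasFDerivAt x hf.hasFDerivAt
  have h2 : fderiv ℝ (fun z => φ (f z)) x = φ' • fderiv ℝ f x := this.fderiv
  simp [partialD, h2]

theorem HasDerivAt.of_partialD {f : (Fin d → ℝ) → ℝ} {x : Fin d → ℝ} (i : Fin d) (h : ℝ)
    (hf : DifferentiableAt ℝ f (x + Pi.single i h)) :
    HasDerivAt (fun h => f (x + Pi.single i h)) (partialD i f (x + Pi.single i h)) h := by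
  have h1 : HasDerivAt (fun h : ℝ => x + Pi.single i h) (Pi.single i (1 : ℝ)) h := by
    have : (fun h : ℝ => x + Pi.single i h) = fun h : ℝ => x + h • (Pi.single i 1 : Fin d → ℝ) := by
      funext h; congr 1; rw [← Pi.single_smul]; simp
    rw [this]
    simpa using ((hasDerivAt_id h).smul_const (Pi.single i (1 : ℝ) : Fin d → ℝ)).const_add x
  exact hf.hasFDerivAt.comp_hasDerivAt h h1

theorem ContDiff.contDiff_one_partialD {f : (Fin d → ℝ) → ℝ} (hf : ContDiff ℝ 2 f) (i : Fin d) :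
    ContDiff ℝ 1 (partialD i f) :=
  (hf.fderiv_right (m := 1) (by norm_num)).clm_apply contDiff_const

theorem ContDiff.continuous_partialD {f : (Fin d → ℝ) → ℝ} (hf : ContDiff ℝ 1 f) (i : Fin d) :
    Continuous (partialD i f) :=
  (hf.continuous_fderiv one_ne_zero).clm_apply continuous_const

/-- A zero of a nonnegative function is a minimum. Where a density vanishes, this removes every term
that carries its gradient, although the coefficients are not controlled there. -/
theorem partialD_eq_zero_of_nonneg {f : (Fin d → ℝ) → ℝ} (hf : ∀ x, 0 ≤ f x) {x : Fin d → ℝ}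
    (hx : f x = 0) (i : Fin d) : partialD i f x = 0 := by
  have : IsLocalMin f x := Filter.Eventually.of_forall fun y => by simpa [hx] using hf y
  simp [partialD, this.fderiv_eq_zero]

theorem partialD_congr_of_eventuallyEq {f g : (Fin d → ℝ) → ℝ} {x : Fin d → ℝ}
    (h : f =ᶠ[nhds x] g) (i : Fin d) : partialD i f x = partialD i g x := by
  simp [partialD, h.fderiv_eq]

theorem partialD_eventuallyEq {f g : (Fin d → ℝ) → ℝ} {x : Fin d → ℝ}
    (h : f =ᶠ[nhds x] g) (i : Fin d) : partialD i f =ᶠ[nhds x] partialD i g := by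
  filter_upwards [h.eventuallyEq_nhds] with y hy using partialD_congr_of_eventuallyEq hy i

theorem partialD_eq_zero_of_notMem_tsupport {f : (Fin d → ℝ) → ℝ} {x : Fin d → ℝ}
    (h : x ∉ tsupport f) (i : Fin d) : partialD i f x = 0 := by
  simp [partialD, fderiv_of_notMem_tsupport ℝ h]

theorem tsupport_partialD_subset (f : (Fin d → ℝ) → ℝ) (i : Fin d) :
    tsupport (partialD i f) ⊆ tsupport f := by
  refine closure_minimal (fun x hx => ?_) (isClosed_tsupport f)
  by_contra h
  exact hx (partialD_eq_zero_of_notMem_tsupport h i)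

/-- A quadratic polynomial that is nonnegative near zero has a small linear coefficient if its
constant coefficient is small. -/
theorem sq_le_of_quadratic_nonneg {f p M κ : ℝ} (hκ : 0 < κ) (hM : 0 ≤ M)
    (H : ∀ h, |h| ≤ κ → 0 ≤ f + p * h + M / 2 * h ^ 2) : p ^ 2 ≤ 2 * f * (M + |p| / κ) := by
  have hf : 0 ≤ f := by simpa using H 0 (by simpa using hκ.le)
  rcases eq_or_ne p 0 with rfl | hp
  · simp; positivity
  have hp' : 0 < |p| := abs_pos.2 hp
  -- Enlarging `M` to `N` only raises the quadratic, and it brings the minimiser `-p / N` into the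
  -- interval of radius `κ`.
  set N := M + |p| / κ with hN
  have hN0 : 0 < N := by positivity
  have h1 := H (-p / N) (by
    rw [abs_div, abs_neg, abs_of_pos hN0, div_le_iff₀ hN0, hN]
    have : κ * (|p| / κ) = |p| := by field_simp
    nlinarith)
  have h2 : M / 2 * (-p / N) ^ 2 ≤ N / 2 * (-p / N) ^ 2 := by
    gcongr
    rw [hN]
    linarith [div_pos hp' hκ]
  have h3 : f + p * (-p / N) + N / 2 * (-p / N) ^ 2 = f - p ^ 2 / (2 * N) := by
    field_simp; ring
  have h4 : p ^ 2 / (2 * N) ≤ f := by linarith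
  rw [div_le_iff₀ (by positivity)] at h4
  linarith

/-- Second order Taylor upper bound in one variable. -/
theorem le_taylor_of_deriv_le {f f' f'' : ℝ → ℝ} {κ M : ℝ}
    (hf : ∀ h, |h| ≤ κ → HasDerivAt f (f' h) h) (hf' : ∀ h, |h| ≤ κ → HasDerivAt f' (f'' h) h)
    (hM : ∀ h, |h| ≤ κ → f'' h ≤ M) (h : ℝ) (hh : |h| ≤ κ) :
    f h ≤ f 0 + f' 0 * h + M / 2 * h ^ 2 := by
  have hκ : 0 ≤ κ := (abs_nonneg h).trans hh
  -- the difference `φ` has antitone derivative which vanishes at zero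
  set φ : ℝ → ℝ := fun h => f h - f' 0 * h - M / 2 * h ^ 2 with hφ
  set φ' : ℝ → ℝ := fun h => f' h - f' 0 - M * h with hφ'
  have h1 : ∀ h, |h| ≤ κ → HasDerivAt φ (φ' h) h := fun h hh => by
    have := ((hf h hh).sub ((hasDerivAt_id h).const_mul (f' 0))).sub
      (((hasDerivAt_id h).pow 2).const_mul (M / 2))
    exact HasDerivAt.congr_deriv (f := φ) this (by simp [hφ']; ring)
  have h2 : ∀ h, |h| ≤ κ → HasDerivAt φ' (f'' h - M) h := fun h hh => by
    have := ((hf' h hh).sub_const (f' 0)).sub ((hasDerivAt_id h).const_mul M)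
    exact HasDerivAt.congr_deriv (f := φ') this (by simp)
  have hI : ∀ x ∈ Set.Icc (-κ) κ, |x| ≤ κ := fun x hx => abs_le.2 ⟨hx.1, hx.2⟩
  have anti : AntitoneOn φ' (Set.Icc (-κ) κ) := by
    refine antitoneOn_of_deriv_nonpos (convex_Icc _ _)
      (fun x hx => (h2 x (hI x hx)).continuousAt.continuousWithinAt)
      (fun x hx => (h2 x (hI x (interior_subset hx))).differentiableAt.differentiableWithinAt)
      (fun x hx => ?_)
    rw [(h2 x (hI x (interior_subset hx))).deriv]
    linarith [hM x (hI x (interior_subset hx))]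
  have hz : φ' 0 = 0 := by simp [hφ']
  have key : φ h ≤ φ 0 := by
    rcases le_total 0 h with h0 | h0
    · have : AntitoneOn φ (Set.Icc 0 κ) := by
        refine antitoneOn_of_deriv_nonpos (convex_Icc _ _)
          (fun x hx => (h1 x (hI x ⟨by linarith [hx.1], hx.2⟩)).continuousAt.continuousWithinAt)
          (fun x hx => ?_) (fun x hx => ?_)
        all_goals have hx' := interior_subset hx
        all_goals have hx'' : x ∈ Set.Icc (-κ) κ := ⟨by linarith [hx'.1], hx'.2⟩
        · exact (h1 x (hI x hx'')).differentiableAt.differentiableWithinAt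
        · rw [(h1 x (hI x hx'')).deriv, ← hz]
          exact anti ⟨by linarith, hκ⟩ hx'' hx'.1
      exact this ⟨le_rfl, hκ⟩ ⟨h0, (abs_le.1 hh).2⟩ h0
    · have : MonotoneOn φ (Set.Icc (-κ) 0) := by
        refine monotoneOn_of_deriv_nonneg (convex_Icc _ _)
          (fun x hx => (h1 x (hI x ⟨hx.1, by linarith [hx.2]⟩)).continuousAt.continuousWithinAt)
          (fun x hx => ?_) (fun x hx => ?_)
        all_goals have hx' := interior_subset hx
        all_goals have hx'' : x ∈ Set.Icc (-κ) κ := ⟨hx'.1, by linarith [hx'.2]⟩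
        · exact (h1 x (hI x hx'')).differentiableAt.differentiableWithinAt
        · rw [(h1 x (hI x hx'')).deriv, ← hz]
          exact anti hx'' ⟨by linarith, hκ⟩ hx'.2
      exact this ⟨(abs_le.1 hh).1, h0⟩ ⟨by linarith, le_rfl⟩ h0
  simp only [hφ] at key
  simp at key
  linarith

/-- A nonnegative `C²` function has a gradient that is at most of the order of its square root. -/
theorem sq_partialD_le {f : (Fin d → ℝ) → ℝ} (hf : ContDiff ℝ 2 f) (h0 : ∀ x, 0 ≤ f x) {κ M : ℝ}
    (hκ : 0 < κ) (hM0 : 0 ≤ M) (x : Fin d → ℝ) (i : Fin d)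
    (hM : ∀ h, |h| ≤ κ → partialD i (partialD i f) (x + Pi.single i h) ≤ M) :
    partialD i f x ^ 2 ≤ 2 * f x * (M + |partialD i f x| / κ) := by
  refine sq_le_of_quadratic_nonneg hκ hM0 fun h hh => ?_
  have h1 := le_taylor_of_deriv_le (f := fun h => f (x + Pi.single i h))
    (f' := fun h => partialD i f (x + Pi.single i h))
    (f'' := fun h => partialD i (partialD i f) (x + Pi.single i h)) (κ := κ) (M := M)
    (fun h _ => HasDerivAt.of_partialD i h (hf.differentiable two_ne_zero _))
    (fun h _ => HasDerivAt.of_partialD i h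
      ((hf.contDiff_one_partialD i).differentiable one_ne_zero _)) hM h hh
  simp only [Pi.single_zero, add_zero] at h1
  exact (h0 _).trans h1

/-- Almost everywhere on the zero set of a `C¹` function, the gradient vanishes. -/
theorem ae_partialD_eq_zero_of_eq_zero {f : (Fin d → ℝ) → ℝ} (hf : ContDiff ℝ 1 f) :
    ∀ᵐ x, f x = 0 → ∀ i, partialD i f x = 0 := by
  rcases Nat.eq_zero_or_pos d with rfl | hd
  · exact Filter.Eventually.of_forall fun x _ i => i.elim0
  have : Nonempty (Fin d) := ⟨⟨0, hd⟩⟩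
  -- The density point theorem below concerns maps of a space into itself, so `f` is repeated in
  -- every coordinate; this is where `0 < d` is used.
  let ψ : (Fin d → ℝ) → (Fin d → ℝ) := fun x _ => f x
  let ψ' : (Fin d → ℝ) → ((Fin d → ℝ) →L[ℝ] (Fin d → ℝ)) := fun x =>
    ContinuousLinearMap.pi fun _ => fderiv ℝ f x
  have hs : MeasurableSet {x | f x = 0} := (isClosed_eq hf.continuous continuous_const).measurableSet
  -- On the zero set `ψ` is constant, that is, approximated by the linear map `0` with error `0`. At
  -- density points of that set the full derivative must then be `0`.
  have h1 := ApproximatesLinearOn.norm_fderiv_sub_le (f := ψ) (A := 0) (δ := 0)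
    (s := {x | f x = 0}) volume (fun x hx y hy => by
      have : ψ x = ψ y := by
        funext k; exact (Eq.trans hx (Eq.symm hy) : f x = f y)
      simp [this]) hs ψ' (fun x _ => by
      refine HasFDerivAt.hasFDerivWithinAt ?_
      rw [hasFDerivAt_pi]
      exact fun _ => (hf.differentiable one_ne_zero x).hasFDerivAt)
  rw [ae_restrict_iff' hs] at h1
  filter_upwards [h1] with x hx h0 i
  have h2 : ψ' x = 0 := by simpa using hx h0
  have h3 := congrFun (congrArg (fun L => L (Pi.single i 1)) h2) ⟨0, hd⟩
  simpa [ψ', partialD] using h3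

end Calculus

/-! ### Fatou's lemma, an integrable weight, and the divergence theorem -/

section Integration

/-- Fatou's lemma for real functions that are bounded below by an integrable function. -/
theorem eventually_integral_ge_of_ge {α ι : Type*} [MeasurableSpace α] {μ : Measure α}
    {l : Filter ι} [l.IsCountablyGenerated] {f : ι → α → ℝ} {F h : α → ℝ}
    (hf : ∀ᶠ i in l, Integrable (f i) μ) (hF : Integrable F μ) (hh : Integrable h μ)
    (hlow : ∀ᶠ i in l, ∀ᵐ x ∂μ, -h x ≤ f i x)
    (hlim : ∀ᵐ x ∂μ, ∀ η > 0, ∀ᶠ i in l, F x - η ≤ f i x) {η : ℝ} (hη : 0 < η) :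
    ∀ᶠ i in l, ∫ x, F x ∂μ - η ≤ ∫ x, f i x ∂μ := by
  -- Truncation at `F` from above makes dominated convergence applicable: `min (f i) F` is bounded
  -- by `|h| + |F|` and tends to `F`, whatever `f i` does above `F`.
  have h1 : Filter.Tendsto (fun i => ∫ x, min (f i x) (F x) ∂μ) l (nhds (∫ x, F x ∂μ)) := by
    refine tendsto_integral_filter_of_dominated_convergence (fun x => |h x| + |F x|) ?_ ?_
      (hh.abs.add hF.abs) ?_
    · filter_upwards [hf] with i hi
      exact (hi.aestronglyMeasurable.inf hF.aestronglyMeasurable)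
    · filter_upwards [hlow] with i hi
      filter_upwards [hi] with x hx
      rw [Real.norm_eq_abs, abs_le]
      constructor
      · refine le_min ?_ ?_
        · linarith [le_abs_self (h x), abs_nonneg (F x)]
        · linarith [neg_abs_le (F x), abs_nonneg (h x)]
      · exact (min_le_right _ _).trans (by linarith [le_abs_self (F x), abs_nonneg (h x)])
    · filter_upwards [hlim] with x hx
      rw [Metric.tendsto_nhds]
      intro ε hε
      filter_upwards [hx (ε / 2) (half_pos hε)] with i hi
      rw [Real.dist_eq, abs_lt]
      constructor
      · have : F x - ε / 2 ≤ min (f i x) (F x) := le_min hi (by linarith)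
        linarith
      · linarith [min_le_right (f i x) (F x)]
  have h2 := h1.eventually (eventually_ge_nhds (show ∫ x, F x ∂μ - η < ∫ x, F x ∂μ by linarith))
  filter_upwards [h2, hf] with i hi hfi
  exact hi.trans (integral_mono (hfi.inf hF) hfi fun x => min_le_left _ _)

/-- The weight `(1 + ‖y‖)^{-(d+1)}`. -/
noncomputable def decayWeight {d : ℕ} (y : Fin d → ℝ) : ℝ := ((1 + ‖y‖) ^ (d + 1))⁻¹

theorem decayWeight_pos {d : ℕ} (y : Fin d → ℝ) : 0 < decayWeight y := by
  unfold decayWeight; positivity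

theorem decayWeight_le_one {d : ℕ} (y : Fin d → ℝ) : decayWeight y ≤ 1 := by
  unfold decayWeight
  exact inv_le_one_of_one_le₀ (one_le_pow₀ (by linarith [norm_nonneg y]))

theorem integrable_decayWeight {d : ℕ} : Integrable (decayWeight (d := d)) := by
  have h := integrable_one_add_norm (E := Fin d → ℝ) (μ := volume) (r := (d + 1 : ℕ))
    (by simp)
  refine h.congr (Filter.Eventually.of_forall fun y => ?_)
  simp only [decayWeight]
  rw [Real.rpow_neg (by positivity), Real.rpow_natCast]

/-- Of `p + d + 1` powers of decay, `d + 1` pay for an integrable factor and `p` remain to absorb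
coefficients of polynomial growth. -/
theorem le_mul_decayWeight {d p : ℕ} {y : Fin d → ℝ} {a c : ℝ}
    (h : (1 + ‖y‖) ^ (p + d + 1) * a ≤ c) : (1 + ‖y‖) ^ p * a ≤ c * decayWeight y := by
  unfold decayWeight
  rw [← div_eq_mul_inv, le_div_iff₀ (by positivity)]
  calc _ = (1 + ‖y‖) ^ (p + d + 1) * a := by ring
    _ ≤ c := h

theorem Continuous.integrable_of_le_decayWeight {d : ℕ} {f : (Fin d → ℝ) → ℝ}
    (hf : AEStronglyMeasurable f volume) {c : ℝ} (h : ∀ y, |f y| ≤ c * decayWeight y) :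
    Integrable f :=
  (integrable_decayWeight.const_mul c).mono' hf (Filter.Eventually.of_forall h)

/-- The divergence theorem on the whole space. -/
theorem integral_divergence_eq_zero {d : ℕ} {V : Fin d → (Fin d → ℝ) → ℝ}
    (hV : ∀ i, ContDiff ℝ 1 (V i)) (hi : ∀ i, Integrable (V i))
    (hd : Integrable (fun y => ∑ i, partialD i (V i) y)) :
    ∫ y, ∑ i, partialD i (V i) y = 0 := by
  -- The cutoffs `χ (c k • y)` with `c k → 0` exhaust the space. Their gradients are of order `c k`,
  -- so after an integration by parts the error is at most a multiple of `c k` times the integral of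
  -- `|V i|`.
  let χ : ContDiffBump (0 : Fin d → ℝ) := ⟨1, 2, one_pos, one_lt_two⟩
  have hχ : ContDiff ℝ ((⊤ : ℕ∞) : WithTop ℕ∞) (χ : (Fin d → ℝ) → ℝ) := χ.contDiff
  have hχ1 : ContDiff ℝ 1 (χ : (Fin d → ℝ) → ℝ) := χ.contDiff
  have hχc : HasCompactSupport (χ : (Fin d → ℝ) → ℝ) := χ.hasCompactSupport
  let c : ℕ → ℝ := fun k => 1 / ((k : ℝ) + 1)
  have hc0 : ∀ k, 0 < c k := fun k => by positivity
  have hc : Filter.Tendsto c Filter.atTop (nhds 0) := tendsto_one_div_add_atTop_nhds_zero_nat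
  let X : ℕ → (Fin d → ℝ) → ℝ := fun k y => χ (c k • y)
  have hX : ∀ k, ContDiff ℝ 1 (X k) := fun k => hχ1.comp (contDiff_const_smul _)
  have hXc : ∀ k, HasCompactSupport (X k) := fun k =>
    hχc.comp_homeomorph (Homeomorph.smulOfNeZero (c k) (hc0 k).ne')
  have hXd : ∀ k i y, partialD i (X k) y = c k * partialD i χ (c k • y) := by
    intro k i y
    simp only [partialD, X]
    have := fderiv_comp_smul (𝕜 := ℝ) (f := (χ : (Fin d → ℝ) → ℝ)) (c k) (x := y)
    rw [this]; simp
  have hM : ∀ i, ∃ M, ∀ y, |partialD i (χ : (Fin d → ℝ) → ℝ) y| ≤ M := fun i => by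
    have hcont := hχ1.continuous_partialD i
    have hcs : HasCompactSupport (partialD i (χ : (Fin d → ℝ) → ℝ)) :=
      hχc.mono' ((subset_tsupport _).trans (tsupport_partialD_subset _ i))
    exact hcs.exists_bound_of_continuous hcont
  choose M hM using hM
  have ibp : ∀ k i, ∫ y, X k y * partialD i (V i) y = -∫ y, partialD i (X k) y * V i y := by
    intro k i
    have hcs : HasCompactSupport (partialD i (X k)) :=
      (hXc k).mono' ((subset_tsupport _).trans (tsupport_partialD_subset _ i))
    refine integral_mul_fderiv_eq_neg_fderiv_mul_of_integrable ?_ ?_ ?_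
      (fun x _ => (hX k).differentiable one_ne_zero x)
      (fun x _ => (hV i).differentiable one_ne_zero x)
    · exact (((hX k).continuous_partialD i).mul (hV i).continuous).integrable_of_hasCompactSupport
        hcs.mul_right
    · exact ((hX k).continuous.mul ((hV i).continuous_partialD i)).integrable_of_hasCompactSupport
        (hXc k).mul_right
    · exact ((hX k).continuous.mul (hV i).continuous).integrable_of_hasCompactSupport
        (hXc k).mul_right
  have e1 : ∀ k, ∫ y, X k y * ∑ i, partialD i (V i) y
      = ∑ i, -∫ y, partialD i (X k) y * V i y := by
    intro k
    simp_rw [Finset.mul_sum]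
    rw [integral_finsetSum]
    · exact Finset.sum_congr rfl fun i _ => ibp k i
    · exact fun i _ => ((hX k).continuous.mul
        ((hV i).continuous_partialD i)).integrable_of_hasCompactSupport (hXc k).mul_right
  have t1 : Filter.Tendsto (fun k => ∫ y, X k y * ∑ i, partialD i (V i) y) Filter.atTop
      (nhds (∫ y, ∑ i, partialD i (V i) y)) := by
    refine tendsto_integral_of_dominated_convergence (fun y => |∑ i, partialD i (V i) y|)
      (fun k => (hX k).continuous.aestronglyMeasurable.mul hd.aestronglyMeasurable) hd.abs
      (fun k => Filter.Eventually.of_forall fun y => ?_) (Filter.Eventually.of_forall fun y => ?_)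
    · rw [Real.norm_eq_abs, abs_mul]
      refine mul_le_of_le_one_left (abs_nonneg _) ?_
      rw [abs_of_nonneg χ.nonneg]
      exact χ.le_one
    · have : Filter.Tendsto (fun k => X k y) Filter.atTop (nhds 1) := by
        have h0 : (χ : (Fin d → ℝ) → ℝ) ((0 : ℝ) • y) = 1 := by
          rw [zero_smul]
          exact χ.one_of_mem_closedBall (by simp [χ])
        rw [← h0]
        exact (hχ1.continuous.tendsto _).comp (hc.smul_const y)
      simpa using this.mul_const _
  have t2 : Filter.Tendsto (fun k => ∑ i, -∫ y, partialD i (X k) y * V i y) Filter.atTop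
      (nhds (∑ _i : Fin d, 0)) := by
    refine tendsto_finsetSum _ fun i _ => ?_
    refine squeeze_zero_norm (a := fun k => c k * (M i * ∫ y, |V i y|)) (fun k => ?_) ?_
    · rw [norm_neg, ← integral_const_mul, ← integral_const_mul]
      refine norm_integral_le_of_norm_le (((hi i).abs.const_mul _).const_mul _)
        (Filter.Eventually.of_forall fun y => ?_)
      rw [hXd, Real.norm_eq_abs, abs_mul, abs_mul, abs_of_pos (hc0 k), mul_assoc]
      gcongr
      exact hM i _
    · simpa using hc.mul_const (M i * ∫ y, |V i y|)
  simp_rw [e1] at t1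
  simpa using tendsto_nhds_unique t1 t2

end Integration

/-! ### Splitting off the first coordinate -/

section Slices

variable {d : ℕ}

/-- The linear map that prepends the coordinate `0`. -/
noncomputable def consZeroCLM (d : ℕ) : (Fin d → ℝ) →L[ℝ] (Fin (d + 1) → ℝ) :=
  ContinuousLinearMap.pi (Fin.cons 0 (fun i => ContinuousLinearMap.proj i))

/-- The linear map that forgets the first coordinate. -/
noncomputable def tailCLM (d : ℕ) : (Fin (d + 1) → ℝ) →L[ℝ] (Fin d → ℝ) :=
  ContinuousLinearMap.pi (fun i => ContinuousLinearMap.proj i.succ)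

theorem cons_eq_consZeroCLM_add (a : ℝ) (y : Fin d → ℝ) :
    (Fin.cons a y : Fin (d + 1) → ℝ) = consZeroCLM d y + Pi.single 0 a := by
  funext k
  refine Fin.cases ?_ (fun i => ?_) k
  · simp [consZeroCLM]
  · simp [consZeroCLM]

theorem consZeroCLM_single (i : Fin d) :
    consZeroCLM d (Pi.single i 1) = Pi.single i.succ 1 := by
  funext k
  refine Fin.cases ?_ (fun j => ?_) k
  · simp [consZeroCLM]
  · by_cases h : j = i
    · subst h; simp [consZeroCLM]
    · simp [consZeroCLM, h]

theorem hasFDerivAt_cons (a : ℝ) (y : Fin d → ℝ) :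
    HasFDerivAt (fun y : Fin d → ℝ => (Fin.cons a y : Fin (d + 1) → ℝ)) (consZeroCLM d) y := by
  simp_rw [cons_eq_consZeroCLM_add]
  exact (consZeroCLM d).hasFDerivAt.add_const _

theorem contDiff_cons {k : WithTop ℕ∞} (a : ℝ) :
    ContDiff ℝ k (fun y : Fin d → ℝ => (Fin.cons a y : Fin (d + 1) → ℝ)) := by
  simp_rw [cons_eq_consZeroCLM_add]
  exact (consZeroCLM d).contDiff.add contDiff_const

theorem contDiff_tail {k : WithTop ℕ∞} :
    ContDiff ℝ k (fun x : Fin (d + 1) → ℝ => (Fin.tail x : Fin d → ℝ)) :=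
  (tailCLM d).contDiff

theorem continuous_cons_prod :
    Continuous (fun z : ℝ × (Fin d → ℝ) => (Fin.cons z.1 z.2 : Fin (d + 1) → ℝ)) := by
  simp_rw [cons_eq_consZeroCLM_add]
  refine ((consZeroCLM d).continuous.comp continuous_snd).add ?_
  exact (continuous_single (A := fun _ : Fin (d + 1) => ℝ) 0).comp continuous_fst

theorem norm_le_norm_cons (a : ℝ) (y : Fin d → ℝ) :
    ‖y‖ ≤ ‖(Fin.cons a y : Fin (d + 1) → ℝ)‖ := by
  refine (pi_norm_le_iff_of_nonneg (norm_nonneg _)).2 fun i => ?_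
  simpa using norm_le_pi_norm (Fin.cons a y : Fin (d + 1) → ℝ) i.succ

theorem partialD_comp_cons {f : (Fin (d + 1) → ℝ) → ℝ} {a : ℝ} {y : Fin d → ℝ}
    (hf : DifferentiableAt ℝ f (Fin.cons a y)) (i : Fin d) :
    partialD i (fun y => f (Fin.cons a y)) y = partialD i.succ f (Fin.cons a y) := by
  have := (hf.hasFDerivAt.comp y (hasFDerivAt_cons a y)).fderiv
  simp only [partialD]
  rw [show (fun y : Fin d → ℝ => f (Fin.cons a y)) = f ∘ (fun y => Fin.cons a y) from rfl, this]
  simp [consZeroCLM_single]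

theorem partialD_succ_comp_tail {f : (Fin d → ℝ) → ℝ} {x : Fin (d + 1) → ℝ}
    (hf : DifferentiableAt ℝ f (Fin.tail x)) (i : Fin d) :
    partialD i.succ (fun x => f (Fin.tail x)) x = partialD i f (Fin.tail x) := by
  have := (hf.hasFDerivAt.comp x (tailCLM d).hasFDerivAt).fderiv
  simp only [partialD]
  rw [show (fun x : Fin (d + 1) → ℝ => f (Fin.tail x)) = f ∘ Fin.tail from rfl, this]
  simp only [ContinuousLinearMap.comp_apply]
  congr 1
  funext j
  by_cases h : j = i
  · subst h; simp [tailCLM]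
  · simp [tailCLM, h]

theorem partialD_zero_comp_tail {f : (Fin d → ℝ) → ℝ} {x : Fin (d + 1) → ℝ}
    (hf : DifferentiableAt ℝ f (Fin.tail x)) :
    partialD 0 (fun x => f (Fin.tail x)) x = 0 := by
  have := (hf.hasFDerivAt.comp x (tailCLM d).hasFDerivAt).fderiv
  simp only [partialD]
  rw [show (fun x : Fin (d + 1) → ℝ => f (Fin.tail x)) = f ∘ Fin.tail from rfl, this]
  simp only [ContinuousLinearMap.comp_apply]
  have : tailCLM d (Pi.single 0 1) = 0 := by
    funext j; simp [tailCLM]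
  rw [this]; simp

end Slices

/-! ### Rapidly decreasing families in time -/

/-- `w` is twice continuously differentiable in space and differentiable in time on `[t₀, t₁]` with
time derivative `wt`, and these derivatives decrease rapidly in space with the constants `K`. -/
structure IsDecayingFamily {d : ℕ} (K : ℕ → ℝ) (t₀ t₁ : ℝ) (w wt : ℝ → (Fin d → ℝ) → ℝ) :
    Prop where
  contDiff : ∀ s ∈ Set.Icc t₀ t₁, ContDiff ℝ 2 (w s)
  continuousOn : ContinuousOn (fun z : ℝ × (Fin d → ℝ) => w z.1 z.2) (Set.Icc t₀ t₁ ×ˢ Set.univ)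
  continuousOn_partialD : ∀ i, ContinuousOn (fun z : ℝ × (Fin d → ℝ) => partialD i (w z.1) z.2)
    (Set.Icc t₀ t₁ ×ˢ Set.univ)
  continuousOn_partialD_partialD : ∀ i j, ContinuousOn
    (fun z : ℝ × (Fin d → ℝ) => partialD i (partialD j (w z.1)) z.2) (Set.Icc t₀ t₁ ×ˢ Set.univ)
  hasDerivWithinAt : ∀ s ∈ Set.Icc t₀ t₁, ∀ y,
    HasDerivWithinAt (fun s => w s y) (wt s y) (Set.Icc t₀ t₁) s
  continuousOn_deriv : ContinuousOn (fun z : ℝ × (Fin d → ℝ) => wt z.1 z.2)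
    (Set.Icc t₀ t₁ ×ˢ Set.univ)
  bound : ∀ N, ∀ s ∈ Set.Icc t₀ t₁, ∀ y, (1 + ‖y‖) ^ N * |w s y| ≤ K N
  bound_partialD : ∀ i N, ∀ s ∈ Set.Icc t₀ t₁, ∀ y, (1 + ‖y‖) ^ N * |partialD i (w s) y| ≤ K N
  bound_partialD_partialD : ∀ i j N, ∀ s ∈ Set.Icc t₀ t₁, ∀ y,
    (1 + ‖y‖) ^ N * |partialD i (partialD j (w s)) y| ≤ K N
  bound_deriv : ∀ N, ∀ s ∈ Set.Icc t₀ t₁, ∀ y, (1 + ‖y‖) ^ N * |wt s y| ≤ K N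
  lipschitz_deriv : ∀ N, ∀ s ∈ Set.Icc t₀ t₁, ∀ r ∈ Set.Icc t₀ t₁, ∀ y,
    (1 + ‖y‖) ^ N * |wt s y - wt r y| ≤ K N * |s - r|

/-- The time derivative of a family of functions on `[t₀, t₁]`. -/
noncomputable def timeDeriv {d : ℕ} (t₀ t₁ : ℝ) (w : ℝ → (Fin d → ℝ) → ℝ) (s : ℝ)
    (y : Fin d → ℝ) : ℝ :=
  fderivWithin ℝ (fun z : ℝ × (Fin d → ℝ) => w z.1 z.2) (Set.Icc t₀ t₁ ×ˢ Set.univ) (s, y) (1, 0)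

section Regularity

variable {d : ℕ} {t₀ t₁ : ℝ} {w : ℝ → (Fin d → ℝ) → ℝ}

theorem hasFDerivAt_slice_of_hasFDerivWithinAt {G : Type*} [NormedAddCommGroup G] [NormedSpace ℝ G]
    {W : ℝ × (Fin d → ℝ) → G} {L : ℝ × (Fin d → ℝ) →L[ℝ] G} {s : ℝ} {y : Fin d → ℝ}
    (hs : s ∈ Set.Icc t₀ t₁)
    (h : HasFDerivWithinAt W L (Set.Icc t₀ t₁ ×ˢ Set.univ) (s, y)) :
    HasFDerivAt (fun y => W (s, y)) (L.comp (ContinuousLinearMap.inr ℝ ℝ (Fin d → ℝ))) y :=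
  h.comp_hasFDerivAt y (hasFDerivAt_prodMk_right s y)
    (Filter.Eventually.of_forall fun y => ⟨hs, Set.mem_univ y⟩)

theorem hasDerivWithinAt_of_hasFDerivWithinAt {G : Type*} [NormedAddCommGroup G] [NormedSpace ℝ G]
    {W : ℝ × (Fin d → ℝ) → G} {L : ℝ × (Fin d → ℝ) →L[ℝ] G} {s : ℝ} {y : Fin d → ℝ}
    (h : HasFDerivWithinAt W L (Set.Icc t₀ t₁ ×ˢ Set.univ) (s, y)) :
    HasDerivWithinAt (fun s => W (s, y)) (L (1, 0)) (Set.Icc t₀ t₁) s := by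
  have hm : Set.MapsTo (fun r : ℝ => (r, y)) (Set.Icc t₀ t₁)
      (Set.Icc t₀ t₁ ×ˢ (Set.univ : Set (Fin d → ℝ))) := fun r hr => ⟨hr, Set.mem_univ y⟩
  have h0 : HasFDerivWithinAt (fun r : ℝ => (r, y)) (ContinuousLinearMap.inl ℝ ℝ (Fin d → ℝ))
      (Set.Icc t₀ t₁) s := (hasFDerivAt_prodMk_left s y).hasFDerivWithinAt
  have h1 := HasFDerivWithinAt.comp s h h0 hm
  exact HasDerivWithinAt.congr_deriv (f := fun s => W (s, y)) h1.hasDerivWithinAt (by simp)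

theorem ContDiffOn.hasDerivWithinAt_timeDeriv
    (hw : ContDiffOn ℝ 1 (fun z : ℝ × (Fin d → ℝ) => w z.1 z.2) (Set.Icc t₀ t₁ ×ˢ Set.univ))
    {s : ℝ} (hs : s ∈ Set.Icc t₀ t₁) (y : Fin d → ℝ) :
    HasDerivWithinAt (fun s => w s y) (timeDeriv t₀ t₁ w s y) (Set.Icc t₀ t₁) s :=
  hasDerivWithinAt_of_hasFDerivWithinAt
    (hw.differentiableOn one_ne_zero (s, y) ⟨hs, Set.mem_univ y⟩).hasFDerivWithinAt

theorem uniqueDiffOn_Icc_prod_univ (h : t₀ < t₁) :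
    UniqueDiffOn ℝ (Set.Icc t₀ t₁ ×ˢ (Set.univ : Set (Fin d → ℝ))) :=
  (uniqueDiffOn_Icc h).prod uniqueDiffOn_univ

theorem ContDiffOn.continuousOn_timeDeriv (h01 : t₀ < t₁)
    (hw : ContDiffOn ℝ 1 (fun z : ℝ × (Fin d → ℝ) => w z.1 z.2) (Set.Icc t₀ t₁ ×ˢ Set.univ)) :
    ContinuousOn (fun z : ℝ × (Fin d → ℝ) => timeDeriv t₀ t₁ w z.1 z.2)
      (Set.Icc t₀ t₁ ×ˢ Set.univ) :=
  (hw.continuousOn_fderivWithin (uniqueDiffOn_Icc_prod_univ h01) le_rfl).clm_apply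
    continuousOn_const

theorem ContDiffOn.contDiff_slice {k : WithTop ℕ∞}
    (hw : ContDiffOn ℝ k (fun z : ℝ × (Fin d → ℝ) => w z.1 z.2) (Set.Icc t₀ t₁ ×ˢ Set.univ))
    {s : ℝ} (hs : s ∈ Set.Icc t₀ t₁) : ContDiff ℝ k (w s) :=
  hw.comp_contDiff (f := fun y => (s, y)) (contDiff_const.prodMk contDiff_id)
    fun y => ⟨hs, Set.mem_univ y⟩

/-- Everything is read off the first and second derivatives within the slab: spatial derivatives by
evaluation at `(0, eᵢ)`, the time derivative by evaluation at `(1, 0)`. These vectors have norm at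
most one, so the constants do not change. The Lipschitz bound for the time derivative is the mean
value inequality for the second derivative at `(1, 0), (1, 0)`. -/
theorem IsRapidlyDecreasing.isDecayingFamily {C : ℕ → ℝ} (h01 : t₀ < t₁)
    (h : IsRapidlyDecreasing C t₀ t₁ w) : IsDecayingFamily C t₀ t₁ w (timeDeriv t₀ t₁ w) := by
  obtain ⟨hw, hb⟩ := h
  set S : Set (ℝ × (Fin d → ℝ)) := Set.Icc t₀ t₁ ×ˢ Set.univ with hS
  have hU : UniqueDiffOn ℝ S := uniqueDiffOn_Icc_prod_univ h01
  set W : ℝ × (Fin d → ℝ) → ℝ := fun z => w z.1 z.2 with hW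
  set W1 := fderivWithin ℝ W S with hW1
  set W2 := fderivWithin ℝ W1 S with hW2
  have c1 : ContDiffOn ℝ 1 W1 S := hw.fderivWithin hU (by norm_num)
  have c2 : ContinuousOn W2 S := c1.continuousOn_fderivWithin hU le_rfl
  have d1 : ∀ z ∈ S, HasFDerivWithinAt W (W1 z) S z := fun z hz =>
    (hw.differentiableOn two_ne_zero z hz).hasFDerivWithinAt
  have d2 : ∀ z ∈ S, HasFDerivWithinAt W1 (W2 z) S z := fun z hz =>
    (c1.differentiableOn one_ne_zero z hz).hasFDerivWithinAt
  have memS : ∀ s ∈ Set.Icc t₀ t₁, ∀ y, (s, y) ∈ S := fun s hs y => ⟨hs, Set.mem_univ y⟩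
  have p1 : ∀ s ∈ Set.Icc t₀ t₁, ∀ i, partialD i (w s) = fun y => W1 (s, y) (0, Pi.single i 1) := by
    intro s hs i
    funext y
    have := (hasFDerivAt_slice_of_hasFDerivWithinAt hs (d1 _ (memS s hs y))).fderiv
    simp only [partialD]
    rw [show w s = fun y => W (s, y) from rfl, this]
    simp
  have p2 : ∀ s ∈ Set.Icc t₀ t₁, ∀ i j y, partialD i (partialD j (w s)) y
      = W2 (s, y) (0, Pi.single i 1) (0, Pi.single j 1) := by
    intro s hs i j y
    rw [p1 s hs j]
    have h1 := hasFDerivAt_slice_of_hasFDerivWithinAt hs (d2 _ (memS s hs y))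
    have h2 := (h1.clm_apply (hasFDerivAt_const ((0 : ℝ), (Pi.single j 1 : Fin d → ℝ)) y)).fderiv
    simp only [partialD]
    rw [h2]
    simp
  have n1 : ∀ i : Fin d, ‖((0 : ℝ), (Pi.single i 1 : Fin d → ℝ))‖ ≤ 1 := by
    intro i
    simp [Prod.norm_def, Pi.norm_single]
  have n0 : ‖((1 : ℝ), (0 : Fin d → ℝ))‖ ≤ 1 := by simp [Prod.norm_def]
  have b0 : ∀ N, ∀ z ∈ S, (1 + ‖z.2‖) ^ N * ‖W z‖ ≤ C N := by
    intro N z hz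
    have := hb N 0 (by norm_num) z.1 hz.1 z.2
    simpa using this
  have b1 : ∀ N, ∀ z ∈ S, (1 + ‖z.2‖) ^ N * ‖W1 z‖ ≤ C N := by
    intro N z hz
    have := hb N 1 (by norm_num) z.1 hz.1 z.2
    rwa [norm_iteratedFDerivWithin_one _ (hU _ hz)] at this
  have b2 : ∀ N, ∀ z ∈ S, (1 + ‖z.2‖) ^ N * ‖W2 z‖ ≤ C N := by
    intro N z hz
    have := hb N 2 le_rfl z.1 hz.1 z.2
    rwa [show (2 : ℕ) = 1 + 1 from rfl, ← norm_iteratedFDerivWithin_fderivWithin hU hz,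
      norm_iteratedFDerivWithin_one _ (hU _ hz)] at this
  have le1 : ∀ {N : ℕ} {y : Fin d → ℝ} {a b : ℝ}, a ≤ b → (1 + ‖y‖) ^ N * b ≤ C N →
      (1 + ‖y‖) ^ N * a ≤ C N := fun hab h => (by gcongr : _ ≤ _).trans h
  have app1 : ∀ z v, ‖v‖ ≤ 1 → |W1 z v| ≤ ‖W1 z‖ := fun z v hv => by
    have := (W1 z).le_opNorm v
    exact this.trans (mul_le_of_le_one_right (norm_nonneg _) hv)
  have app2 : ∀ z v v', ‖v‖ ≤ 1 → ‖v'‖ ≤ 1 → |W2 z v v'| ≤ ‖W2 z‖ := fun z v v' hv hv' => by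
    have := (W2 z).le_opNorm₂ v v'
    refine this.trans ?_
    calc ‖W2 z‖ * ‖v‖ * ‖v'‖ ≤ ‖W2 z‖ * 1 * 1 := by gcongr
      _ = _ := by ring
  refine ⟨fun s hs => hw.contDiff_slice hs, hw.continuousOn, fun i => ?_, fun i j => ?_,
    fun s hs y => (hw.of_le one_le_two).hasDerivWithinAt_timeDeriv hs y,
    (hw.of_le one_le_two).continuousOn_timeDeriv h01,
    fun N s hs y => by simpa using b0 N (s, y) (memS s hs y), fun i N s hs y => ?_,
    fun i j N s hs y => ?_, fun N s hs y => ?_, fun N s hs r hr y => ?_⟩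
  · refine (c1.continuousOn.clm_apply (continuousOn_const (c := (0, Pi.single i 1)))).congr ?_
    intro z hz
    simp only [p1 z.1 hz.1 i]
  · refine ((c2.clm_apply (continuousOn_const (c := (0, Pi.single i 1)))).clm_apply
      (continuousOn_const (c := (0, Pi.single j 1)))).congr ?_
    intro z hz
    simp only [p2 z.1 hz.1 i j]
  · rw [p1 s hs]
    exact le1 (app1 _ _ (n1 i)) (b1 N (s, y) (memS s hs y))
  · rw [p2 s hs]
    exact le1 (app2 _ _ _ (n1 i) (n1 j)) (b2 N (s, y) (memS s hs y))
  · exact le1 (app1 _ _ n0) (b1 N (s, y) (memS s hs y))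
  · have hder : ∀ r ∈ Set.Icc t₀ t₁, HasDerivWithinAt (fun r => timeDeriv t₀ t₁ w r y)
        (W2 (r, y) (1, 0) (1, 0)) (Set.Icc t₀ t₁) r := by
      intro r hr
      have h1 := hasDerivWithinAt_of_hasFDerivWithinAt (d2 _ (memS r hr y))
      have h2 := h1.clm_apply (hasDerivWithinAt_const r (Set.Icc t₀ t₁) ((1 : ℝ), (0 : Fin d → ℝ)))
      exact HasDerivWithinAt.congr_deriv (f := fun r => timeDeriv t₀ t₁ w r y) h2 (by simp)
    have hpos : (0 : ℝ) < (1 + ‖y‖) ^ N := by positivity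
    have := (convex_Icc t₀ t₁).norm_image_sub_le_of_norm_hasDerivWithin_le
      (C := C N / (1 + ‖y‖) ^ N) hder (fun r hr => by
        rw [le_div_iff₀ hpos, mul_comm]
        exact le1 (app2 _ _ _ n0 n0) (b2 N (r, y) (memS r hr y))) hr hs
    simp only [Real.norm_eq_abs] at this
    calc (1 + ‖y‖) ^ N * |timeDeriv t₀ t₁ w s y - timeDeriv t₀ t₁ w r y|
        ≤ (1 + ‖y‖) ^ N * (C N / (1 + ‖y‖) ^ N * |s - r|) := by gcongr
      _ = C N * |s - r| := by field_simp

variable {K : ℕ → ℝ} {wt : ℝ → (Fin d → ℝ) → ℝ}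

namespace IsDecayingFamily

theorem mono (h : IsDecayingFamily K t₀ t₁ w wt) {K' : ℕ → ℝ} (hK : ∀ N, K N ≤ K' N) :
    IsDecayingFamily K' t₀ t₁ w wt where
  contDiff := h.contDiff
  continuousOn := h.continuousOn
  continuousOn_partialD := h.continuousOn_partialD
  continuousOn_partialD_partialD := h.continuousOn_partialD_partialD
  hasDerivWithinAt := h.hasDerivWithinAt
  continuousOn_deriv := h.continuousOn_deriv
  bound N s hs y := (h.bound N s hs y).trans (hK N)
  bound_partialD i N s hs y := (h.bound_partialD i N s hs y).trans (hK N)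
  bound_partialD_partialD i j N s hs y := (h.bound_partialD_partialD i j N s hs y).trans (hK N)
  bound_deriv N s hs y := (h.bound_deriv N s hs y).trans (hK N)
  lipschitz_deriv N s hs r hr y := (h.lipschitz_deriv N s hs r hr y).trans
    (mul_le_mul_of_nonneg_right (hK N) (abs_nonneg _))

theorem lipschitz (h : IsDecayingFamily K t₀ t₁ w wt) (N : ℕ) {s r : ℝ}
    (hs : s ∈ Set.Icc t₀ t₁) (hr : r ∈ Set.Icc t₀ t₁) (y : Fin d → ℝ) :
    (1 + ‖y‖) ^ N * |w s y - w r y| ≤ K N * |s - r| := by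
  have hpos : (0 : ℝ) < (1 + ‖y‖) ^ N := by positivity
  have := (convex_Icc t₀ t₁).norm_image_sub_le_of_norm_hasDerivWithin_le
      (C := K N / (1 + ‖y‖) ^ N) (fun r hr => h.hasDerivWithinAt r hr y) (fun r hr => by
        rw [le_div_iff₀ hpos, mul_comm]
        exact h.bound_deriv N r hr y) hr hs
  simp only [Real.norm_eq_abs] at this
  calc (1 + ‖y‖) ^ N * |w s y - w r y|
      ≤ (1 + ‖y‖) ^ N * (K N / (1 + ‖y‖) ^ N * |s - r|) := by gcongr
    _ = K N * |s - r| := by field_simp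

/-- Mean value inequality for `w r y - (r - t₀) * wt t₀ y`, whose time derivative is of order `s -
t₀` by the Lipschitz bound for `wt`. This costs the factor `1 / 2` of Taylor's formula. -/
theorem taylor (h : IsDecayingFamily K t₀ t₁ w wt) (N : ℕ) {s : ℝ}
    (hs : s ∈ Set.Icc t₀ t₁) (y : Fin d → ℝ) :
    (1 + ‖y‖) ^ N * |w s y - w t₀ y - (s - t₀) * wt t₀ y| ≤ K N * (s - t₀) ^ 2 := by
  have hpos : (0 : ℝ) < (1 + ‖y‖) ^ N := by positivity
  have h0 : t₀ ∈ Set.Icc t₀ t₁ := ⟨le_rfl, hs.1.trans hs.2⟩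
  have hsub : Set.Icc t₀ s ⊆ Set.Icc t₀ t₁ := Set.Icc_subset_Icc_right hs.2
  have hK : 0 ≤ K N := le_trans (by positivity) (h.bound N s hs y)
  have := (convex_Icc t₀ s).norm_image_sub_le_of_norm_hasDerivWithin_le
      (f := fun r => w r y - (r - t₀) * wt t₀ y) (f' := fun r => wt r y - wt t₀ y)
      (C := K N / (1 + ‖y‖) ^ N * (s - t₀)) (x := t₀) (y := s)
      (fun r hr => by
        have h1 := ((h.hasDerivWithinAt r (hsub hr) y).mono hsub).sub
          (((hasDerivWithinAt_id r (Set.Icc t₀ s)).sub_const t₀).mul_const (wt t₀ y))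
        exact HasDerivWithinAt.congr_deriv (f := fun r => w r y - (r - t₀) * wt t₀ y) h1 (by simp))
      (fun r hr => by
        have h1 := h.lipschitz_deriv N r (hsub hr) t₀ h0 y
        rw [div_mul_eq_mul_div, le_div_iff₀ hpos, mul_comm]
        refine h1.trans ?_
        rw [abs_of_nonneg (by linarith [hr.1])]
        have := hr.2
        gcongr)
      ⟨le_rfl, hs.1⟩ ⟨hs.1, le_rfl⟩
  simp only [Real.norm_eq_abs, sub_self, zero_mul, sub_zero] at this
  rw [abs_of_nonneg (by linarith [hs.1] : 0 ≤ s - t₀)] at this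
  calc (1 + ‖y‖) ^ N * |w s y - w t₀ y - (s - t₀) * wt t₀ y|
      = (1 + ‖y‖) ^ N * |w s y - (s - t₀) * wt t₀ y - w t₀ y| := by congr 2; ring
    _ ≤ (1 + ‖y‖) ^ N * (K N / (1 + ‖y‖) ^ N * (s - t₀) * (s - t₀)) := by gcongr
    _ = K N * (s - t₀) ^ 2 := by field_simp

/-- Restriction to a hyperplane on which the first variable is constant. -/
theorem slice {w wt : ℝ → (Fin (d + 1) → ℝ) → ℝ} (h : IsDecayingFamily K t₀ t₁ w wt) (a : ℝ) :
    IsDecayingFamily K t₀ t₁ (fun s (y : Fin d → ℝ) => w s (Fin.cons a y))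
      (fun s y => wt s (Fin.cons a y)) := by
  have e1 : ∀ s ∈ Set.Icc t₀ t₁, ∀ i : Fin d, partialD i (fun y => w s (Fin.cons a y))
      = fun y => partialD i.succ (w s) (Fin.cons a y) := fun s hs i => by
    funext y
    exact partialD_comp_cons ((h.contDiff s hs).differentiable two_ne_zero _) i
  have e2 : ∀ s ∈ Set.Icc t₀ t₁, ∀ (i j : Fin d) y,
      partialD i (partialD j (fun y => w s (Fin.cons a y))) y
      = partialD i.succ (partialD j.succ (w s)) (Fin.cons a y) := fun s hs i j y => by
    rw [e1 s hs j]
    exact partialD_comp_cons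
      (((h.contDiff s hs).contDiff_one_partialD _).differentiable one_ne_zero _) i
  have hm : Set.MapsTo (fun z : ℝ × (Fin d → ℝ) => (z.1, (Fin.cons a z.2 : Fin (d + 1) → ℝ)))
      (Set.Icc t₀ t₁ ×ˢ Set.univ) (Set.Icc t₀ t₁ ×ˢ Set.univ) := fun z hz => ⟨hz.1, Set.mem_univ _⟩
  have hc : ContinuousOn (fun z : ℝ × (Fin d → ℝ) => (z.1, (Fin.cons a z.2 : Fin (d + 1) → ℝ)))
      (Set.Icc t₀ t₁ ×ˢ Set.univ) :=
    (continuous_fst.prodMk ((contDiff_cons (k := 0) a).continuous.comp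
      continuous_snd)).continuousOn
  have le1 : ∀ {N : ℕ} {y : Fin d → ℝ} {b c : ℝ}, 0 ≤ b →
      (1 + ‖(Fin.cons a y : Fin (d + 1) → ℝ)‖) ^ N * b ≤ c → (1 + ‖y‖) ^ N * b ≤ c := by
    intro N y b c hb hc
    refine le_trans ?_ hc
    have := norm_le_norm_cons a y
    gcongr
  refine ⟨fun s hs => (h.contDiff s hs).comp (contDiff_cons a), h.continuousOn.comp hc hm,
    fun i => ?_, fun i j => ?_, fun s hs y => h.hasDerivWithinAt s hs _,
    h.continuousOn_deriv.comp hc hm, fun N s hs y => le1 (abs_nonneg _) (h.bound N s hs _),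
    fun i N s hs y => ?_, fun i j N s hs y => ?_,
    fun N s hs y => le1 (abs_nonneg _) (h.bound_deriv N s hs _),
    fun N s hs r hr y => le1 (abs_nonneg _) (h.lipschitz_deriv N s hs r hr _)⟩
  · refine ((h.continuousOn_partialD i.succ).comp hc hm).congr fun z hz => ?_
    simp only [e1 z.1 hz.1, Function.comp]
  · refine ((h.continuousOn_partialD_partialD i.succ j.succ).comp hc hm).congr fun z hz => ?_
    simp only [e2 z.1 hz.1, Function.comp]
  · rw [e1 s hs]
    exact le1 (abs_nonneg _) (h.bound_partialD i.succ N s hs _)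
  · rw [e2 s hs]
    exact le1 (abs_nonneg _) (h.bound_partialD_partialD i.succ j.succ N s hs _)

end IsDecayingFamily

end Regularity

/-! ### Expectations expressed through densities -/

section Densities

variable {d : ℕ} {Ω : Type*} [MeasurableSpace Ω] {P : Measure Ω} {Y : Ω → (Fin d → ℝ)}
  {w : (Fin d → ℝ) → ℝ}

theorem IsPDFOf.integral_comp (h : IsPDFOf P Y w) (hY : AEMeasurable Y P) (hw : Measurable w)
    {g : (Fin d → ℝ) → ℝ} (hg : Measurable g) :
    ∫ ω, g (Y ω) ∂P = ∫ x, w x * g x := by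
  rw [← integral_map (φ := Y) (f := g) hY hg.aestronglyMeasurable, h.2,
    integral_withDensity_eq_integral_toReal_smul hw.ennreal_ofReal
      (Filter.Eventually.of_forall fun x => ENNReal.ofReal_lt_top)]
  refine integral_congr_ae (Filter.Eventually.of_forall fun x => ?_)
  simp [ENNReal.toReal_ofReal (h.1 x)]

theorem IsPDFOf.integrable_comp (h : IsPDFOf P Y w) (hY : AEMeasurable Y P) (hw : Measurable w)
    {g : (Fin d → ℝ) → ℝ} (hg : Measurable g) :
    Integrable (fun ω => g (Y ω)) P ↔ Integrable (fun x => w x * g x) := by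
  have h1 : Integrable (fun ω => g (Y ω)) P ↔ Integrable g (P.map Y) :=
    (integrable_map_measure hg.aestronglyMeasurable hY).symm
  rw [h1, h.2, integrable_withDensity_iff_integrable_smul' hw.ennreal_ofReal
    (Filter.Eventually.of_forall fun x => ENNReal.ofReal_lt_top)]
  refine integrable_congr (Filter.Eventually.of_forall fun x => ?_)
  simp [ENNReal.toReal_ofReal (h.1 x)]

theorem IsPDFOf.ae_comp (h : IsPDFOf P Y w) (hY : AEMeasurable Y P) (hw : Measurable w)
    {p : (Fin d → ℝ) → Prop} (hp : MeasurableSet {x | p x}) :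
    (∀ᵐ ω ∂P, p (Y ω)) ↔ ∀ᵐ x, 0 < w x → p x := by
  rw [← ae_map_iff hY hp, h.2, ae_withDensity_iff hw.ennreal_ofReal]
  refine Filter.eventually_congr (Filter.Eventually.of_forall fun x => ?_)
  simp

theorem IsPDFOf.integrable [IsProbabilityMeasure P] (h : IsPDFOf P Y w) (hY : AEMeasurable Y P)
    (hw : Measurable w) : Integrable w := by
  have := (h.integrable_comp hY hw (g := fun _ => 1) measurable_const).1 (integrable_const 1)
  simpa using this

theorem IsPDFOf.integral_eq_one [IsProbabilityMeasure P] (h : IsPDFOf P Y w)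
    (hY : AEMeasurable Y P) (hw : Measurable w) : ∫ x, w x = 1 := by
  have := h.integral_comp hY hw (g := fun _ => 1) measurable_const
  simpa using this.symm

theorem IsWeakSolution.measurable {m : ℕ} {F : ℝ → (Fin d → ℝ) → Fin d → ℝ}
    {B : ℝ → (Fin d → ℝ) → Fin d → Fin m → ℝ} {t₀ t₁ : ℝ} {X : ℝ → Ω → (Fin d → ℝ)}
    (h : IsWeakSolution F B t₀ t₁ P X) {s : ℝ} (hs : s ∈ Set.Icc t₀ t₁) : Measurable (X s) := by
  obtain ⟨𝓕, h1, -⟩ := h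
  exact (h1 s hs).mono (𝓕.le s) le_rfl

end Densities

/-! ### From the martingale problem to the Fokker–Planck equation -/

section Generator

variable {d m : ℕ} {F : ℝ → (Fin d → ℝ) → Fin d → ℝ} {B : ℝ → (Fin d → ℝ) → Fin d → Fin m → ℝ}

theorem continuous_diffusionMatrix (hB : Continuous (fun z : ℝ × (Fin d → ℝ) => B z.1 z.2))
    (i j : Fin d) : Continuous (fun z : ℝ × (Fin d → ℝ) => diffusionMatrix B z.1 z.2 i j) := by
  have h : ∀ i k, Continuous (fun z : ℝ × (Fin d → ℝ) => B z.1 z.2 i k) := fun i k =>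
    (continuous_apply k).comp ((continuous_apply i).comp hB)
  exact continuous_finsetSum _ fun k _ => (h i k).mul (h j k)

theorem diffusionMatrix_symm (s : ℝ) (x : Fin d → ℝ) (i j : Fin d) :
    diffusionMatrix B s x i j = diffusionMatrix B s x j i := by
  simp [diffusionMatrix, mul_comm]

theorem continuous_generator (hF : Continuous (fun z : ℝ × (Fin d → ℝ) => F z.1 z.2))
    (hB : Continuous (fun z : ℝ × (Fin d → ℝ) => B z.1 z.2)) {f : (Fin d → ℝ) → ℝ}
    (hf : ContDiff ℝ 2 f) :
    Continuous (fun z : ℝ × (Fin d → ℝ) => generator F B z.1 f z.2) := by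
  unfold generator
  have h1 := hf.of_le one_le_two
  refine (continuous_finsetSum _ fun i _ => ?_).add (continuous_const.mul
    (continuous_finsetSum _ fun i _ => continuous_finsetSum _ fun j _ => ?_))
  · exact ((continuous_apply i).comp hF).mul ((h1.continuous_partialD i).comp continuous_snd)
  · exact (continuous_diffusionMatrix hB i j).mul
      (((hf.contDiff_one_partialD j).continuous_partialD i).comp continuous_snd)

theorem generator_eq_zero_of_notMem_tsupport {f : (Fin d → ℝ) → ℝ} {x : Fin d → ℝ}
    (hx : x ∉ tsupport f) (s : ℝ) : generator F B s f x = 0 := by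
  have h2 : ∀ i j, partialD i (partialD j f) x = 0 := fun i j =>
    partialD_eq_zero_of_notMem_tsupport (fun h => hx (tsupport_partialD_subset f j h)) i
  simp [generator, partialD_eq_zero_of_notMem_tsupport hx, h2]

theorem exists_generator_bound (hF : Continuous (fun z : ℝ × (Fin d → ℝ) => F z.1 z.2))
    (hB : Continuous (fun z : ℝ × (Fin d → ℝ) => B z.1 z.2)) {f : (Fin d → ℝ) → ℝ}
    (hf : ContDiff ℝ 2 f) (hfc : HasCompactSupport f) (t₀ t₁ : ℝ) :
    ∃ M, ∀ s ∈ Set.Icc t₀ t₁, ∀ x, |generator F B s f x| ≤ M := by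
  obtain ⟨M, hM⟩ := (isCompact_Icc (a := t₀) (b := t₁)).prod hfc
    |>.exists_bound_of_continuousOn (continuous_generator hF hB hf).continuousOn
  refine ⟨max M 0, fun s hs x => ?_⟩
  by_cases hx : x ∈ tsupport f
  · exact (hM (s, x) ⟨hs, hx⟩).trans (le_max_left _ _)
  · simp [generator_eq_zero_of_notMem_tsupport hx]

/-- The fundamental theorem of calculus is needed one-sidedly, since the paths are controlled only
on a closed time interval. -/
theorem tendsto_average_right {φ : ℝ → ℝ} {r b : ℝ} (hrb : r < b)
    (hφ : ContinuousOn φ (Set.Icc r b)) :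
    Filter.Tendsto (fun s => (s - r)⁻¹ * ∫ q in r..s, φ q) (nhdsWithin r (Set.Ioi r))
      (nhds (φ r)) := by
  have hm : Set.Icc r b ∈ nhdsWithin r (Set.Ioi r) := Icc_mem_nhdsGT hrb
  have hc : ContinuousWithinAt φ (Set.Ioi r) r :=
    (hφ r ⟨le_rfl, hrb.le⟩).mono_of_mem_nhdsWithin hm
  have hs : StronglyMeasurableAtFilter φ (nhdsWithin r (Set.Ioi r)) :=
    ⟨Set.Icc r b, hm, hφ.aestronglyMeasurable measurableSet_Icc⟩
  have h := intervalIntegral.integral_hasDerivWithinAt_right (a := r) (b := r)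
    (s := Set.Ici r) (t := Set.Ioi r) (IntervalIntegrable.refl) hs hc
  rw [hasDerivWithinAt_iff_tendsto_slope] at h
  have hset : Set.Ici r \ {r} = Set.Ioi r := Set.Ici_sdiff_left
  rw [hset] at h
  refine h.congr fun s => ?_
  simp [slope_def_field, div_eq_inv_mul]

/-- The weak form of the forward equation at one instant. -/
theorem IsWeakSolution.integral_mul_deriv_eq {Ω : Type*} [MeasurableSpace Ω] {P : Measure Ω}
    [IsProbabilityMeasure P] {t₀ t₁ : ℝ} {X : ℝ → Ω → (Fin d → ℝ)}
    (hX : IsWeakSolution F B t₀ t₁ P X)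
    (hF : Continuous (fun z : ℝ × (Fin d → ℝ) => F z.1 z.2))
    (hB : Continuous (fun z : ℝ × (Fin d → ℝ) => B z.1 z.2))
    {w : ℝ → (Fin d → ℝ) → ℝ} {a b : ℝ} (hab : Set.Icc a b ⊆ Set.Icc t₀ t₁)
    (hpdf : ∀ s ∈ Set.Icc a b, IsPDFOf P (X s) (w s))
    (hw : ContDiffOn ℝ 1 (fun z : ℝ × (Fin d → ℝ) => w z.1 z.2) (Set.Icc a b ×ˢ Set.univ))
    {r : ℝ} (hr : r ∈ Set.Ico a b) {f : (Fin d → ℝ) → ℝ}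
    (hf : ContDiff ℝ ((⊤ : ℕ∞) : WithTop ℕ∞) f) (hfc : HasCompactSupport f) :
    ∫ x, timeDeriv a b w r x * f x = ∫ x, w r x * generator F B r f x := by
  have hmeas : ∀ s ∈ Set.Icc t₀ t₁, Measurable (X s) := fun s hs => hX.measurable hs
  obtain ⟨𝓕, -, hpath, hM⟩ := hX
  obtain ⟨hM1, hM2⟩ := hM f hf hfc
  have hf2 : ContDiff ℝ 2 f := contDiff_infty.1 hf 2
  have hlt : a < b := hr.1.trans_lt hr.2
  have hrI : r ∈ Set.Icc a b := ⟨hr.1, hr.2.le⟩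
  have hrT := hab hrI
  have hgc := continuous_generator hF hB hf2
  obtain ⟨Mg, hMg⟩ := exists_generator_bound hF hB hf2 hfc t₀ t₁
  have hpc : ∀ ω, ContinuousOn (fun q => generator F B q f (X q ω)) (Set.Icc t₀ t₁) := fun ω =>
    hgc.comp_continuousOn (continuousOn_id.prodMk (hpath ω))
  have hint : ∀ ω, ∀ s ∈ Set.Icc t₀ t₁, ∀ s' ∈ Set.Icc t₀ t₁,
      IntervalIntegrable (fun q => generator F B q f (X q ω)) volume s s' := fun ω s hs s' hs' =>
    ((hpc ω).mono (Set.uIcc_subset_Icc hs hs')).intervalIntegrable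
  have ht0 : t₀ ∈ Set.Icc t₀ t₁ := ⟨le_rfl, hrT.1.trans hrT.2⟩
  have hfb : ∃ C, ∀ x, ‖f x‖ ≤ C := hfc.exists_bound_of_continuous hf.continuous
  obtain ⟨Cf, hCf⟩ := hfb
  have hfX : ∀ s ∈ Set.Icc t₀ t₁, Integrable (fun ω => f (X s ω)) P := fun s hs =>
    (integrable_const Cf).mono' (hf.continuous.measurable.comp (hmeas s hs)).aestronglyMeasurable
      (Filter.Eventually.of_forall fun ω => hCf _)
  have hI : ∀ s ∈ Set.Icc t₀ t₁,
      Integrable (fun ω => ∫ q in t₀..s, generator F B q f (X q ω)) P := fun s hs => by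
    refine ((hfX s hs).sub (hM1 s hs).2).congr (Filter.Eventually.of_forall fun ω => ?_)
    simp
  -- The martingale of the test function has equal means at times `r` and `s`. This equates the mean
  -- of the averaged generator along the paths with the difference quotient of `∫ w f`.
  have hslope : ∀ s ∈ Set.Ioc r b,
      ∫ ω, ((s - r)⁻¹ * ∫ q in r..s, generator F B q f (X q ω)) ∂P
        = ∫ x, ((s - r)⁻¹ * (w s x - w r x)) * f x := by
    intro s hs
    have hsI : s ∈ Set.Icc a b := ⟨hr.1.trans hs.1.le, hs.2⟩
    have hsT := hab hsI
    have e1 := integral_congr_ae (hM2 r hrT s hsT hs.1.le)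
    rw [integral_condExp (𝓕.le r)] at e1
    rw [integral_sub (hfX s hsT) (hI s hsT), integral_sub (hfX r hrT) (hI r hrT)] at e1
    have e2 : ∫ ω, (∫ q in r..s, generator F B q f (X q ω)) ∂P
        = ∫ ω, (∫ q in t₀..s, generator F B q f (X q ω)) ∂P
          - ∫ ω, (∫ q in t₀..r, generator F B q f (X q ω)) ∂P := by
      rw [← integral_sub (hI s hsT) (hI r hrT)]
      refine integral_congr_ae (Filter.Eventually.of_forall fun ω => ?_)
      exact (intervalIntegral.integral_interval_sub_left (hint ω _ ht0 _ hsT)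
        (hint ω _ ht0 _ hrT)).symm
    have ws : Continuous (w s) := (hw.contDiff_slice hsI).continuous
    have wr : Continuous (w r) := (hw.contDiff_slice hrI).continuous
    have e3 := (hpdf s hsI).integral_comp (hmeas s hsT).aemeasurable ws.measurable
      hf.continuous.measurable
    have e4 := (hpdf r hrI).integral_comp (hmeas r hrT).aemeasurable wr.measurable
      hf.continuous.measurable
    rw [integral_const_mul, e2]
    have e5 : ∫ x, ((s - r)⁻¹ * (w s x - w r x)) * f x
        = (s - r)⁻¹ * ((∫ x, w s x * f x) - ∫ x, w r x * f x) := by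
      rw [← integral_sub, ← integral_const_mul]
      · refine integral_congr_ae (Filter.Eventually.of_forall fun x => ?_)
        simp only; ring
      · exact (ws.mul hf.continuous).integrable_of_hasCompactSupport hfc.mul_left
      · exact (wr.mul hf.continuous).integrable_of_hasCompactSupport hfc.mul_left
    rw [e5, ← e3, ← e4]
    congr 1
    linarith
  -- Only limits from the right are taken, so the equation holds at the left end point too. The
  -- frozen systems are used at exactly that time.
  have hev : ∀ᶠ s in nhdsWithin r (Set.Ioi r), s ∈ Set.Ioc r b := Ioc_mem_nhdsGT hr.2
  -- the limit of the averages along the paths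
  have lim1 : Filter.Tendsto
      (fun s => ∫ ω, ((s - r)⁻¹ * ∫ q in r..s, generator F B q f (X q ω)) ∂P)
      (nhdsWithin r (Set.Ioi r)) (nhds (∫ ω, generator F B r f (X r ω) ∂P)) := by
    refine tendsto_integral_filter_of_dominated_convergence (fun _ => Mg) ?_ ?_
      (integrable_const _) (Filter.Eventually.of_forall fun ω => ?_)
    · filter_upwards [hev] with s hs
      have hsT := hab ⟨hr.1.trans hs.1.le, hs.2⟩
      refine (((hI s hsT).sub (hI r hrT)).const_mul (s - r)⁻¹).aestronglyMeasurable.congr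
        (Filter.Eventually.of_forall fun ω => ?_)
      simp only [Pi.sub_apply]
      rw [intervalIntegral.integral_interval_sub_left (hint ω _ ht0 _ hsT)
        (hint ω _ ht0 _ hrT)]
    · filter_upwards [hev] with s hs
      have hsT := hab ⟨hr.1.trans hs.1.le, hs.2⟩
      refine Filter.Eventually.of_forall fun ω => ?_
      have h1 : ‖∫ q in r..s, generator F B q f (X q ω)‖ ≤ Mg * |s - r| := by
        refine intervalIntegral.norm_integral_le_of_norm_le_const fun q hq => ?_
        rw [Set.uIoc_of_le hs.1.le] at hq
        exact hMg q ⟨hrT.1.trans hq.1.le, hq.2.trans hsT.2⟩ _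
      have hpos : 0 < s - r := by linarith [hs.1]
      rw [abs_of_pos hpos] at h1
      rw [norm_mul, norm_inv, Real.norm_eq_abs (s - r), abs_of_pos hpos, inv_mul_le_iff₀ hpos,
        mul_comm]
      exact h1
    · exact tendsto_average_right hr.2 ((hpc ω).mono
        ((Set.Icc_subset_Icc_left hr.1).trans hab))
  have lim2 : Filter.Tendsto (fun s => ∫ x, ((s - r)⁻¹ * (w s x - w r x)) * f x)
      (nhdsWithin r (Set.Ioi r)) (nhds (∫ x, timeDeriv a b w r x * f x)) := by
    obtain ⟨C, hC⟩ := ((isCompact_Icc (a := a) (b := b)).prod hfc).exists_bound_of_continuousOn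
      ((hw.continuousOn_timeDeriv hlt).mono (Set.prod_mono_right (Set.subset_univ _)))
    have hfi : Integrable (fun x => |C| * |f x|) :=
      (hf.continuous.integrable_of_hasCompactSupport hfc).abs.const_mul _
    refine tendsto_integral_filter_of_dominated_convergence (fun x => |C| * |f x|) ?_ ?_
      hfi (Filter.Eventually.of_forall fun x => ?_)
    · filter_upwards [hev] with s hs
      have hsI : s ∈ Set.Icc a b := ⟨hr.1.trans hs.1.le, hs.2⟩
      have ws : Continuous (w s) := (hw.contDiff_slice hsI).continuous
      have wr : Continuous (w r) := (hw.contDiff_slice hrI).continuous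
      exact ((continuous_const.mul (ws.sub wr)).mul hf.continuous).aestronglyMeasurable
    · filter_upwards [hev] with s hs
      have hsI : s ∈ Set.Icc a b := ⟨hr.1.trans hs.1.le, hs.2⟩
      refine Filter.Eventually.of_forall fun x => ?_
      rw [norm_mul]
      by_cases hx : x ∈ tsupport f
      · have h1 := (convex_Icc a b).norm_image_sub_le_of_norm_hasDerivWithin_le
          (fun q hq => hw.hasDerivWithinAt_timeDeriv hq x) (fun q hq => hC (q, x) ⟨hq, hx⟩) hrI hsI
        refine mul_le_mul_of_nonneg_right ?_ (norm_nonneg _)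
        have hpos : 0 < s - r := by linarith [hs.1]
        rw [norm_mul, norm_inv, inv_mul_le_iff₀ (by simpa using hpos.ne'), mul_comm]
        exact h1.trans (mul_le_mul_of_nonneg_right (le_abs_self C) (norm_nonneg _))
      · simp [image_eq_zero_of_notMem_tsupport hx]
    · refine Filter.Tendsto.mul_const _ ?_
      have h1 := hw.hasDerivWithinAt_timeDeriv hrI x
      rw [hasDerivWithinAt_iff_tendsto_slope] at h1
      refine (h1.mono_left (nhdsWithin_le_of_mem ?_)).congr fun s => ?_
      · filter_upwards [hev] with s hs
        exact ⟨⟨hr.1.trans hs.1.le, hs.2⟩, ne_of_gt hs.1⟩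
      · rw [slope_def_field, div_eq_inv_mul]
  have e := tendsto_nhds_unique (lim1.congr' (by
    filter_upwards [hev] with s hs using hslope s hs)) lim2
  rw [← e]
  have wr : Continuous (w r) := (hw.contDiff_slice hrI).continuous
  have hgr : Continuous (generator F B r f) := hgc.comp (continuous_const.prodMk continuous_id)
  exact (hpdf r hrI).integral_comp (hmeas r hrT).aemeasurable wr.measurable hgr.measurable

/-- The right-hand side of the Fokker–Planck equation,
`-∑_i ∂_i (F_i w) + (1/2) ∑_{i,j} ∂_i ∂_j (g_{ij} w)`. -/
noncomputable def fokkerPlanck (F : ℝ → (Fin d → ℝ) → Fin d → ℝ)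
    (B : ℝ → (Fin d → ℝ) → Fin d → Fin m → ℝ) (s : ℝ) (w : (Fin d → ℝ) → ℝ) (y : Fin d → ℝ) : ℝ :=
  -(∑ i, partialD i (fun z => F s z i * w z) y)
    + (1 / 2) * ∑ i, ∑ j, partialD i (partialD j (fun z => diffusionMatrix B s z i j * w z)) y

theorem integral_mul_partialD_of_hasCompactSupport {u f : (Fin d → ℝ) → ℝ} (hu : ContDiff ℝ 1 u)
    (hf : ContDiff ℝ 1 f) (hfc : HasCompactSupport f) (i : Fin d) :
    ∫ x, u x * partialD i f x = -∫ x, partialD i u x * f x := by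
  have hcs : HasCompactSupport (partialD i f) :=
    hfc.mono' ((subset_tsupport _).trans (tsupport_partialD_subset _ i))
  refine integral_mul_fderiv_eq_neg_fderiv_mul_of_integrable ?_ ?_ ?_
    (fun x _ => hu.differentiable one_ne_zero x) (fun x _ => hf.differentiable one_ne_zero x)
  · exact ((hu.continuous_partialD i).mul hf.continuous).integrable_of_hasCompactSupport
      hfc.mul_left
  · exact (hu.continuous.mul (hf.continuous_partialD i)).integrable_of_hasCompactSupport
      hcs.mul_left
  · exact (hu.continuous.mul hf.continuous).integrable_of_hasCompactSupport hfc.mul_left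

theorem contDiff_diffusionMatrix {k : WithTop ℕ∞} {s : ℝ} (hB : ContDiff ℝ k (B s)) (i j : Fin d) :
    ContDiff ℝ k (fun x => diffusionMatrix B s x i j) := by
  have h : ∀ i k', ContDiff ℝ k (fun x => B s x i k') := fun i k' =>
    (contDiff_pi.1 ((contDiff_pi.1 hB) i)) k'
  exact ContDiff.sum fun k' _ => (h i k').mul (h j k')

theorem continuous_fokkerPlanck {s : ℝ} (hF : ContDiff ℝ 1 (F s)) (hB : ContDiff ℝ 2 (B s))
    {w : (Fin d → ℝ) → ℝ} (hw : ContDiff ℝ 2 w) : Continuous (fokkerPlanck F B s w) := by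
  unfold fokkerPlanck
  refine (continuous_finsetSum _ fun i _ => ?_).neg.add (continuous_const.mul
    (continuous_finsetSum _ fun i _ => continuous_finsetSum _ fun j _ => ?_))
  · exact (((contDiff_pi.1 hF) i).mul (hw.of_le one_le_two)).continuous_partialD i
  · exact (((contDiff_diffusionMatrix hB i j).mul hw).contDiff_one_partialD j).continuous_partialD i

theorem integral_mul_generator_eq {s : ℝ} (hF : ContDiff ℝ 1 (F s)) (hB : ContDiff ℝ 2 (B s))
    {w f : (Fin d → ℝ) → ℝ} (hw : ContDiff ℝ 2 w) (hf : ContDiff ℝ 2 f)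
    (hfc : HasCompactSupport f) :
    ∫ x, w x * generator F B s f x = ∫ x, fokkerPlanck F B s w x * f x := by
  have hcs : ∀ i, HasCompactSupport (partialD i f) := fun i =>
    hfc.mono' ((subset_tsupport _).trans (tsupport_partialD_subset _ i))
  have hcs2 : ∀ i j, HasCompactSupport (partialD i (partialD j f)) := fun i j =>
    (hcs j).mono' ((subset_tsupport _).trans (tsupport_partialD_subset _ i))
  have hf1 := hf.of_le one_le_two
  have hw1 := hw.of_le one_le_two
  have hFw : ∀ i, ContDiff ℝ 1 (fun z => F s z i * w z) := fun i => ((contDiff_pi.1 hF) i).mul hw1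
  have hGw : ∀ i j, ContDiff ℝ 2 (fun z => diffusionMatrix B s z i j * w z) := fun i j =>
    (contDiff_diffusionMatrix hB i j).mul hw
  have a1 : ∀ i, Integrable (fun x => (F s x i * w x) * partialD i f x) := fun i =>
    ((hFw i).continuous.mul (hf1.continuous_partialD i)).integrable_of_hasCompactSupport
      (hcs i).mul_left
  have a2 : ∀ i j, Integrable
      (fun x => (diffusionMatrix B s x i j * w x) * partialD i (partialD j f) x) := fun i j =>
    ((hGw i j).continuous.mul
      ((hf.contDiff_one_partialD j).continuous_partialD i)).integrable_of_hasCompactSupport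
      (hcs2 i j).mul_left
  have b1 : ∀ i, Integrable (fun x => partialD i (fun z => F s z i * w z) x * f x) := fun i =>
    (((hFw i).continuous_partialD i).mul hf.continuous).integrable_of_hasCompactSupport hfc.mul_left
  have b2 : ∀ i j, Integrable (fun x =>
      partialD i (partialD j (fun z => diffusionMatrix B s z i j * w z)) x * f x) := fun i j =>
    ((((hGw i j).contDiff_one_partialD j).continuous_partialD i).mul
      hf.continuous).integrable_of_hasCompactSupport hfc.mul_left
  have e1 : ∫ x, w x * generator F B s f x
      = (∑ i, ∫ x, (F s x i * w x) * partialD i f x)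
        + (1 / 2) * ∑ i, ∑ j, ∫ x, (diffusionMatrix B s x i j * w x)
          * partialD i (partialD j f) x := by
    simp_rw [← integral_finsetSum Finset.univ (fun j _ => a2 _ j)]
    rw [← integral_finsetSum Finset.univ (fun i _ => a1 i), ← integral_finsetSum Finset.univ
      (fun i _ => integrable_finsetSum _ (fun j _ => a2 i j)), ← integral_const_mul, ← integral_add]
    · refine integral_congr_ae (Filter.Eventually.of_forall fun x => ?_)
      simp only [generator, mul_add, Finset.mul_sum]
      congr 1
      · exact Finset.sum_congr rfl fun i _ => by ring
      · exact Finset.sum_congr rfl fun i _ => Finset.sum_congr rfl fun j _ => by ring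
    · exact integrable_finsetSum _ fun i _ => a1 i
    · exact (integrable_finsetSum _ fun i _ => integrable_finsetSum _ fun j _ => a2 i j).const_mul _
  have e2 : ∫ x, fokkerPlanck F B s w x * f x
      = -(∑ i, ∫ x, partialD i (fun z => F s z i * w z) x * f x)
        + (1 / 2) * ∑ i, ∑ j, ∫ x,
          partialD i (partialD j (fun z => diffusionMatrix B s z i j * w z)) x * f x := by
    simp_rw [← integral_finsetSum Finset.univ (fun j _ => b2 _ j)]
    rw [← integral_finsetSum Finset.univ (fun i _ => b1 i), ← integral_finsetSum Finset.univ
      (fun i _ => integrable_finsetSum _ (fun j _ => b2 i j)), ← integral_const_mul,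
      ← integral_neg, ← integral_add]
    · refine integral_congr_ae (Filter.Eventually.of_forall fun x => ?_)
      simp only [fokkerPlanck, add_mul, Finset.sum_mul, neg_mul, Finset.mul_sum]
      congr 1
      exact Finset.sum_congr rfl fun i _ => Finset.sum_congr rfl fun j _ => by ring
    · exact (integrable_finsetSum _ fun i _ => b1 i).neg
    · exact (integrable_finsetSum _ fun i _ => integrable_finsetSum _ fun j _ => b2 i j).const_mul _
  rw [e1, e2]
  congr 1
  · rw [← Finset.sum_neg_distrib]
    exact Finset.sum_congr rfl fun i _ =>
      integral_mul_partialD_of_hasCompactSupport (hFw i) hf1 hfc i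
  · congr 1
    -- Two integrations by parts return the derivatives in reversed order. Exchanging the summation
    -- indices and the symmetry of the diffusion matrix repair this, so no second derivatives have
    -- to be commuted.
    rw [Finset.sum_comm]
    refine Finset.sum_congr rfl fun j _ => Finset.sum_congr rfl fun i _ => ?_
    rw [integral_mul_partialD_of_hasCompactSupport ((hGw i j).of_le one_le_two)
      (hf.contDiff_one_partialD j) (hcs j) i,
      integral_mul_partialD_of_hasCompactSupport ((hGw i j).contDiff_one_partialD i) hf1 hfc j,
      neg_neg]
    simp_rw [diffusionMatrix_symm (B := B) s _ i j]

theorem eq_of_forall_integral_mul_eq {u v : (Fin d → ℝ) → ℝ} (hu : LocallyIntegrable u)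
    (hv : LocallyIntegrable v)
    (h : ∀ f : (Fin d → ℝ) → ℝ, ContDiff ℝ ((⊤ : ℕ∞) : WithTop ℕ∞) f → HasCompactSupport f →
      ∫ x, u x * f x = ∫ x, v x * f x) : u =ᵐ[volume] v := by
  have h1 : ∀ᵐ x, (fun x => u x - v x) x = 0 := by
    refine ae_eq_zero_of_integral_contDiff_smul_eq_zero (hu.sub hv) fun f hf hfc => ?_
    have hui : Integrable (fun x => f x • u x) :=
      hu.integrable_smul_left_of_hasCompactSupport hf.continuous hfc
    have hvi : Integrable (fun x => f x • v x) :=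
      hv.integrable_smul_left_of_hasCompactSupport hf.continuous hfc
    have : ∫ x, f x • (u x - v x) = (∫ x, f x • u x) - ∫ x, f x • v x := by
      rw [← integral_sub hui hvi]
      simp_rw [smul_sub]
    rw [this, sub_eq_zero]
    simpa [mul_comm] using h f hf hfc
  filter_upwards [h1] with x hx
  exact sub_eq_zero.1 hx

/-- The density of a weak solution satisfies the Fokker–Planck equation. -/
theorem IsWeakSolution.timeDeriv_eq_fokkerPlanck {Ω : Type*} [MeasurableSpace Ω] {P : Measure Ω}
    [IsProbabilityMeasure P] {t₀ t₁ : ℝ} {X : ℝ → Ω → (Fin d → ℝ)}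
    (hX : IsWeakSolution F B t₀ t₁ P X)
    (hF : ContDiff ℝ 1 (fun z : ℝ × (Fin d → ℝ) => F z.1 z.2))
    (hB : ContDiff ℝ 2 (fun z : ℝ × (Fin d → ℝ) => B z.1 z.2))
    {w : ℝ → (Fin d → ℝ) → ℝ} {a b : ℝ} (hab : Set.Icc a b ⊆ Set.Icc t₀ t₁)
    (hpdf : ∀ s ∈ Set.Icc a b, IsPDFOf P (X s) (w s))
    (hw : ContDiffOn ℝ 2 (fun z : ℝ × (Fin d → ℝ) => w z.1 z.2) (Set.Icc a b ×ˢ Set.univ))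
    {r : ℝ} (hr : r ∈ Set.Ico a b) (x : Fin d → ℝ) :
    timeDeriv a b w r x = fokkerPlanck F B r (w r) x := by
  have hrI : r ∈ Set.Icc a b := ⟨hr.1, hr.2.le⟩
  have hFr : ContDiff ℝ 1 (F r) :=
    hF.comp (f := fun y => (r, y)) (contDiff_const.prodMk contDiff_id)
  have hBr : ContDiff ℝ 2 (B r) :=
    hB.comp (f := fun y => (r, y)) (contDiff_const.prodMk contDiff_id)
  have hw1 := hw.of_le one_le_two
  have c1 : Continuous (timeDeriv a b w r) :=
    (hw1.continuousOn_timeDeriv (hr.1.trans_lt hr.2)).comp_continuous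
      (f := fun y => (r, y)) (by fun_prop) fun y => ⟨hrI, Set.mem_univ y⟩
  have c2 : Continuous (fokkerPlanck F B r (w r)) :=
    continuous_fokkerPlanck hFr hBr (hw.contDiff_slice hrI)
  have := eq_of_forall_integral_mul_eq c1.locallyIntegrable c2.locallyIntegrable
    fun f hf hfc => by
      rw [hX.integral_mul_deriv_eq hF.continuous hB.continuous hab hpdf hw1 hr hf hfc,
        integral_mul_generator_eq hFr hBr (hw.contDiff_slice hrI)
          (contDiff_infty.1 hf 2) hfc]
  exact congrFun (Continuous.ae_eq_iff_eq volume c1 c2 |>.1 this) x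

end Generator

/-! ### Divergence form and the algebra of `∫ v log (q + ε)` -/

section Flux

variable {d m : ℕ} {F : ℝ → (Fin d → ℝ) → Fin d → ℝ} {B : ℝ → (Fin d → ℝ) → Fin d → Fin m → ℝ}

/-- The drift in the divergence form of the Fokker–Planck equation: `(1/2) ∑_j ∂_j g_{ij} - F_i`. -/
noncomputable def fluxDrift (F : ℝ → (Fin d → ℝ) → Fin d → ℝ)
    (B : ℝ → (Fin d → ℝ) → Fin d → Fin m → ℝ) (s : ℝ) (i : Fin d) (y : Fin d → ℝ) : ℝ :=
  (1 / 2) * (∑ j, partialD j (fun z => diffusionMatrix B s z i j) y) - F s y i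

/-- The vector field whose divergence is the right-hand side of the Fokker–Planck equation. -/
noncomputable def flux (F : ℝ → (Fin d → ℝ) → Fin d → ℝ)
    (B : ℝ → (Fin d → ℝ) → Fin d → Fin m → ℝ) (s : ℝ) (w : (Fin d → ℝ) → ℝ) (i : Fin d)
    (y : Fin d → ℝ) : ℝ :=
  (1 / 2) * (∑ j, diffusionMatrix B s y i j * partialD j w y) + fluxDrift F B s i y * w y

/-- The divergence of `fluxDrift`. -/
noncomputable def fluxDriftDiv (F : ℝ → (Fin d → ℝ) → Fin d → ℝ)
    (B : ℝ → (Fin d → ℝ) → Fin d → Fin m → ℝ) (s : ℝ) (y : Fin d → ℝ) : ℝ :=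
  ∑ i, partialD i (fluxDrift F B s i) y

/-- The quadratic form of the diffusion matrix. -/
noncomputable def diffusionForm (B : ℝ → (Fin d → ℝ) → Fin d → Fin m → ℝ) (s : ℝ) (y : Fin d → ℝ)
    (a b : Fin d → ℝ) : ℝ :=
  ∑ i, ∑ j, diffusionMatrix B s y i j * (a i * b j)

/-- The form is `|Bᵀ a|²`. No ellipticity is assumed; this sign takes its place. -/
theorem diffusionForm_nonneg (s : ℝ) (y a : Fin d → ℝ) : 0 ≤ diffusionForm B s y a a := by
  have : diffusionForm B s y a a = ∑ k, (∑ i, B s y i k * a i) ^ 2 := by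
    simp only [diffusionForm, diffusionMatrix, sq, Finset.sum_mul, Finset.mul_sum]
    rw [Finset.sum_comm]
    conv_lhs => enter [2, i]; rw [Finset.sum_comm]
    rw [Finset.sum_comm]
    refine Finset.sum_congr rfl fun k _ => Finset.sum_congr rfl fun i _ =>
      Finset.sum_congr rfl fun j _ => by ring
  rw [this]
  positivity

theorem diffusionForm_sub (s : ℝ) (y a b : Fin d → ℝ) (α β : ℝ) :
    diffusionForm B s y (fun i => a i * α - b i * β) (fun i => a i * α - b i * β)
      = α ^ 2 * diffusionForm B s y a a
        - α * β * (diffusionForm B s y a b + diffusionForm B s y b a)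
        + β ^ 2 * diffusionForm B s y b b := by
  simp only [diffusionForm, Finset.mul_sum, mul_add, ← Finset.sum_add_distrib,
    ← Finset.sum_sub_distrib]
  exact Finset.sum_congr rfl fun i _ => Finset.sum_congr rfl fun j _ => by ring

theorem diffusionForm_le {s : ℝ} {y a : Fin d → ℝ} {Λ e : ℝ} (hΛ : 0 ≤ Λ)
    (hg : ∀ i j, |diffusionMatrix B s y i j| ≤ Λ) (ha : ∀ i, a i ^ 2 ≤ e) :
    diffusionForm B s y a a ≤ d ^ 2 * (Λ * e) := by
  have : ∀ i j, diffusionMatrix B s y i j * (a i * a j) ≤ Λ * e := by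
    intro i j
    have h1 : |a i * a j| ≤ e := by
      rw [abs_le]
      constructor <;> nlinarith [sq_nonneg (a i + a j), sq_nonneg (a i - a j), ha i, ha j]
    calc _ ≤ |diffusionMatrix B s y i j * (a i * a j)| := le_abs_self _
      _ ≤ Λ * e := by
        rw [abs_mul]
        exact mul_le_mul (hg i j) h1 (abs_nonneg _) hΛ
  calc diffusionForm B s y a a ≤ ∑ _i : Fin d, ∑ _j : Fin d, Λ * e :=
        Finset.sum_le_sum fun i _ => Finset.sum_le_sum fun j _ => this i j
    _ = d ^ 2 * (Λ * e) := by simp; ring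

/-- The diffusion matrix and the drift in divergence form are at most `Λ` at the point `y`. -/
structure CoefficientBoundAt (F : ℝ → (Fin d → ℝ) → Fin d → ℝ)
    (B : ℝ → (Fin d → ℝ) → Fin d → Fin m → ℝ) (s : ℝ) (y : Fin d → ℝ) (Λ : ℝ) : Prop where
  diffusionMatrix_le : ∀ i j, |diffusionMatrix B s y i j| ≤ Λ
  fluxDrift_le : ∀ i, |fluxDrift F B s i y| ≤ Λ
  fluxDriftDiv_le : |fluxDriftDiv F B s y| ≤ Λ

section Smooth

variable {s : ℝ} (hF : ContDiff ℝ 1 (F s)) (hB : ContDiff ℝ 2 (B s))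

include hF hB

theorem contDiff_fluxDrift (i : Fin d) : ContDiff ℝ 1 (fluxDrift F B s i) :=
  (contDiff_const.mul (ContDiff.sum fun j _ =>
    (contDiff_diffusionMatrix hB i j).contDiff_one_partialD j)).sub ((contDiff_pi.1 hF) i)

theorem contDiff_flux {w : (Fin d → ℝ) → ℝ} (hw : ContDiff ℝ 2 w) (i : Fin d) :
    ContDiff ℝ 1 (flux F B s w i) :=
  (contDiff_const.mul (ContDiff.sum fun j _ =>
    ((contDiff_diffusionMatrix hB i j).of_le one_le_two).mul (hw.contDiff_one_partialD j))).add
    ((contDiff_fluxDrift hF hB i).mul (hw.of_le one_le_two))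

/-- The product rule splits the inner derivative of `g w` into `g ∂w`, the second-order part of the
flux, and `w ∂g`, which joins the drift in `fluxDrift`. The outer derivative already stands in the
right place. -/
theorem fokkerPlanck_eq_sum_partialD_flux {w : (Fin d → ℝ) → ℝ} (hw : ContDiff ℝ 2 w)
    (y : Fin d → ℝ) : fokkerPlanck F B s w y = ∑ i, partialD i (flux F B s w i) y := by
  have hg := fun i j => contDiff_diffusionMatrix (k := 2) hB i j
  have e : ∀ i, flux F B s w i = fun z =>
      (1 / 2) * (∑ j, partialD j (fun z => diffusionMatrix B s z i j * w z) z) - F s z i * w z := by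
    intro i
    funext z
    have : ∀ j, partialD j (fun z => diffusionMatrix B s z i j * w z) z
        = diffusionMatrix B s z i j * partialD j w z
          + w z * partialD j (fun z => diffusionMatrix B s z i j) z := fun j =>
      partialD_mul ((hg i j).differentiable two_ne_zero z) (hw.differentiable two_ne_zero z)
    simp_rw [this, Finset.sum_add_distrib, ← Finset.mul_sum]
    simp only [flux, fluxDrift]
    ring
  have c1 : ∀ i j, ContDiff ℝ 1 (partialD j (fun z => diffusionMatrix B s z i j * w z)) :=
    fun i j => ((hg i j).mul hw).contDiff_one_partialD j
  have e2 : ∀ i, partialD i (flux F B s w i) y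
      = (1 / 2) * (∑ j, partialD i (partialD j (fun z => diffusionMatrix B s z i j * w z)) y)
        - partialD i (fun z => F s z i * w z) y := by
    intro i
    rw [e i, partialD_sub, partialD_const_mul, partialD_sum]
    · exact fun j _ => (c1 i j).differentiable one_ne_zero y
    · exact (ContDiff.sum fun j _ => c1 i j).differentiable one_ne_zero y
    · exact (contDiff_const.mul (ContDiff.sum fun j _ => c1 i j)).differentiable one_ne_zero y
    · exact (((contDiff_pi.1 hF) i).mul (hw.of_le one_le_two)).differentiable one_ne_zero y
  simp_rw [e2, Finset.sum_sub_distrib, ← Finset.mul_sum]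
  simp only [fokkerPlanck]
  ring

end Smooth

/-- The rate of change of `∫ v log (q + ε)` when `v` and `q` solve the same Fokker–Planck equation,
written such that the only singular term is nonnegative. -/
noncomputable def logRate (F : ℝ → (Fin d → ℝ) → Fin d → ℝ)
    (B : ℝ → (Fin d → ℝ) → Fin d → Fin m → ℝ) (s : ℝ) (v q : (Fin d → ℝ) → ℝ) (ε : ℝ)
    (y : Fin d → ℝ) : ℝ :=
  (1 / 2) * (v y * diffusionForm B s y
      (fun i => partialD i v y * (v y)⁻¹ - partialD i q y * (q y + ε)⁻¹)
      (fun i => partialD i v y * (v y)⁻¹ - partialD i q y * (q y + ε)⁻¹))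
    - (1 / 2) * (diffusionForm B s y (fun i => partialD i v y) (fun i => partialD i v y) * (v y)⁻¹)
    + fluxDriftDiv F B s y * (v y * (q y * (q y + ε)⁻¹))

theorem logRate_eq_zero {s : ℝ} {v q : (Fin d → ℝ) → ℝ} {ε : ℝ} {y : Fin d → ℝ} (hv : v y = 0) :
    logRate F B s v q ε y = 0 := by
  simp [logRate, hv]

/-- The vector field that yields `logRate` by the divergence theorem. -/
noncomputable def logField (F : ℝ → (Fin d → ℝ) → Fin d → ℝ)
    (B : ℝ → (Fin d → ℝ) → Fin d → Fin m → ℝ) (s : ℝ) (v q : (Fin d → ℝ) → ℝ) (ε : ℝ)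
    (i : Fin d) (y : Fin d → ℝ) : ℝ :=
  flux F B s v i y * Real.log (q y + ε)
    + (v y * (q y + ε)⁻¹) * ((1 / 2) * ∑ j, diffusionMatrix B s y i j * partialD j q y)

section LogField

variable {s ε : ℝ} {v q : (Fin d → ℝ) → ℝ} (hF : ContDiff ℝ 1 (F s)) (hB : ContDiff ℝ 2 (B s))
  (hv : ContDiff ℝ 2 v) (hq : ContDiff ℝ 2 q) (hv0 : ∀ y, 0 ≤ v y) (hq0 : ∀ y, 0 ≤ q y)
  (hε : 0 < ε)

include hF hB hv hq hq0 hε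

theorem contDiff_logField (i : Fin d) : ContDiff ℝ 1 (logField F B s v q ε i) := by
  have hq1 : ContDiff ℝ 1 (fun y => q y + ε) := (hq.of_le one_le_two).add contDiff_const
  have hne : ∀ y, q y + ε ≠ 0 := fun y => by have := hq0 y; positivity
  refine ((contDiff_flux hF hB hv i).mul (hq1.log hne)).add
    (((hv.of_le one_le_two).mul (hq1.inv hne)).mul (contDiff_const.mul (ContDiff.sum fun j _ => ?_)))
  exact ((contDiff_diffusionMatrix hB i j).of_le one_le_two).mul (hq.contDiff_one_partialD j)

-- Write `r = (q + ε)⁻¹`, `a = ∇v`, `b = ∇q`. Moving one derivative off each Fokker–Planck term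
-- leaves, as second-order contribution, `(1/2) v r² g(b, b) - (1/2) r (g(a, b) + g(b, a))`. This
-- equals `(1/2) v g(a/v - rb, a/v - rb) - (1/2) g(a, a) / v`. Of the drift terms, the products with
-- `∇q` cancel and only the divergence of the drift survives. The point of this form is that nothing
-- in it can tend to `-∞` as `ε → 0`.
include hv0 in
theorem sum_partialD_logField (y : Fin d → ℝ) :
    ∑ i, partialD i (logField F B s v q ε i) y
      = fokkerPlanck F B s v y * Real.log (q y + ε)
        + fokkerPlanck F B s q y * (v y * (q y + ε)⁻¹) - logRate F B s v q ε y := by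
  have hq1 : ContDiff ℝ 1 (fun y => q y + ε) := (hq.of_le one_le_two).add contDiff_const
  have hne : ∀ y, q y + ε ≠ 0 := fun y => by have := hq0 y; positivity
  have hqd : DifferentiableAt ℝ q y := hq.differentiable two_ne_zero y
  have hvd : DifferentiableAt ℝ v y := hv.differentiable two_ne_zero y
  set H : Fin d → (Fin d → ℝ) → ℝ := fun i y =>
    (1 / 2) * ∑ j, diffusionMatrix B s y i j * partialD j q y with hH
  have hHc : ∀ i, ContDiff ℝ 1 (H i) := fun i => contDiff_const.mul (ContDiff.sum fun j _ =>
    ((contDiff_diffusionMatrix hB i j).of_le one_le_two).mul (hq.contDiff_one_partialD j))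
  have hHd : ∀ i, DifferentiableAt ℝ (H i) y := fun i => (hHc i).differentiable one_ne_zero y
  have hβd : ∀ i, DifferentiableAt ℝ (fluxDrift F B s i) y := fun i =>
    (contDiff_fluxDrift hF hB i).differentiable one_ne_zero y
  have hfd : ∀ i, DifferentiableAt ℝ (flux F B s v i) y := fun i =>
    (contDiff_flux hF hB hv i).differentiable one_ne_zero y
  have dlog : ∀ i, partialD i (fun y => Real.log (q y + ε)) y
      = (q y + ε)⁻¹ * partialD i q y := fun i => by
    have h1 : HasDerivAt (fun x : ℝ => Real.log (x + ε)) ((q y + ε)⁻¹) (q y) := by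
      have := ((hasDerivAt_id (q y)).add_const ε).log (hne y)
      simpa using this
    exact h1.partialD_comp hqd
  have dinv : ∀ i, partialD i (fun y => (q y + ε)⁻¹) y
      = -((q y + ε)⁻¹ ^ 2) * partialD i q y := fun i => by
    have h1 : HasDerivAt (fun x : ℝ => (x + ε)⁻¹) (-((q y + ε)⁻¹ ^ 2)) (q y) := by
      have := ((hasDerivAt_id (q y)).add_const ε).inv (hne y)
      exact HasDerivAt.congr_deriv (f := fun x : ℝ => (x + ε)⁻¹) this (by
        simp [div_eq_mul_inv])
    exact h1.partialD_comp hqd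
  have hlogd : DifferentiableAt ℝ (fun y => Real.log (q y + ε)) y :=
    (hq1.log hne).differentiable one_ne_zero y
  have hinvd : DifferentiableAt ℝ (fun y => (q y + ε)⁻¹) y :=
    (hq1.inv hne).differentiable one_ne_zero y
  have e1 : ∀ i, partialD i (logField F B s v q ε i) y
      = flux F B s v i y * ((q y + ε)⁻¹ * partialD i q y)
        + Real.log (q y + ε) * partialD i (flux F B s v i) y
        + ((v y * (q y + ε)⁻¹) * partialD i (H i) y
          + H i y * (v y * (-((q y + ε)⁻¹ ^ 2) * partialD i q y)
            + (q y + ε)⁻¹ * partialD i v y)) := by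
    intro i
    rw [show logField F B s v q ε i = fun y => flux F B s v i y * Real.log (q y + ε)
      + (v y * (q y + ε)⁻¹) * H i y from rfl]
    rw [partialD_add ((hfd i).fun_mul hlogd) ((hvd.fun_mul hinvd).fun_mul (hHd i)),
      partialD_mul (hfd i) hlogd, partialD_mul (hvd.fun_mul hinvd) (hHd i), partialD_mul hvd hinvd,
      dlog, dinv]
  have e2 : ∀ i, partialD i (flux F B s q i) y = partialD i (H i) y
      + (fluxDrift F B s i y * partialD i q y + q y * partialD i (fluxDrift F B s i) y) := by
    intro i
    rw [show flux F B s q i = fun y => H i y + fluxDrift F B s i y * q y from rfl,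
      partialD_add (hHd i) ((hβd i).fun_mul hqd), partialD_mul (hβd i) hqd]
  rw [fokkerPlanck_eq_sum_partialD_flux hF hB hv, fokkerPlanck_eq_sum_partialD_flux hF hB hq]
  simp_rw [e1, e2]
  set a : Fin d → ℝ := fun i => partialD i v y with ha
  set b : Fin d → ℝ := fun i => partialD i q y with hb
  set r := (q y + ε)⁻¹ with hr
  have s1 : ∑ i, flux F B s v i y * (r * b i)
      = r * ((1 / 2) * diffusionForm B s y b a) + r * v y * ∑ i, fluxDrift F B s i y * b i := by
    simp only [flux, diffusionForm, Finset.mul_sum, ← Finset.sum_add_distrib]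
    refine Finset.sum_congr rfl fun i _ => ?_
    simp only [add_mul, Finset.sum_mul]
    congr 1
    · exact Finset.sum_congr rfl fun j _ => by simp only [ha]; ring
    · ring
  have s2 : ∀ c : Fin d → ℝ, ∑ i, H i y * c i = (1 / 2) * diffusionForm B s y c b := by
    intro c
    simp only [hH, diffusionForm, Finset.mul_sum, Finset.sum_mul]
    exact Finset.sum_congr rfl fun i _ => Finset.sum_congr rfl fun j _ => by simp only [hb]; ring
  have s3 : ∑ i, H i y * (v y * (-(r ^ 2) * b i) + r * a i)
      = -(v y * r ^ 2) * ((1 / 2) * diffusionForm B s y b b)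
        + r * ((1 / 2) * diffusionForm B s y a b) := by
    rw [← s2 b, ← s2 a, Finset.mul_sum, Finset.mul_sum, ← Finset.sum_add_distrib]
    exact Finset.sum_congr rfl fun i _ => by ring
  have s4 : ∑ i, (partialD i (H i) y
      + (fluxDrift F B s i y * b i + q y * partialD i (fluxDrift F B s i) y))
      = ∑ i, partialD i (H i) y + ∑ i, fluxDrift F B s i y * b i + q y * fluxDriftDiv F B s y := by
    simp only [Finset.sum_add_distrib, fluxDriftDiv, Finset.mul_sum]
    ring
  have lhs : ∑ i, (flux F B s v i y * (r * b i)
        + Real.log (q y + ε) * partialD i (flux F B s v i) y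
        + ((v y * r) * partialD i (H i) y + H i y * (v y * (-(r ^ 2) * b i) + r * a i)))
      = ∑ i, flux F B s v i y * (r * b i)
        + Real.log (q y + ε) * ∑ i, partialD i (flux F B s v i) y
        + ((v y * r) * ∑ i, partialD i (H i) y
          + ∑ i, H i y * (v y * (-(r ^ 2) * b i) + r * a i)) := by
    simp only [Finset.sum_add_distrib, Finset.mul_sum]
  have lhs' := lhs
  rw [s1, s3] at lhs'
  refine lhs'.trans ?_
  rw [s4]
  rw [show logRate F B s v q ε y = (1 / 2) * (v y * diffusionForm B s y
      (fun i => a i * (v y)⁻¹ - b i * r) (fun i => a i * (v y)⁻¹ - b i * r))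
    - (1 / 2) * (diffusionForm B s y a a * (v y)⁻¹)
    + fluxDriftDiv F B s y * (v y * (q y * r)) from rfl]
  -- Completing the square needs `v v⁻¹ = 1`, which fails at a zero of `v`. There the gradient of
  -- `v` vanishes as well, and both sides agree with the convention `0⁻¹ = 0`.
  rcases eq_or_ne (v y) 0 with h0 | h0
  · have ha0 : a = fun _ => 0 := funext fun i => partialD_eq_zero_of_nonneg hv0 h0 i
    have z1 : diffusionForm B s y a b = 0 := by simp [diffusionForm, ha0]
    have z2 : diffusionForm B s y b a = 0 := by simp [diffusionForm, ha0]
    rw [h0, z1, z2]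
    ring
  · rw [diffusionForm_sub]
    have hvv : v y * (v y)⁻¹ = 1 := mul_inv_cancel₀ h0
    linear_combination ((1 / 2) * diffusionForm B s y a a * (v y)⁻¹
      - (1 / 2) * r * (diffusionForm B s y a b + diffusionForm B s y b a)) * hvv

end LogField

end Flux

/-! ### Bounds that are uniform in `ε` -/

section Bounds

variable {d m : ℕ}

/-- A nonnegative `C²` function that, together with its gradient, decreases faster than
`(1 + ‖y‖)^{-p}` by an integrable factor. -/
structure IsWeightedDensity (p : ℕ) (C : ℝ) (v : (Fin d → ℝ) → ℝ) : Prop where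
  contDiff : ContDiff ℝ 2 v
  nonneg : ∀ y, 0 ≤ v y
  le : ∀ y, (1 + ‖y‖) ^ p * v y ≤ C * decayWeight y
  partialD_le : ∀ i y, (1 + ‖y‖) ^ p * |partialD i v y| ≤ C * decayWeight y
  sq_partialD_le : ∀ i y, (1 + ‖y‖) ^ p * partialD i v y ^ 2 ≤ C * decayWeight y * v y

theorem one_le_one_add_norm_pow (p : ℕ) (y : Fin d → ℝ) : 1 ≤ (1 + ‖y‖) ^ p :=
  one_le_pow₀ (by linarith [norm_nonneg y])

theorem one_add_norm_le_of_abs_le_one (y : Fin d → ℝ) (i : Fin d) {η : ℝ} (hη : |η| ≤ 1) :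
    1 + ‖y‖ ≤ 2 * (1 + ‖y + Pi.single i η‖) := by
  have h1 : ‖y‖ ≤ ‖y + Pi.single i η‖ + ‖(Pi.single i η : Fin d → ℝ)‖ := by
    have := norm_sub_le (y + Pi.single i η) (Pi.single i η : Fin d → ℝ)
    rwa [add_sub_cancel_right] at this
  have h2 : ‖(Pi.single i η : Fin d → ℝ)‖ ≤ 1 := by
    refine (pi_norm_le_iff_of_nonneg zero_le_one).2 fun j => ?_
    by_cases h : j = i
    · subst h; simpa using hη
    · simp [h]
  linarith [norm_nonneg (y + Pi.single i η)]

namespace IsWeightedDensity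

variable {p : ℕ} {C : ℝ} {v : (Fin d → ℝ) → ℝ}

theorem const_nonneg (h : IsWeightedDensity p C v) : 0 ≤ C := by
  have h1 := h.le 0
  have h2 : 0 ≤ (1 + ‖(0 : Fin d → ℝ)‖) ^ p * v 0 := mul_nonneg (by positivity) (h.nonneg 0)
  have h3 := decayWeight_pos (0 : Fin d → ℝ)
  by_contra hC
  push Not at hC
  nlinarith

theorem le_decayWeight (h : IsWeightedDensity p C v) (y : Fin d → ℝ) :
    v y ≤ C * decayWeight y :=
  (le_mul_of_one_le_left (h.nonneg y) (one_le_one_add_norm_pow p y)).trans (h.le y)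

theorem le_const (h : IsWeightedDensity p C v) (y : Fin d → ℝ) : v y ≤ C :=
  (h.le_decayWeight y).trans (mul_le_of_le_one_right h.const_nonneg (decayWeight_le_one y))

theorem abs_partialD_le_const (h : IsWeightedDensity p C v) (i : Fin d) (y : Fin d → ℝ) :
    |partialD i v y| ≤ C :=
  (le_mul_of_one_le_left (abs_nonneg _) (one_le_one_add_norm_pow p y)).trans
    ((h.partialD_le i y).trans (mul_le_of_le_one_right h.const_nonneg (decayWeight_le_one y)))

theorem sq_partialD_le_const (h : IsWeightedDensity p C v) (i : Fin d) (y : Fin d → ℝ) :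
    partialD i v y ^ 2 ≤ C * v y :=
  (le_mul_of_one_le_left (sq_nonneg _) (one_le_one_add_norm_pow p y)).trans
    ((h.sq_partialD_le i y).trans (mul_le_mul_of_nonneg_right
      (mul_le_of_le_one_right h.const_nonneg (decayWeight_le_one y)) (h.nonneg y)))

theorem integrable (h : IsWeightedDensity p C v) : Integrable v :=
  Continuous.integrable_of_le_decayWeight h.contDiff.continuous.aestronglyMeasurable
    (c := C) fun y => by rw [abs_of_nonneg (h.nonneg y)]; exact h.le_decayWeight y

end IsWeightedDensity

/-- The constant in `IsDecayingFamily.isWeightedDensity`. -/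
noncomputable def weightConst (K : ℕ → ℝ) (p d : ℕ) : ℝ :=
  2 * (2 ^ (p + d + 1) + 1) * K (p + d + 1)

theorem IsDecayingFamily.const_nonneg {K : ℕ → ℝ} {t₀ t₁ : ℝ} (h01 : t₀ ≤ t₁)
    {w wt : ℝ → (Fin d → ℝ) → ℝ}
    (h : IsDecayingFamily K t₀ t₁ w wt) (N : ℕ) : 0 ≤ K N :=
  le_trans (by positivity) (h.bound N t₀ ⟨le_rfl, h01⟩ 0)

theorem IsDecayingFamily.le_weightConst {K : ℕ → ℝ} {t₀ t₁ : ℝ} (h01 : t₀ ≤ t₁)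
    {w wt : ℝ → (Fin d → ℝ) → ℝ} (h : IsDecayingFamily K t₀ t₁ w wt) (p : ℕ) :
    K (p + d + 1) ≤ weightConst K p d := by
  have h1 := h.const_nonneg h01 (p + d + 1)
  unfold weightConst
  have h2 : (0 : ℝ) < 2 ^ (p + d + 1) := by positivity
  nlinarith

/-- The bound on the squared gradient is the only substantial one. It is `sq_partialD_le` with
radius `κ = 1`: on the unit segment around `y` the weight changes by a factor of at most `2 ^ N`, so
the second derivative is at most `2 ^ N * K N / (1 + ‖y‖) ^ N`, and the gradient term adds `K N / (1
+ ‖y‖) ^ N`. Twice the sum of the two constants is `weightConst`. -/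
theorem IsDecayingFamily.isWeightedDensity {K : ℕ → ℝ} {t₀ t₁ : ℝ} {w wt : ℝ → (Fin d → ℝ) → ℝ}
    (h : IsDecayingFamily K t₀ t₁ w wt) {s : ℝ} (hs : s ∈ Set.Icc t₀ t₁) (h0 : ∀ y, 0 ≤ w s y)
    (p : ℕ) : IsWeightedDensity p (weightConst K p d) (w s) := by
  have h01 := hs.1.trans hs.2
  have hK := h.const_nonneg h01 (p + d + 1)
  have hC := h.le_weightConst h01 p
  refine ⟨h.contDiff s hs, h0, fun y => ?_, fun i y => ?_, fun i y => ?_⟩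
  · have := h.bound (p + d + 1) s hs y
    rw [abs_of_nonneg (h0 y)] at this
    exact le_mul_decayWeight (this.trans hC)
  · exact le_mul_decayWeight ((h.bound_partialD i (p + d + 1) s hs y).trans hC)
  · set N := p + d + 1 with hN
    have hpos : (0 : ℝ) < (1 + ‖y‖) ^ N := by positivity
    have h2 : ∀ η, |η| ≤ 1 → partialD i (partialD i (w s)) (y + Pi.single i η)
        ≤ 2 ^ N * K N / (1 + ‖y‖) ^ N := by
      intro η hη
      have h3 := h.bound_partialD_partialD i i N s hs (y + Pi.single i η)
      set z := y + Pi.single i η with hz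
      have h4 : 1 + ‖y‖ ≤ 2 * (1 + ‖z‖) := one_add_norm_le_of_abs_le_one y i hη
      rw [le_div_iff₀ hpos]
      calc partialD i (partialD i (w s)) z * (1 + ‖y‖) ^ N
          ≤ |partialD i (partialD i (w s)) z| * (2 * (1 + ‖z‖)) ^ N := by
            gcongr
            exact le_abs_self _
        _ = 2 ^ N * ((1 + ‖z‖) ^ N * |partialD i (partialD i (w s)) z|) := by
            rw [mul_pow]; ring
        _ ≤ 2 ^ N * K N := by gcongr
    have h5 := sq_partialD_le (h.contDiff s hs) h0 one_pos (by positivity) y i h2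
    have h6 : |partialD i (w s) y| ≤ K N / (1 + ‖y‖) ^ N := by
      rw [le_div_iff₀ hpos, mul_comm]
      exact h.bound_partialD i N s hs y
    have h7 : partialD i (w s) y ^ 2 ≤ weightConst K p d * w s y / (1 + ‖y‖) ^ N := by
      refine h5.trans ?_
      calc 2 * w s y * (2 ^ N * K N / (1 + ‖y‖) ^ N + |partialD i (w s) y| / 1)
          ≤ 2 * w s y * (2 ^ N * K N / (1 + ‖y‖) ^ N + K N / (1 + ‖y‖) ^ N) := by
            have := h0 y
            rw [div_one]; gcongr
        _ = weightConst K p d * w s y / (1 + ‖y‖) ^ N := by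
            unfold weightConst; rw [← hN]; ring
    have h8 : (1 + ‖y‖) ^ N * partialD i (w s) y ^ 2 ≤ weightConst K p d * w s y := by
      rw [le_div_iff₀ hpos] at h7
      linarith
    calc _ ≤ (weightConst K p d * w s y) * decayWeight y := le_mul_decayWeight h8
      _ = _ := by ring

section FixedTime

variable {F : ℝ → (Fin d → ℝ) → Fin d → ℝ} {B : ℝ → (Fin d → ℝ) → Fin d → Fin m → ℝ}
  {s ε C Λ : ℝ} {p : ℕ} {v q : (Fin d → ℝ) → ℝ}

/-- The factor `v` in the bound for the squared gradient cancels `v⁻¹`, and its weight cancels the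
growth of the coefficients. -/
theorem diffusionForm_partialD_le (hv : IsWeightedDensity p C v) (hΛ : 0 ≤ Λ) {y : Fin d → ℝ}
    (hc : CoefficientBoundAt F B s y (Λ * (1 + ‖y‖) ^ p)) :
    diffusionForm B s y (fun i => partialD i v y) (fun i => partialD i v y) * (v y)⁻¹
      ≤ d ^ 2 * (Λ * (C * decayWeight y)) := by
  have hpos : (0 : ℝ) < (1 + ‖y‖) ^ p := by positivity
  have hw := decayWeight_pos y
  have hC := hv.const_nonneg
  rcases (hv.nonneg y).eq_or_lt with h0 | h0
  · rw [← h0]; simp; positivity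
  have h1 := diffusionForm_le (B := B) (s := s) (y := y) (a := fun i => partialD i v y)
    (e := C * decayWeight y * v y / (1 + ‖y‖) ^ p) (by positivity) hc.diffusionMatrix_le
    (fun i => by rw [le_div_iff₀ hpos, mul_comm]; exact hv.sq_partialD_le i y)
  rw [← div_eq_mul_inv, div_le_iff₀ h0]
  refine h1.trans_eq ?_
  field_simp

/-- Discard the nonnegative square. What is left involves `q` and `ε` only through `q / (q + ε) ≤
1`, so one integrable minorant serves all later limits: in `ε`, in time and in the parameter. -/
theorem neg_le_logRate (hv : IsWeightedDensity p C v) (hq0 : ∀ y, 0 ≤ q y) (hε : 0 ≤ ε)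
    (hΛ : 0 ≤ Λ) {y : Fin d → ℝ}
    (hc : v y ≠ 0 → CoefficientBoundAt F B s y (Λ * (1 + ‖y‖) ^ p)) :
    -((d ^ 2 + 1) * (Λ * C) * decayWeight y) ≤ logRate F B s v q ε y
    := by
  have hw := decayWeight_pos y
  have hC := hv.const_nonneg
  by_cases h0 : v y = 0
  · rw [logRate_eq_zero h0]
    have : 0 ≤ (d ^ 2 + 1) * (Λ * C) * decayWeight y := by positivity
    linarith
  have hc := hc h0
  have h1 := diffusionForm_partialD_le hv hΛ hc
  have h2 : 0 ≤ v y * diffusionForm B s y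
      (fun i => partialD i v y * (v y)⁻¹ - partialD i q y * (q y + ε)⁻¹)
      (fun i => partialD i v y * (v y)⁻¹ - partialD i q y * (q y + ε)⁻¹) :=
    mul_nonneg (hv.nonneg y) (diffusionForm_nonneg _ _ _)
  have h3 : |fluxDriftDiv F B s y * (v y * (q y * (q y + ε)⁻¹))| ≤ Λ * (C * decayWeight y) := by
    have hr : 0 ≤ q y * (q y + ε)⁻¹ := mul_nonneg (hq0 y) (inv_nonneg.2 (add_nonneg (hq0 y) hε))
    have hr1 : q y * (q y + ε)⁻¹ ≤ 1 :=
      mul_inv_le_one_of_le₀ (by linarith) (add_nonneg (hq0 y) hε)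
    rw [abs_mul, abs_of_nonneg (mul_nonneg (hv.nonneg y) hr)]
    calc |fluxDriftDiv F B s y| * (v y * (q y * (q y + ε)⁻¹))
        ≤ (Λ * (1 + ‖y‖) ^ p) * (v y * 1) := by
          have := hv.nonneg y
          have := hc.fluxDriftDiv_le
          gcongr
      _ = Λ * ((1 + ‖y‖) ^ p * v y) := by ring
      _ ≤ Λ * (C * decayWeight y) := by exact mul_le_mul_of_nonneg_left (hv.le y) (by positivity)
  have h4 := (abs_le.1 h3).1
  have h5 : 0 ≤ (d : ℝ) ^ 2 * (Λ * (C * decayWeight y)) := by positivity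
  simp only [logRate]
  nlinarith

/-- The square is opened by `(x - y)² ≤ 2x² + 2y²`. Its part from `v` is integrable by the gradient
bound for `v`; in its part from `q`, the bound `|∂q|² ≤ C q` reduces `(q + ε)⁻²` to `(q + ε)⁻¹`.
Hence the only singular quantity is the ratio `v / (q + ε)`. -/
theorem abs_logRate_le (hv : IsWeightedDensity p C v) (hq : IsWeightedDensity p C q) (hε : 0 ≤ ε)
    (hΛ : 0 ≤ Λ) {y : Fin d → ℝ}
    (hc : v y ≠ 0 → CoefficientBoundAt F B s y (Λ * (1 + ‖y‖) ^ p)) :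
    |logRate F B s v q ε y| ≤ (2 * d ^ 2 + 1) * (Λ * C)
      * (decayWeight y + (1 + ‖y‖) ^ p * (v y * (q y + ε)⁻¹)) := by
  have hw := decayWeight_pos y
  have hC := hv.const_nonneg
  have hpos : (0 : ℝ) < (1 + ‖y‖) ^ p := by positivity
  have hr0 : 0 ≤ (q y + ε)⁻¹ := inv_nonneg.2 (add_nonneg (hq.nonneg y) hε)
  by_cases h0 : v y = 0
  · rw [logRate_eq_zero h0, h0]
    simp; positivity
  have hv0 : 0 < v y := (hv.nonneg y).lt_of_ne' h0
  have hlow := neg_le_logRate hv hq.nonneg hε hΛ hc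
  have hc := hc h0
  set r := (q y + ε)⁻¹ with hr
  have hX : 0 ≤ (1 + ‖y‖) ^ p * (v y * r) := by positivity
  have hqr : q y * r ≤ 1 := mul_inv_le_one_of_le₀ (by linarith) (add_nonneg (hq.nonneg y) hε)
  have h1 := diffusionForm_le (B := B) (s := s) (y := y)
    (a := fun i => partialD i v y * (v y)⁻¹ - partialD i q y * r)
    (e := 2 * (C * decayWeight y / ((1 + ‖y‖) ^ p * v y)) + 2 * (C * r))
    (by positivity) hc.diffusionMatrix_le (fun i => by
      have e1 : (partialD i v y * (v y)⁻¹) ^ 2 ≤ C * decayWeight y / ((1 + ‖y‖) ^ p * v y) := by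
        rw [← div_eq_mul_inv, div_pow, div_le_div_iff₀ (by positivity) (by positivity)]
        have := hv.sq_partialD_le i y
        nlinarith
      have e2 : (partialD i q y * r) ^ 2 ≤ C * r := by
        have h3 := hq.sq_partialD_le_const i y
        calc (partialD i q y * r) ^ 2 = partialD i q y ^ 2 * r ^ 2 := by ring
          _ ≤ C * q y * r ^ 2 := by gcongr
          _ = C * r * (q y * r) := by ring
          _ ≤ C * r * 1 := by gcongr
          _ = C * r := by ring
      nlinarith [sq_nonneg (partialD i v y * (v y)⁻¹ + partialD i q y * r)])
  have h2 : v y * diffusionForm B s y (fun i => partialD i v y * (v y)⁻¹ - partialD i q y * r)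
      (fun i => partialD i v y * (v y)⁻¹ - partialD i q y * r)
      ≤ 2 * d ^ 2 * (Λ * C) * (decayWeight y + (1 + ‖y‖) ^ p * (v y * r)) := by
    calc _ ≤ v y * (d ^ 2 * (Λ * (1 + ‖y‖) ^ p
          * (2 * (C * decayWeight y / ((1 + ‖y‖) ^ p * v y)) + 2 * (C * r)))) := by gcongr
      _ = _ := by field_simp
  have h3 : fluxDriftDiv F B s y * (v y * (q y * r)) ≤ Λ * (C * decayWeight y) := by
    calc _ ≤ |fluxDriftDiv F B s y| * (v y * (q y * r)) := by
          have := mul_nonneg (hq.nonneg y) hr0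
          gcongr
          exact le_abs_self _
      _ ≤ (Λ * (1 + ‖y‖) ^ p) * (v y * 1) := by
          have := hc.fluxDriftDiv_le
          have := mul_nonneg (hq.nonneg y) hr0
          gcongr
      _ = Λ * ((1 + ‖y‖) ^ p * v y) := by ring
      _ ≤ Λ * (C * decayWeight y) := by exact mul_le_mul_of_nonneg_left (hv.le y) (by positivity)
  have h4 : 0 ≤ diffusionForm B s y (fun i => partialD i v y) (fun i => partialD i v y) * (v y)⁻¹ :=
    mul_nonneg (diffusionForm_nonneg _ _ _) (inv_nonneg.2 hv0.le)
  have hΛC : 0 ≤ Λ * C := by positivity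
  have h5 : 0 ≤ (Λ * C) * ((1 + ‖y‖) ^ p * (v y * r)) := by positivity
  have h6 : 0 ≤ (d : ℝ) ^ 2 * ((Λ * C) * ((1 + ‖y‖) ^ p * (v y * r))) := by positivity
  have h7 : 0 ≤ (d : ℝ) ^ 2 * (Λ * C * decayWeight y) := by positivity
  rw [abs_le]
  constructor
  · nlinarith
  · simp only [logRate, ← hr]
    nlinarith

/-- The coefficients are bounded only where `v ≠ 0`; elsewhere `v` and its gradient vanish, and the
flux with them. -/
theorem integrable_flux (hF : ContDiff ℝ 1 (F s)) (hB : ContDiff ℝ 2 (B s))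
    (hv : IsWeightedDensity p C v) (hΛ : 0 ≤ Λ)
    (hc : ∀ y, v y ≠ 0 → CoefficientBoundAt F B s y (Λ * (1 + ‖y‖) ^ p)) (i : Fin d) :
    Integrable (flux F B s v i) ∧ ∀ y, |flux F B s v i y| ≤ (d + 1) * (Λ * C) * decayWeight y := by
  have hb : ∀ y, |flux F B s v i y| ≤ (d + 1) * (Λ * C) * decayWeight y := by
    intro y
    have hw := decayWeight_pos y
    have hC := hv.const_nonneg
    by_cases h0 : v y = 0
    · have : flux F B s v i y = 0 := by
        simp [flux, h0, partialD_eq_zero_of_nonneg hv.nonneg h0]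
      rw [this, abs_zero]; positivity
    have hc := hc y h0
    have h1 : ∀ j, |diffusionMatrix B s y i j * partialD j v y| ≤ Λ * (C * decayWeight y) := by
      intro j
      rw [abs_mul]
      calc _ ≤ (Λ * (1 + ‖y‖) ^ p) * |partialD j v y| := by
            gcongr; exact hc.diffusionMatrix_le i j
        _ = Λ * ((1 + ‖y‖) ^ p * |partialD j v y|) := by ring
        _ ≤ Λ * (C * decayWeight y) := by exact mul_le_mul_of_nonneg_left (hv.partialD_le j y) (by positivity)
    have h2 : |∑ j, diffusionMatrix B s y i j * partialD j v y| ≤ d * (Λ * (C * decayWeight y)) := by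
      refine (Finset.abs_sum_le_sum_abs _ _).trans ((Finset.sum_le_sum fun j _ => h1 j).trans ?_)
      simp
    have h3 : |fluxDrift F B s i y * v y| ≤ Λ * (C * decayWeight y) := by
      rw [abs_mul, abs_of_nonneg (hv.nonneg y)]
      calc _ ≤ (Λ * (1 + ‖y‖) ^ p) * v y := by
            have := hv.nonneg y
            gcongr; exact hc.fluxDrift_le i
        _ = Λ * ((1 + ‖y‖) ^ p * v y) := by ring
        _ ≤ Λ * (C * decayWeight y) := by exact mul_le_mul_of_nonneg_left (hv.le y) (by positivity)
    simp only [flux]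
    refine (abs_add_le _ _).trans ?_
    rw [abs_mul, abs_of_pos (by norm_num : (0 : ℝ) < 1 / 2)]
    have h5 : 0 ≤ (d : ℝ) * (Λ * (C * decayWeight y)) := by positivity
    nlinarith
  exact ⟨Continuous.integrable_of_le_decayWeight
    (contDiff_flux hF hB hv.contDiff i).continuous.aestronglyMeasurable hb, hb⟩

theorem integral_fokkerPlanck_eq_zero (hF : ContDiff ℝ 1 (F s)) (hB : ContDiff ℝ 2 (B s))
    (hv : IsWeightedDensity p C v) (hΛ : 0 ≤ Λ)
    (hc : ∀ y, v y ≠ 0 → CoefficientBoundAt F B s y (Λ * (1 + ‖y‖) ^ p))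
    {C' : ℝ} (hfv : ∀ y, |fokkerPlanck F B s v y| ≤ C' * decayWeight y) :
    ∫ y, fokkerPlanck F B s v y = 0 := by
  simp_rw [fokkerPlanck_eq_sum_partialD_flux hF hB hv.contDiff]
  refine integral_divergence_eq_zero (contDiff_flux hF hB hv.contDiff)
    (fun i => (integrable_flux hF hB hv hΛ hc i).1) ?_
  simp_rw [← fokkerPlanck_eq_sum_partialD_flux hF hB hv.contDiff]
  exact Continuous.integrable_of_le_decayWeight
    (continuous_fokkerPlanck hF hB hv.contDiff).aestronglyMeasurable hfv

theorem abs_log_add_le {C ε x : ℝ} (hε : 0 < ε) (hx : 0 ≤ x) (hxC : x ≤ C) :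
    |Real.log (x + ε)| ≤ |Real.log ε| + |Real.log (C + ε)| := by
  have h1 : Real.log ε ≤ Real.log (x + ε) := Real.log_le_log hε (by linarith)
  have h2 : Real.log (x + ε) ≤ Real.log (C + ε) := Real.log_le_log (by linarith) (by linarith)
  rw [abs_le]
  constructor
  · linarith [neg_abs_le (Real.log ε), abs_nonneg (Real.log (C + ε))]
  · linarith [le_abs_self (Real.log (C + ε)), abs_nonneg (Real.log ε)]

/-- The divergence theorem for `logField`. For fixed `ε > 0` both `log (q + ε)` and `(q + ε)⁻¹` are
bounded, so every term is dominated by a multiple of `decayWeight`; these multiples may blow up as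
`ε → 0`. -/
theorem integral_logRate (hF : ContDiff ℝ 1 (F s)) (hB : ContDiff ℝ 2 (B s))
    (hv : IsWeightedDensity p C v) (hq : IsWeightedDensity p C q) (hε : 0 < ε) (hΛ : 0 ≤ Λ)
    (hc : ∀ y, v y ≠ 0 → CoefficientBoundAt F B s y (Λ * (1 + ‖y‖) ^ p)) {C' : ℝ}
    (hfv : ∀ y, |fokkerPlanck F B s v y| ≤ C' * decayWeight y)
    (hfq : ∀ y, |fokkerPlanck F B s q y| ≤ C' * decayWeight y) :
    Integrable (fun y => fokkerPlanck F B s v y * Real.log (q y + ε)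
      + fokkerPlanck F B s q y * (v y * (q y + ε)⁻¹)) ∧
    Integrable (logRate F B s v q ε) ∧
    ∫ y, (fokkerPlanck F B s v y * Real.log (q y + ε)
      + fokkerPlanck F B s q y * (v y * (q y + ε)⁻¹)) = ∫ y, logRate F B s v q ε y := by
  have hC := hv.const_nonneg
  have hlog := fun y => abs_log_add_le hε (hq.nonneg y) (hq.le_const y)
  set L := |Real.log ε| + |Real.log (C + ε)| with hL
  have hL0 : 0 ≤ L := by positivity
  have hr : ∀ y, 0 < (q y + ε)⁻¹ := fun y => inv_pos.2 (by linarith [hq.nonneg y])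
  have hrε : ∀ y, (q y + ε)⁻¹ ≤ ε⁻¹ := fun y => inv_anti₀ hε (by linarith [hq.nonneg y])
  have hC' : 0 ≤ C' := by
    have h1 := (abs_nonneg _).trans (hfv 0)
    have h3 := decayWeight_pos (0 : Fin d → ℝ)
    by_contra h; push Not at h
    nlinarith
  have c1 : ContDiff ℝ 1 (fun y => q y + ε) :=
    (hq.contDiff.of_le one_le_two).add contDiff_const
  have hne : ∀ y, q y + ε ≠ 0 := fun y => by have := hq.nonneg y; positivity
  have clog : Continuous (fun y => Real.log (q y + ε)) := c1.continuous.log hne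
  have cinv : Continuous (fun y => (q y + ε)⁻¹) := c1.continuous.inv₀ hne
  have cfv := continuous_fokkerPlanck hF hB hv.contDiff
  have cfq := continuous_fokkerPlanck hF hB hq.contDiff
  have cG := (cfv.mul clog).add (cfq.mul (hv.contDiff.continuous.mul cinv))
  have iG : Integrable (fun y => fokkerPlanck F B s v y * Real.log (q y + ε)
      + fokkerPlanck F B s q y * (v y * (q y + ε)⁻¹)) := by
    refine Continuous.integrable_of_le_decayWeight cG.aestronglyMeasurable
      (c := C' * L + C' * (C * ε⁻¹)) fun y => ?_
    have hw := decayWeight_pos y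
    refine (abs_add_le _ _).trans ?_
    rw [abs_mul, abs_mul, abs_of_nonneg (mul_nonneg (hv.nonneg y) (hr y).le), add_mul]
    refine add_le_add ?_ ?_
    · calc _ ≤ (C' * decayWeight y) * L := by
            have := hfv y
            have := hlog y
            gcongr
        _ = _ := by ring
    · calc _ ≤ (C' * decayWeight y) * (C * ε⁻¹) := by
            have := hfq y
            have := hv.nonneg y
            have := (hr y).le
            have := hv.le_const y
            have := hrε y
            gcongr
        _ = _ := by ring
  have hdiv := sum_partialD_logField hF hB hv.contDiff hq.contDiff hv.nonneg hq.nonneg hε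
  have hV := contDiff_logField hF hB hv.contDiff hq.contDiff hq.nonneg hε
  -- The definition contains `(v y)⁻¹`. Continuity is instead inherited from the divergence
  -- identity, all of whose other terms are continuous.
  have cΘ : Continuous (logRate F B s v q ε) := by
    have : logRate F B s v q ε = fun y => (fokkerPlanck F B s v y * Real.log (q y + ε)
      + fokkerPlanck F B s q y * (v y * (q y + ε)⁻¹))
      - ∑ i, partialD i (logField F B s v q ε i) y := by
      funext y; rw [hdiv y]; ring
    rw [this]
    exact cG.sub (continuous_finsetSum _ fun i _ => (hV i).continuous_partialD i)
  have iΘ : Integrable (logRate F B s v q ε) := by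
    refine Continuous.integrable_of_le_decayWeight cΘ.aestronglyMeasurable
      (c := (2 * d ^ 2 + 1) * (Λ * C) * (1 + C * ε⁻¹)) fun y => ?_
    refine (abs_logRate_le hv hq hε.le hΛ (hc y)).trans ?_
    rw [mul_assoc ((2 * (d : ℝ) ^ 2 + 1) * (Λ * C))]
    gcongr
    calc decayWeight y + (1 + ‖y‖) ^ p * (v y * (q y + ε)⁻¹)
        = decayWeight y + ((1 + ‖y‖) ^ p * v y) * (q y + ε)⁻¹ := by ring
      _ ≤ decayWeight y + (C * decayWeight y) * ε⁻¹ := by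
          have := hv.le y
          have := hrε y
          have := hr y
          have := decayWeight_pos y
          gcongr
      _ = (1 + C * ε⁻¹) * decayWeight y := by ring
  have hz := integral_divergence_eq_zero hV (fun i => ?_) ?_
  · refine ⟨iG, iΘ, ?_⟩
    have : ∫ y, ((fokkerPlanck F B s v y * Real.log (q y + ε)
      + fokkerPlanck F B s q y * (v y * (q y + ε)⁻¹)) - logRate F B s v q ε y) = 0 := by
      rw [← hz]
      exact integral_congr_ae (Filter.Eventually.of_forall fun y => (hdiv y).symm)
    rw [integral_sub iG iΘ, sub_eq_zero] at this
    exact this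
  · refine Continuous.integrable_of_le_decayWeight (hV i).continuous.aestronglyMeasurable
      (c := (d + 1) * (Λ * C) * L + ε⁻¹ * (d * (Λ * C * C))) fun y => ?_
    have hw := decayWeight_pos y
    by_cases h0 : v y = 0
    · have : logField F B s v q ε i y = 0 := by
        simp [logField, flux, h0, partialD_eq_zero_of_nonneg hv.nonneg h0]
      rw [this, abs_zero]; positivity
    have h1 := (integrable_flux hF hB hv hΛ hc i).2 y
    have h2 : |∑ j, diffusionMatrix B s y i j * partialD j q y| ≤ d * (Λ * (1 + ‖y‖) ^ p * C) := by
      refine (Finset.abs_sum_le_sum_abs _ _).trans ?_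
      calc _ ≤ ∑ _j : Fin d, Λ * (1 + ‖y‖) ^ p * C := by
            refine Finset.sum_le_sum fun j _ => ?_
            rw [abs_mul]
            have := (hc y h0).diffusionMatrix_le i j
            have := hq.abs_partialD_le_const j y
            gcongr
        _ = _ := by simp
    simp only [logField]
    refine (abs_add_le _ _).trans ?_
    rw [add_mul, abs_mul, abs_mul _ ((1 : ℝ) / 2 * _), abs_mul (1 / 2 : ℝ),
      abs_of_nonneg (mul_nonneg (hv.nonneg y) (hr y).le), abs_of_pos (by norm_num : (0 : ℝ) < 1 / 2)]
    refine add_le_add ?_ ?_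
    · calc _ ≤ ((d + 1) * (Λ * C) * decayWeight y) * L := by
            have := hlog y
            gcongr
        _ = _ := by ring
    · calc _ ≤ (v y * ε⁻¹) * (1 * (d * (Λ * (1 + ‖y‖) ^ p * C))) := by
            have := hv.nonneg y
            have := hrε y
            gcongr
            norm_num
        _ = ε⁻¹ * (d * (Λ * C)) * ((1 + ‖y‖) ^ p * v y) := by ring
        _ ≤ ε⁻¹ * (d * (Λ * C)) * (C * decayWeight y) := by exact mul_le_mul_of_nonneg_left (hv.le y) (by positivity)
        _ = _ := by ring
  · exact (iG.sub iΘ).congr (Filter.Eventually.of_forall fun y => (hdiv y).symm)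

end FixedTime

end Bounds

/-! ### Polynomial growth of the coefficients in divergence form -/

section CoefficientBounds

variable {d m : ℕ} {F : ℝ → (Fin d → ℝ) → Fin d → ℝ} {B : ℝ → (Fin d → ℝ) → Fin d → Fin m → ℝ}

/-- The constant in `HasPolynomialBoundAt.coefficientBoundAt`. -/
noncomputable def coefficientConst (c : ℝ) (d m : ℕ) : ℝ :=
  ((m : ℝ) + (d * m + 1) + d * (2 * d * m + 1)) * (1 + c ^ 2)

theorem coefficientConst_nonneg (c : ℝ) (d m : ℕ) : 0 ≤ coefficientConst c d m := by
  unfold coefficientConst; positivity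

/-- With `κ` bounding `F`, `B` and their derivatives, the product rule gives `m κ²`, `2 m κ²` and `4
m κ²` for the entries of `g = B Bᵀ` and their first and second derivatives. The quadratic dependence
on `B` doubles the exponent to `2 * p`, and `κ ≤ 1 + κ²` lets `F` share the same bound. -/
theorem HasPolynomialBoundAt.coefficientBoundAt {c : ℝ} {p : ℕ} {s : ℝ} {y : Fin d → ℝ}
    (h : HasPolynomialBoundAt F B c p s y) (hF : ContDiff ℝ 1 (F s)) (hB : ContDiff ℝ 2 (B s)) :
    CoefficientBoundAt F B s y (coefficientConst c d m * (1 + ‖y‖) ^ (2 * p)) := by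
  obtain ⟨h1, h2⟩ := h
  set κ := c * (1 + ‖y‖) ^ p with hκ
  have single_le : ∀ i : Fin d, ‖(Pi.single i 1 : Fin d → ℝ)‖ ≤ 1 := fun i => by
    simp [Pi.norm_single]
  have F0 : ∀ i, |F s y i| ≤ κ := fun i => by
    have := h1 0 zero_le_one
    rw [norm_iteratedFDeriv_zero] at this
    exact (norm_le_pi_norm (F s y) i).trans this
  have F1 : ∀ i j, |partialD j (fun z => F s z i) y| ≤ κ := fun i j => by
    have h3 := h1 1 le_rfl
    rw [norm_iteratedFDeriv_one] at h3
    have e : partialD j (fun z => F s z i) y = fderiv ℝ (F s) y (Pi.single j 1) i := by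
      have := (hasFDerivAt_pi'.1 (hF.differentiable one_ne_zero y).hasFDerivAt i).fderiv
      simp only [partialD]; rw [this]; rfl
    rw [e]
    calc _ ≤ ‖fderiv ℝ (F s) y (Pi.single j 1)‖ := norm_le_pi_norm (f := _) i
      _ ≤ ‖fderiv ℝ (F s) y‖ * 1 := (fderiv ℝ (F s) y).le_opNorm_of_le (single_le j)
      _ ≤ κ := by rw [mul_one]; exact h3
  have hBd : ∀ z, HasFDerivAt (B s) (fderiv ℝ (B s) z) z := fun z =>
    (hB.differentiable two_ne_zero z).hasFDerivAt
  have eB : ∀ i k j, partialD j (fun z => B s z i k)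
      = fun z => fderiv ℝ (B s) z (Pi.single j 1) i k := fun i k j => by
    funext z
    have := (hasFDerivAt_pi'.1 (hasFDerivAt_pi'.1 (hBd z) i) k).fderiv
    simp only [partialD]; rw [this]; rfl
  have eBB : ∀ i k j l, partialD l (partialD j (fun z => B s z i k)) y
      = fderiv ℝ (fderiv ℝ (B s)) y (Pi.single l 1) (Pi.single j 1) i k := fun i k j l => by
    rw [eB]
    have hd : HasFDerivAt (fderiv ℝ (B s)) (fderiv ℝ (fderiv ℝ (B s)) y) y :=
      ((hB.fderiv_right (m := 1) (by norm_num)).differentiable one_ne_zero y).hasFDerivAt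
    have h4 := hd.clm_apply (hasFDerivAt_const (Pi.single j 1 : Fin d → ℝ) y)
    have := (hasFDerivAt_pi'.1 (hasFDerivAt_pi'.1 h4 i) k).fderiv
    simp only [partialD]; rw [this]; simp
  have entry_le : ∀ (M : Fin d → Fin m → ℝ) i k, |M i k| ≤ ‖M‖ := fun M i k =>
    (norm_le_pi_norm (M i) k).trans (norm_le_pi_norm M i)
  have B0 : ∀ i k, |B s y i k| ≤ κ := fun i k => by
    have := h2 0 zero_le_two
    rw [norm_iteratedFDeriv_zero] at this
    exact (entry_le _ i k).trans this
  have B1 : ∀ i k j, |partialD j (fun z => B s z i k) y| ≤ κ := fun i k j => by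
    have h3 := h2 1 one_le_two
    rw [norm_iteratedFDeriv_one] at h3
    rw [eB]
    calc _ ≤ ‖fderiv ℝ (B s) y (Pi.single j 1)‖ := entry_le _ i k
      _ ≤ ‖fderiv ℝ (B s) y‖ * 1 := (fderiv ℝ (B s) y).le_opNorm_of_le (single_le j)
      _ ≤ κ := by rw [mul_one]; exact h3
  have B2 : ∀ i k j l, |partialD l (partialD j (fun z => B s z i k)) y| ≤ κ := fun i k j l => by
    have h3 := h2 2 le_rfl
    rw [show (2 : ℕ) = 1 + 1 from rfl, ← norm_iteratedFDeriv_fderiv, norm_iteratedFDeriv_one] at h3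
    rw [eBB]
    calc _ ≤ ‖fderiv ℝ (fderiv ℝ (B s)) y (Pi.single l 1) (Pi.single j 1)‖ := entry_le _ i k
      _ ≤ ‖fderiv ℝ (fderiv ℝ (B s)) y (Pi.single l 1)‖ * 1 :=
          ContinuousLinearMap.le_opNorm_of_le _ (single_le j)
      _ ≤ (‖fderiv ℝ (fderiv ℝ (B s)) y‖ * 1) * 1 := by
          gcongr
          exact ContinuousLinearMap.le_opNorm_of_le _ (single_le l)
      _ ≤ κ := by rw [mul_one, mul_one]; exact h3
  have hBc : ∀ i k, ContDiff ℝ 2 (fun z => B s z i k) := fun i k =>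
    (contDiff_pi.1 ((contDiff_pi.1 hB) i)) k
  have hBd0 : ∀ i k z, DifferentiableAt ℝ (fun z => B s z i k) z := fun i k z =>
    (hBc i k).differentiable two_ne_zero z
  have hBd1 : ∀ i k j z, DifferentiableAt ℝ (partialD j (fun z => B s z i k)) z := fun i k j z =>
    ((hBc i k).contDiff_one_partialD j).differentiable one_ne_zero z
  have prod_le : ∀ {a b : ℝ}, |a| ≤ κ → |b| ≤ κ → |a * b| ≤ κ ^ 2 := fun {a b} ha hb => by
    rw [abs_mul, sq]
    exact mul_le_mul ha hb (abs_nonneg _) ((abs_nonneg _).trans ha)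
  have g0 : ∀ i j, |diffusionMatrix B s y i j| ≤ m * κ ^ 2 := fun i j => by
    refine (Finset.abs_sum_le_sum_abs _ _).trans
      ((Finset.sum_le_sum fun k _ => prod_le (B0 i k) (B0 j k)).trans ?_)
    simp
  have e1 : ∀ i j l, partialD l (fun z => diffusionMatrix B s z i j)
      = fun z => ∑ k, (B s z i k * partialD l (fun z => B s z j k) z
        + B s z j k * partialD l (fun z => B s z i k) z) := fun i j l => by
    funext z
    simp only [diffusionMatrix]
    rw [partialD_sum (f := fun k z => B s z i k * B s z j k)
      (fun k _ => (hBd0 i k z).fun_mul (hBd0 j k z))]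
    exact Finset.sum_congr rfl fun k _ => partialD_mul (hBd0 i k z) (hBd0 j k z)
  have g1 : ∀ i j l, |partialD l (fun z => diffusionMatrix B s z i j) y| ≤ m * (2 * κ ^ 2) := by
    intro i j l
    rw [e1]
    refine (Finset.abs_sum_le_sum_abs _ _).trans
      ((Finset.sum_le_sum (g := fun _ => 2 * κ ^ 2) fun k _ => ?_).trans ?_)
    · refine (abs_add_le _ _).trans ?_
      linarith [prod_le (B0 i k) (B1 j k l), prod_le (B0 j k) (B1 i k l)]
    · simp
  have g2 : ∀ i j l l', |partialD l' (partialD l (fun z => diffusionMatrix B s z i j)) y|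
      ≤ m * (4 * κ ^ 2) := by
    intro i j l l'
    rw [e1, partialD_sum (fun k _ => ((hBd0 i k y).fun_mul (hBd1 j k l y)).fun_add
      ((hBd0 j k y).fun_mul (hBd1 i k l y)))]
    refine (Finset.abs_sum_le_sum_abs _ _).trans
      ((Finset.sum_le_sum (g := fun _ => 4 * κ ^ 2) fun k _ => ?_).trans ?_)
    · rw [partialD_add ((hBd0 i k y).fun_mul (hBd1 j k l y))
        ((hBd0 j k y).fun_mul (hBd1 i k l y)), partialD_mul (hBd0 i k y) (hBd1 j k l y),
        partialD_mul (hBd0 j k y) (hBd1 i k l y)]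
      have a1 := prod_le (B0 i k) (B2 j k l l')
      have a2 := prod_le (B1 j k l) (B1 i k l')
      have a3 := prod_le (B0 j k) (B2 i k l l')
      have a4 := prod_le (B1 i k l) (B1 j k l')
      refine (abs_add_le _ _).trans ?_
      linarith [abs_add_le (B s y i k * partialD l' (partialD l fun z => B s z j k) y)
          (partialD l (fun z => B s z j k) y * partialD l' (fun z => B s z i k) y),
        abs_add_le (B s y j k * partialD l' (partialD l fun z => B s z i k) y)
          (partialD l (fun z => B s z i k) y * partialD l' (fun z => B s z j k) y)]
    · simp
  have hg := fun i j => contDiff_diffusionMatrix (k := 2) hB i j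
  have hκ2 : 1 + κ ^ 2 ≤ (1 + c ^ 2) * (1 + ‖y‖) ^ (2 * p) := by
    have e : κ ^ 2 = c ^ 2 * (1 + ‖y‖) ^ (2 * p) := by rw [hκ, mul_pow, ← pow_mul, mul_comm p 2]
    rw [e, add_mul, one_mul]
    have := one_le_one_add_norm_pow (2 * p) y
    linarith
  have hκ1 : κ ≤ 1 + κ ^ 2 := by nlinarith [sq_nonneg (κ - 1)]
  have hsq := sq_nonneg κ
  -- `coefficientConst` contains the sum of the constants `m`, `d * m + 1` and `d * (2 * d * m + 1)`
  -- of the three bounds, so each of them may be enlarged to it.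
  have final : ∀ {x a : ℝ}, 0 ≤ a → a ≤ (m : ℝ) + (d * m + 1) + d * (2 * d * m + 1) →
      x ≤ a * (1 + κ ^ 2) → x ≤ coefficientConst c d m * (1 + ‖y‖) ^ (2 * p) := by
    intro x a ha0 ha hx
    refine hx.trans ?_
    unfold coefficientConst
    rw [mul_assoc]
    gcongr
  have hm : (0 : ℝ) ≤ m := by positivity
  have hdm : (0 : ℝ) ≤ d * m := by positivity
  have hddm : (0 : ℝ) ≤ d * (2 * d * m + 1) := by positivity
  refine ⟨fun i j => ?_, fun i => ?_, ?_⟩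
  · refine final hm (by linarith) ((g0 i j).trans ?_)
    nlinarith
  · refine final (a := d * m + 1) (by positivity) (by linarith) ?_
    simp only [fluxDrift]
    refine (abs_sub _ _).trans ?_
    have h5 : |∑ j, partialD j (fun z => diffusionMatrix B s z i j) y| ≤ d * (m * (2 * κ ^ 2)) := by
      refine (Finset.abs_sum_le_sum_abs _ _).trans
        ((Finset.sum_le_sum fun j _ => g1 i j j).trans ?_)
      simp
    rw [abs_mul, abs_of_pos (by norm_num : (0 : ℝ) < 1 / 2)]
    have h6 := F0 i
    nlinarith
  · refine final (a := d * (2 * d * m + 1)) (by positivity) (by linarith) ?_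
    have h7 : ∀ i, |partialD i (fluxDrift F B s i) y| ≤ (2 * d * m + 1) * (1 + κ ^ 2) := by
      intro i
      have hdj : ∀ j, DifferentiableAt ℝ (partialD j (fun z => diffusionMatrix B s z i j)) y :=
        fun j => ((hg i j).contDiff_one_partialD j).differentiable one_ne_zero y
      have e3 : partialD i (fluxDrift F B s i) y
          = (1 / 2) * (∑ j, partialD i (partialD j (fun z => diffusionMatrix B s z i j)) y)
            - partialD i (fun z => F s z i) y := by
        rw [show fluxDrift F B s i = fun y =>
          (1 / 2) * (∑ j, partialD j (fun z => diffusionMatrix B s z i j) y) - F s y i from rfl,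
          partialD_sub ((DifferentiableAt.fun_sum fun j _ => hdj j).const_mul _)
            (((contDiff_pi.1 hF) i).differentiable one_ne_zero y),
          partialD_const_mul _ (DifferentiableAt.fun_sum fun j _ => hdj j),
          partialD_sum (fun j _ => hdj j)]
      rw [e3]
      refine (abs_sub _ _).trans ?_
      have h5 : |∑ j, partialD i (partialD j (fun z => diffusionMatrix B s z i j)) y|
          ≤ d * (m * (4 * κ ^ 2)) := by
        refine (Finset.abs_sum_le_sum_abs _ _).trans
          ((Finset.sum_le_sum fun j _ => g2 i j j i).trans ?_)
        simp
      rw [abs_mul, abs_of_pos (by norm_num : (0 : ℝ) < 1 / 2)]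
      have h6 := F1 i i
      nlinarith
    refine (Finset.abs_sum_le_sum_abs _ _).trans ((Finset.sum_le_sum fun i _ => h7 i).trans ?_)
    simp
    linarith

end CoefficientBounds

/-! ### Joint regularity of the coefficients in time and space -/

section Params

variable {d : ℕ}

theorem partialD_eq_fderiv_uncurry {f : ℝ → (Fin d → ℝ) → ℝ}
    (hf : Differentiable ℝ (fun z : ℝ × (Fin d → ℝ) => f z.1 z.2)) (i : Fin d) (s : ℝ)
    (y : Fin d → ℝ) : partialD i (f s) y
      = fderiv ℝ (fun z : ℝ × (Fin d → ℝ) => f z.1 z.2) (s, y) (0, Pi.single i 1) := by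
  have := ((hf (s, y)).hasFDerivAt.comp y (hasFDerivAt_prodMk_right s y)).fderiv
  simp only [partialD]
  rw [show f s = (fun z : ℝ × (Fin d → ℝ) => f z.1 z.2) ∘ (fun y => (s, y)) from rfl, this]
  simp

theorem contDiff_partialD_uncurry {f : ℝ → (Fin d → ℝ) → ℝ}
    (hf : ContDiff ℝ 2 (fun z : ℝ × (Fin d → ℝ) => f z.1 z.2)) (i : Fin d) :
    ContDiff ℝ 1 (fun z : ℝ × (Fin d → ℝ) => partialD i (f z.1) z.2) := by
  simp_rw [partialD_eq_fderiv_uncurry (hf.differentiable two_ne_zero) i]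
  exact (hf.fderiv_right (m := 1) (by norm_num)).clm_apply contDiff_const

theorem continuous_partialD_uncurry {f : ℝ → (Fin d → ℝ) → ℝ}
    (hf : ContDiff ℝ 1 (fun z : ℝ × (Fin d → ℝ) => f z.1 z.2)) (i : Fin d) :
    Continuous (fun z : ℝ × (Fin d → ℝ) => partialD i (f z.1) z.2) := by
  simp_rw [partialD_eq_fderiv_uncurry (hf.differentiable one_ne_zero) i]
  exact (hf.continuous_fderiv one_ne_zero).clm_apply continuous_const

variable {m : ℕ} {F : ℝ → (Fin d → ℝ) → Fin d → ℝ} {B : ℝ → (Fin d → ℝ) → Fin d → Fin m → ℝ}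

theorem contDiff_diffusionMatrix_uncurry
    (hB : ContDiff ℝ 2 (fun z : ℝ × (Fin d → ℝ) => B z.1 z.2)) (i j : Fin d) :
    ContDiff ℝ 2 (fun z : ℝ × (Fin d → ℝ) => diffusionMatrix B z.1 z.2 i j) := by
  have h : ∀ i k, ContDiff ℝ 2 (fun z : ℝ × (Fin d → ℝ) => B z.1 z.2 i k) := fun i k =>
    (contDiff_pi.1 ((contDiff_pi.1 hB) i)) k
  exact ContDiff.sum fun k _ => (h i k).mul (h j k)

theorem contDiff_fluxDrift_uncurry (hF : ContDiff ℝ 1 (fun z : ℝ × (Fin d → ℝ) => F z.1 z.2))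
    (hB : ContDiff ℝ 2 (fun z : ℝ × (Fin d → ℝ) => B z.1 z.2)) (i : Fin d) :
    ContDiff ℝ 1 (fun z : ℝ × (Fin d → ℝ) => fluxDrift F B z.1 i z.2) :=
  (contDiff_const.mul (ContDiff.sum fun j _ => contDiff_partialD_uncurry
    (f := fun s z => diffusionMatrix B s z i j) (contDiff_diffusionMatrix_uncurry hB i j) j)).sub
    ((contDiff_pi.1 hF) i)

theorem continuous_fluxDriftDiv_uncurry
    (hF : ContDiff ℝ 1 (fun z : ℝ × (Fin d → ℝ) => F z.1 z.2))
    (hB : ContDiff ℝ 2 (fun z : ℝ × (Fin d → ℝ) => B z.1 z.2)) :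
    Continuous (fun z : ℝ × (Fin d → ℝ) => fluxDriftDiv F B z.1 z.2) :=
  continuous_finsetSum _ fun i _ => continuous_partialD_uncurry
    (f := fun s => fluxDrift F B s i) (contDiff_fluxDrift_uncurry hF hB i) i

theorem ContDiff.slice {G : Type*} [NormedAddCommGroup G] [NormedSpace ℝ G] {k : WithTop ℕ∞}
    {f : ℝ → (Fin d → ℝ) → G} (hf : ContDiff ℝ k (fun z : ℝ × (Fin d → ℝ) => f z.1 z.2)) (s : ℝ) :
    ContDiff ℝ k (f s) :=
  hf.comp (f := fun y => (s, y)) (contDiff_const.prodMk contDiff_id)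

end Params

/-! ### Two solutions of one equation: integrability of `v log q` -/

/-- Two nonnegative rapidly decreasing solutions `v`, `q` of the same Fokker–Planck equation, whose
coefficients grow at most polynomially where `v` is nonzero. -/
structure IsFokkerPlanckPair {d m : ℕ} (F : ℝ → (Fin d → ℝ) → Fin d → ℝ)
    (B : ℝ → (Fin d → ℝ) → Fin d → Fin m → ℝ) (t₀ t₁ : ℝ) (K : ℕ → ℝ) (p : ℕ) (Λ : ℝ)
    (v vt q qt : ℝ → (Fin d → ℝ) → ℝ) : Prop where
  contDiff_drift : ContDiff ℝ 1 (fun z : ℝ × (Fin d → ℝ) => F z.1 z.2)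
  contDiff_noise : ContDiff ℝ 2 (fun z : ℝ × (Fin d → ℝ) => B z.1 z.2)
  lt : t₀ < t₁
  bound_nonneg : 0 ≤ Λ
  decaying : IsDecayingFamily K t₀ t₁ v vt
  decaying' : IsDecayingFamily K t₀ t₁ q qt
  nonneg : ∀ s ∈ Set.Icc t₀ t₁, ∀ y, 0 ≤ v s y
  nonneg' : ∀ s ∈ Set.Icc t₀ t₁, ∀ y, 0 ≤ q s y
  eq : ∀ s ∈ Set.Ico t₀ t₁, ∀ y, vt s y = fokkerPlanck F B s (v s) y
  eq' : ∀ s ∈ Set.Ico t₀ t₁, ∀ y, qt s y = fokkerPlanck F B s (q s) y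
  coefficient : ∀ s ∈ Set.Icc t₀ t₁, ∀ y, v s y ≠ 0 →
    CoefficientBoundAt F B s y (Λ * (1 + ‖y‖) ^ p)

/-- The rate in the uniform lower bounds for `∫ v log (q + ε)`. -/
noncomputable def lowerRate (K : ℕ → ℝ) (p : ℕ) (Λ : ℝ) (d : ℕ) : ℝ :=
  (d ^ 2 + 1) * (Λ * weightConst K p d) * ∫ y : Fin d → ℝ, decayWeight y

namespace IsFokkerPlanckPair

variable {d m : ℕ} {F : ℝ → (Fin d → ℝ) → Fin d → ℝ} {B : ℝ → (Fin d → ℝ) → Fin d → Fin m → ℝ}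
  {t₀ t₁ Λ ε : ℝ} {K : ℕ → ℝ} {p : ℕ} {v vt q qt : ℝ → (Fin d → ℝ) → ℝ}
  (h : IsFokkerPlanckPair F B t₀ t₁ K p Λ v vt q qt)

include h

theorem isWeightedDensity {s : ℝ} (hs : s ∈ Set.Icc t₀ t₁) :
    IsWeightedDensity p (weightConst K p d) (v s) :=
  h.decaying.isWeightedDensity hs (h.nonneg s hs) p

theorem isWeightedDensity' {s : ℝ} (hs : s ∈ Set.Icc t₀ t₁) :
    IsWeightedDensity p (weightConst K p d) (q s) :=
  h.decaying'.isWeightedDensity hs (h.nonneg' s hs) p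

theorem weightConst_nonneg : 0 ≤ weightConst K p d :=
  (h.isWeightedDensity ⟨le_rfl, h.lt.le⟩).const_nonneg

theorem abs_deriv_le {s : ℝ} (hs : s ∈ Set.Icc t₀ t₁) (y : Fin d → ℝ) :
    |vt s y| ≤ weightConst K p d * decayWeight y :=
  (le_mul_of_one_le_left (abs_nonneg _) (one_le_one_add_norm_pow p y)).trans
    (le_mul_decayWeight ((h.decaying.bound_deriv (p + d + 1) s hs y).trans
      (h.decaying.le_weightConst h.lt.le p)))

theorem abs_deriv_le' {s : ℝ} (hs : s ∈ Set.Icc t₀ t₁) (y : Fin d → ℝ) :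
    |qt s y| ≤ weightConst K p d * decayWeight y :=
  (le_mul_of_one_le_left (abs_nonneg _) (one_le_one_add_norm_pow p y)).trans
    (le_mul_decayWeight ((h.decaying'.bound_deriv (p + d + 1) s hs y).trans
      (h.decaying'.le_weightConst h.lt.le p)))

/-- The total mass of `v` is conserved. -/
theorem integral_eq {s : ℝ} (hs : s ∈ Set.Icc t₀ t₁) : ∫ y, v s y = ∫ y, v t₀ y := by
  set C := weightConst K p d with hC
  have hcont : ContinuousOn (fun s => ∫ y, v s y) (Set.Icc t₀ t₁) := by
    refine continuousOn_of_dominated (bound := fun y => C * decayWeight y)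
      (fun s hs => (h.isWeightedDensity hs).contDiff.continuous.aestronglyMeasurable)
      (fun s hs => Filter.Eventually.of_forall fun y => ?_) (integrable_decayWeight.const_mul C)
      (Filter.Eventually.of_forall fun y s hs =>
        (h.decaying.hasDerivWithinAt s hs y).continuousWithinAt)
    rw [Real.norm_eq_abs, abs_of_nonneg (h.nonneg s hs y)]
    exact (h.isWeightedDensity hs).le_decayWeight y
  have hder : ∀ s ∈ Set.Ioo t₀ t₁, HasDerivAt (fun s => ∫ y, v s y) 0 s := by
    intro s hs
    have hsI := Set.Ioo_subset_Icc_self hs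
    have hvt : ∀ y, vt s y = fokkerPlanck F B s (v s) y := h.eq s ⟨hs.1.le, hs.2⟩
    have hz : ∫ y, vt s y = 0 := by
      simp_rw [hvt]
      refine integral_fokkerPlanck_eq_zero (h.contDiff_drift.slice s) (h.contDiff_noise.slice s)
        (h.isWeightedDensity hsI) h.bound_nonneg (h.coefficient s hsI) (C' := C) fun y => ?_
      rw [← hvt]
      exact h.abs_deriv_le hsI y
    have h1 := hasDerivAt_integral_of_dominated_loc_of_deriv_le (μ := volume)
      (F := fun s y => v s y) (F' := fun s y => vt s y) (x₀ := s) (s := Set.Ioo t₀ t₁)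
      (bound := fun y => C * decayWeight y) (isOpen_Ioo.mem_nhds hs) ?_
      (h.isWeightedDensity hsI).integrable ?_ ?_ (integrable_decayWeight.const_mul C) ?_
    · rw [hz] at h1; exact h1.2
    · filter_upwards [isOpen_Ioo.mem_nhds hs] with r hr
      exact (h.isWeightedDensity (Set.Ioo_subset_Icc_self hr)).contDiff.continuous.aestronglyMeasurable
    · simp_rw [hvt]
      exact (continuous_fokkerPlanck (h.contDiff_drift.slice s) (h.contDiff_noise.slice s)
        (h.isWeightedDensity hsI).contDiff).aestronglyMeasurable
    · exact Filter.Eventually.of_forall fun y r hr => h.abs_deriv_le (Set.Ioo_subset_Icc_self hr) y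
    · exact Filter.Eventually.of_forall fun y r hr =>
        (h.decaying.hasDerivWithinAt r (Set.Ioo_subset_Icc_self hr) y).hasDerivAt
          (Icc_mem_nhds hr.1 hr.2)
  exact constant_of_has_deriv_right_zero (hcont.mono (Set.Icc_subset_Icc_right le_rfl))
    (fun x hx => by
      rcases hx.1.eq_or_lt with h0 | h0
      · -- the right derivative at the left end point is the limit of the derivatives
        subst h0
        refine hasDerivWithinAt_Ici_of_tendsto_deriv (s := Set.Ioo t₀ t₁)
          (fun r hr => (hder r hr).differentiableAt.differentiableWithinAt)
          ((hcont t₀ ⟨le_rfl, h.lt.le⟩).mono Set.Ioo_subset_Icc_self)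
          (Ioo_mem_nhdsGT h.lt) ?_
        refine tendsto_const_nhds.congr' ?_
        filter_upwards [Ioo_mem_nhdsGT h.lt] with r hr
        exact (hder r hr).deriv.symm
      · exact (hder x ⟨h0, hx.2⟩).hasDerivWithinAt) s hs

theorem continuousOn_integral_log (hε : 0 < ε) :
    ContinuousOn (fun s => ∫ y, v s y * Real.log (q s y + ε)) (Set.Icc t₀ t₁) := by
  set C := weightConst K p d with hC
  have hne : ∀ s ∈ Set.Icc t₀ t₁, ∀ y, q s y + ε ≠ 0 := fun s hs y => by
    have := h.nonneg' s hs y; positivity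
  refine continuousOn_of_dominated
    (bound := fun y => C * decayWeight y * (|Real.log ε| + |Real.log (C + ε)|))
    (fun s hs => ?_) (fun s hs => Filter.Eventually.of_forall fun y => ?_)
    ((integrable_decayWeight.const_mul C).mul_const _)
    (Filter.Eventually.of_forall fun y s hs => ?_)
  · exact ((h.isWeightedDensity hs).contDiff.continuous.mul
      (((h.isWeightedDensity' hs).contDiff.continuous.add continuous_const).log
        (hne s hs))).aestronglyMeasurable
  · rw [Real.norm_eq_abs, abs_mul, abs_of_nonneg (h.nonneg s hs y)]
    have h1 := (h.isWeightedDensity hs).le_decayWeight y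
    have h2 := abs_log_add_le hε (h.nonneg' s hs y) ((h.isWeightedDensity' hs).le_const y)
    have h3 := h.nonneg s hs y
    exact mul_le_mul h1 h2 (abs_nonneg _) (h3.trans h1)
  · exact (h.decaying.hasDerivWithinAt s hs y).continuousWithinAt.mul
      (((h.decaying'.hasDerivWithinAt s hs y).continuousWithinAt.add
        continuousWithinAt_const).log (hne s hs y))

theorem integral_logRate_eq {s : ℝ} (hs : s ∈ Set.Ico t₀ t₁) (hε : 0 < ε) :
    Integrable (logRate F B s (v s) (q s) ε) ∧
    Integrable (fun y => vt s y * Real.log (q s y + ε) + qt s y * (v s y * (q s y + ε)⁻¹)) ∧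
    ∫ y, (vt s y * Real.log (q s y + ε) + qt s y * (v s y * (q s y + ε)⁻¹))
      = ∫ y, logRate F B s (v s) (q s) ε y := by
  have hsI : s ∈ Set.Icc t₀ t₁ := ⟨hs.1, hs.2.le⟩
  simp_rw [h.eq s hs, h.eq' s hs]
  have := integral_logRate (h.contDiff_drift.slice s) (h.contDiff_noise.slice s)
    (h.isWeightedDensity hsI) (h.isWeightedDensity' hsI) hε h.bound_nonneg (h.coefficient s hsI)
    (C' := weightConst K p d) (fun y => by rw [← h.eq s hs]; exact h.abs_deriv_le hsI y)
    (fun y => by rw [← h.eq' s hs]; exact h.abs_deriv_le' hsI y)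
  exact ⟨this.2.1, this.1, this.2.2⟩

/-- Differentiation under the integral uses majorants that depend on `ε`. Only after the result is
rewritten through `logRate` does a lower bound survive the limit `ε → 0`. -/
theorem hasDerivAt_integral_log (hε : 0 < ε) {s : ℝ} (hs : s ∈ Set.Ioo t₀ t₁) :
    HasDerivAt (fun s => ∫ y, v s y * Real.log (q s y + ε))
      (∫ y, logRate F B s (v s) (q s) ε y) s := by
  set C := weightConst K p d with hC
  have hC0 : 0 ≤ C := h.weightConst_nonneg
  set L := |Real.log ε| + |Real.log (C + ε)| with hL
  have hsI := Set.Ioo_subset_Icc_self hs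
  have hpos : ∀ s ∈ Set.Icc t₀ t₁, ∀ y, 0 < q s y + ε := fun s hs y => by
    have := h.nonneg' s hs y; positivity
  obtain ⟨-, i2, i3⟩ := h.integral_logRate_eq (ε := ε) ⟨hs.1.le, hs.2⟩ hε
  rw [← i3]
  refine (hasDerivAt_integral_of_dominated_loc_of_deriv_le (μ := volume)
    (F := fun s y => v s y * Real.log (q s y + ε))
    (F' := fun s y => vt s y * Real.log (q s y + ε) + qt s y * (v s y * (q s y + ε)⁻¹)) (x₀ := s)
    (s := Set.Ioo t₀ t₁) (bound := fun y => (C * L + C * (C * ε⁻¹)) * decayWeight y)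
    (isOpen_Ioo.mem_nhds hs) ?_ ?_ i2.aestronglyMeasurable ?_
    (integrable_decayWeight.const_mul _) ?_).2
  · filter_upwards [isOpen_Ioo.mem_nhds hs] with r hr
    have hr' := Set.Ioo_subset_Icc_self hr
    exact ((h.isWeightedDensity hr').contDiff.continuous.mul
      (((h.isWeightedDensity' hr').contDiff.continuous.add continuous_const).log
        fun y => (hpos r hr' y).ne')).aestronglyMeasurable
  · refine Continuous.integrable_of_le_decayWeight (c := C * L) ?_ fun y => ?_
    · exact ((h.isWeightedDensity hsI).contDiff.continuous.mul
        (((h.isWeightedDensity' hsI).contDiff.continuous.add continuous_const).log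
          fun y => (hpos s hsI y).ne')).aestronglyMeasurable
    · rw [abs_mul, abs_of_nonneg (h.nonneg s hsI y)]
      have h1 := (h.isWeightedDensity hsI).le_decayWeight y
      have h2 := abs_log_add_le hε (h.nonneg' s hsI y) ((h.isWeightedDensity' hsI).le_const y)
      calc _ ≤ (C * decayWeight y) * L :=
            mul_le_mul h1 h2 (abs_nonneg _) ((h.nonneg s hsI y).trans h1)
        _ = _ := by ring
  · refine Filter.Eventually.of_forall fun y r hr => ?_
    have hr' := Set.Ioo_subset_Icc_self hr
    have h2 := abs_log_add_le hε (h.nonneg' r hr' y) ((h.isWeightedDensity' hr').le_const y)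
    have h3 := h.abs_deriv_le hr' y
    have h4 := h.abs_deriv_le' hr' y
    have h5 : 0 < (q r y + ε)⁻¹ := inv_pos.2 (hpos r hr' y)
    have h6 : (q r y + ε)⁻¹ ≤ ε⁻¹ := inv_anti₀ hε (by linarith [h.nonneg' r hr' y])
    have h7 := (h.isWeightedDensity hr').le_const y
    have h8 := h.nonneg r hr' y
    have hw := decayWeight_pos y
    rw [Real.norm_eq_abs]
    refine (abs_add_le _ _).trans ?_
    rw [abs_mul, abs_mul, abs_of_nonneg (mul_nonneg h8 h5.le)]
    calc _ ≤ (C * decayWeight y) * L + (C * decayWeight y) * (C * ε⁻¹) := by gcongr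
      _ = _ := by ring
  · refine Filter.Eventually.of_forall fun y r hr => ?_
    have hr' := Set.Ioo_subset_Icc_self hr
    have hn := Icc_mem_nhds hr.1 hr.2
    have h1 := (h.decaying.hasDerivWithinAt r hr' y).hasDerivAt hn
    have h2 := ((h.decaying'.hasDerivWithinAt r hr' y).hasDerivAt hn).add_const ε
    refine HasDerivAt.congr_deriv (h1.mul (h2.log (hpos r hr' y).ne')) ?_
    rw [div_eq_mul_inv]; ring

theorem neg_lowerRate_le {s : ℝ} (hs : s ∈ Set.Ico t₀ t₁) (hε : 0 < ε) :
    -lowerRate K p Λ d ≤ ∫ y, logRate F B s (v s) (q s) ε y := by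
  have hsI : s ∈ Set.Icc t₀ t₁ := ⟨hs.1, hs.2.le⟩
  unfold lowerRate
  rw [← integral_const_mul, ← integral_neg]
  refine integral_mono (integrable_decayWeight.const_mul _).neg
    (h.integral_logRate_eq hs hε).1 fun y => ?_
  exact neg_le_logRate (h.isWeightedDensity hsI) (h.nonneg' s hsI) hε.le h.bound_nonneg
    (h.coefficient s hsI y)

theorem integral_log_sub_ge (hε : 0 < ε) {s c : ℝ} (hs : s ∈ Set.Icc t₀ t₁)
    (hc : ∀ r ∈ Set.Ioo t₀ s, c ≤ ∫ y, logRate F B r (v r) (q r) ε y) :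
    c * (s - t₀) ≤ (∫ y, v s y * Real.log (q s y + ε))
      - ∫ y, v t₀ y * Real.log (q t₀ y + ε) := by
  have hsub : Set.Icc t₀ s ⊆ Set.Icc t₀ t₁ := Set.Icc_subset_Icc_right hs.2
  have hsub' : Set.Ioo t₀ s ⊆ Set.Ioo t₀ t₁ := Set.Ioo_subset_Ioo_right hs.2
  refine (convex_Icc t₀ s).mul_sub_le_image_sub_of_le_deriv
    ((h.continuousOn_integral_log hε).mono hsub) ?_ ?_ t₀ ⟨le_rfl, hs.1⟩ s ⟨hs.1, le_rfl⟩ hs.1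
  · rw [interior_Icc]
    exact fun r hr =>
      (h.hasDerivAt_integral_log hε (hsub' hr)).differentiableAt.differentiableWithinAt
  · rw [interior_Icc]
    intro r hr
    rw [(h.hasDerivAt_integral_log hε (hsub' hr)).deriv]
    exact hc r hr

/-- The logarithm of `q` stays integrable with respect to `v`, and in particular `q` is positive
where `v` is. -/
theorem log_integrable (hlog : Integrable (fun y => v t₀ y * Real.log (q t₀ y)))
    (hpos : ∀ y, v t₀ y ≠ 0 → 0 < q t₀ y) {s : ℝ} (hs : s ∈ Set.Icc t₀ t₁) :
    Integrable (fun y => v s y * Real.log (q s y)) ∧ (∀ᵐ y, v s y ≠ 0 → 0 < q s y) ∧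
    Filter.Tendsto (fun ε => ∫ y, v s y * Real.log (q s y + ε)) (nhdsWithin 0 (Set.Ioi 0))
      (nhds (∫ y, v s y * Real.log (q s y))) ∧
    (∫ y, v t₀ y * Real.log (q t₀ y)) - lowerRate K p Λ d * (s - t₀)
      ≤ ∫ y, v s y * Real.log (q s y) := by
  set C := weightConst K p d with hC
  have hC0 : 0 ≤ C := h.weightConst_nonneg
  have ht₀ : t₀ ∈ Set.Icc t₀ t₁ := ⟨le_rfl, h.lt.le⟩
  have hv := h.isWeightedDensity hs
  have hq := h.isWeightedDensity' hs
  have hv0 := h.nonneg s hs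
  have hq0 := h.nonneg' s hs
  have cv := hv.contDiff.continuous
  have cq := hq.contDiff.continuous
  have ilog : ∀ {ε}, 0 < ε → ∀ r ∈ Set.Icc t₀ t₁,
      Integrable (fun y => v r y * Real.log (q r y + ε)) := by
    intro ε hε r hr
    refine Continuous.integrable_of_le_decayWeight
      (c := C * (|Real.log ε| + |Real.log (C + ε)|)) ?_ fun y => ?_
    · exact ((h.isWeightedDensity hr).contDiff.continuous.mul
        (((h.isWeightedDensity' hr).contDiff.continuous.add continuous_const).log
          fun y => (add_pos_of_nonneg_of_pos (h.nonneg' r hr y) hε).ne')).aestronglyMeasurable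
    · rw [abs_mul, abs_of_nonneg (h.nonneg r hr y)]
      have h1 := (h.isWeightedDensity hr).le_decayWeight y
      have h2 := abs_log_add_le hε (h.nonneg' r hr y) ((h.isWeightedDensity' hr).le_const y)
      calc _ ≤ (C * decayWeight y) * (|Real.log ε| + |Real.log (C + ε)|) :=
            mul_le_mul h1 h2 (abs_nonneg _) ((h.nonneg r hr y).trans h1)
        _ = _ := by ring
  -- the lower bound for positive `ε`
  have low : ∀ {ε}, 0 < ε → (∫ y, v t₀ y * Real.log (q t₀ y)) - lowerRate K p Λ d * (s - t₀)
      ≤ ∫ y, v s y * Real.log (q s y + ε) := by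
    intro ε hε
    have h1 := h.integral_log_sub_ge hε hs (c := -lowerRate K p Λ d) fun r hr =>
      h.neg_lowerRate_le ⟨hr.1.le, hr.2.trans_le hs.2⟩ hε
    -- At the initial time the shift by `ε` only increases the logarithm, so the lower bound can be
    -- stated without `ε`.
    have h2 : ∫ y, v t₀ y * Real.log (q t₀ y) ≤ ∫ y, v t₀ y * Real.log (q t₀ y + ε) := by
      refine integral_mono hlog (ilog hε t₀ ht₀) fun y => ?_
      by_cases h0 : v t₀ y = 0
      · simp [h0]
      · exact mul_le_mul_of_nonneg_left (Real.log_le_log (hpos y h0) (by linarith))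
          (h.nonneg t₀ ht₀ y)
    linarith
  -- Since `q ≤ C` and the shifts are at most `1`, `M` bounds every `log (q + e k)`; this makes the
  -- functions `g k` nonnegative, as Fatou's lemma requires.
  set M := Real.log (C + 1) with hM
  have hM0 : 0 ≤ M := Real.log_nonneg (by linarith)
  let e : ℕ → ℝ := fun k => 1 / ((k : ℝ) + 1)
  have he0 : ∀ k, 0 < e k := fun k => by positivity
  have he1 : ∀ k, e k ≤ 1 := fun k => by
    rw [div_le_one (by positivity)]; linarith [(Nat.cast_nonneg k : (0 : ℝ) ≤ k)]
  have he : Filter.Tendsto e Filter.atTop (nhds 0) := tendsto_one_div_add_atTop_nhds_zero_nat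
  let g : ℕ → (Fin d → ℝ) → ℝ := fun k y => v s y * (M - Real.log (q s y + e k))
  have hg0 : ∀ k y, 0 ≤ g k y := fun k y => by
    refine mul_nonneg (hv0 y) (sub_nonneg.2 (Real.log_le_log ?_ ?_))
    · linarith [hq0 y, he0 k]
    · linarith [hq.le_const y, he1 k]
  have ig : ∀ k, Integrable (g k) := fun k => by
    refine ((hv.integrable.mul_const M).sub (ilog (he0 k) s hs)).congr
      (Filter.Eventually.of_forall fun y => ?_)
    simp only [g, Pi.sub_apply]; ring
  set D := M * (∫ y, v s y) - ((∫ y, v t₀ y * Real.log (q t₀ y)) - lowerRate K p Λ d * (s - t₀))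
    with hD
  have hgD : ∀ k, ∫ y, g k y ≤ D := fun k => by
    have : ∫ y, g k y = M * (∫ y, v s y) - ∫ y, v s y * Real.log (q s y + e k) := by
      rw [← integral_const_mul, ← integral_sub (hv.integrable.const_mul M) (ilog (he0 k) s hs)]
      refine integral_congr_ae (Filter.Eventually.of_forall fun y => ?_)
      simp only [g]; ring
    rw [this, hD]
    linarith [low (he0 k)]
  have mg : ∀ k, Measurable (fun y => ENNReal.ofReal (g k y)) := fun k =>
    (cv.mul (continuous_const.sub ((cq.add continuous_const).log fun y =>
      (add_pos_of_nonneg_of_pos (hq0 y) (he0 k)).ne'))).measurable.ennreal_ofReal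
  -- The bound `D` does not depend on `k`. A finite integral makes the lower limit finite almost
  -- everywhere, whereas it is infinite wherever `v > 0` and `q = 0`. The same estimate then gives
  -- the integrability of `v log q`.
  have fatou : ∫⁻ y, Filter.liminf (fun k => ENNReal.ofReal (g k y)) Filter.atTop
      ≤ ENNReal.ofReal D := by
    refine (lintegral_liminf_le mg).trans ?_
    refine Filter.liminf_le_of_le (by isBoundedDefault) fun b hb => ?_
    obtain ⟨k, hk⟩ := hb.exists
    refine hk.trans ?_
    rw [← ofReal_integral_eq_lintegral_ofReal (ig k) (Filter.Eventually.of_forall (hg0 k))]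
    exact ENNReal.ofReal_le_ofReal (hgD k)
  have hfin : ∀ᵐ y, Filter.liminf (fun k => ENNReal.ofReal (g k y)) Filter.atTop < ⊤ :=
    ae_lt_top (Measurable.liminf mg) (fatou.trans_lt ENNReal.ofReal_lt_top).ne
  have hae : ∀ᵐ y, v s y ≠ 0 → 0 < q s y := by
    filter_upwards [hfin] with y hy h0
    by_contra hq'
    have hqz : q s y = 0 := le_antisymm (not_lt.1 hq') (hq0 y)
    have hvp : 0 < v s y := (hv0 y).lt_of_ne' h0
    have t1 : Filter.Tendsto (fun k => g k y) Filter.atTop Filter.atTop := by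
      have l0 : Filter.Tendsto (fun k => Real.log (e k)) Filter.atTop Filter.atBot :=
        Real.tendsto_log_nhdsGT_zero.comp
          (tendsto_nhdsWithin_iff.2 ⟨he, Filter.Eventually.of_forall he0⟩)
      have l1 : Filter.Tendsto (fun k => M + -Real.log (e k)) Filter.atTop Filter.atTop :=
        Filter.tendsto_atTop_add_const_left _ _ (Filter.tendsto_neg_atBot_atTop.comp l0)
      refine (l1.const_mul_atTop hvp).congr fun k => ?_
      simp only [g, hqz, zero_add]; ring
    have t2 := (ENNReal.tendsto_ofReal_atTop.comp t1).liminf_eq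
    simp only [Function.comp_def] at t2
    rw [t2] at hy
    exact lt_irrefl _ hy
  have hlim : ∀ᵐ y, ENNReal.ofReal (v s y * (M - Real.log (q s y)))
      ≤ Filter.liminf (fun k => ENNReal.ofReal (g k y)) Filter.atTop := by
    filter_upwards [hae] with y hy
    refine le_of_eq (Filter.Tendsto.liminf_eq ?_).symm
    refine ENNReal.tendsto_ofReal ?_
    by_cases h0 : v s y = 0
    · simp [g, h0]
    · refine Filter.Tendsto.const_mul _ (tendsto_const_nhds.sub ?_)
      have : Filter.Tendsto (fun k => q s y + e k) Filter.atTop (nhds (q s y)) := by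
        simpa using he.const_add (q s y)
      exact this.log (hy h0).ne'
  have hGnn : ∀ᵐ y, 0 ≤ v s y * (M - Real.log (q s y)) := by
    filter_upwards [hae] with y hy
    by_cases h0 : v s y = 0
    · simp [h0]
    · exact mul_nonneg (hv0 y) (sub_nonneg.2 (Real.log_le_log (hy h0)
        (by linarith [hq.le_const y])))
  have mG : Measurable (fun y => v s y * (M - Real.log (q s y))) :=
    cv.measurable.mul (measurable_const.sub cq.measurable.log)
  have iG : Integrable (fun y => v s y * (M - Real.log (q s y))) := by
    refine ⟨mG.aestronglyMeasurable, ?_⟩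
    rw [hasFiniteIntegral_iff_ofReal hGnn]
    exact ((lintegral_mono_ae hlim).trans fatou).trans_lt ENNReal.ofReal_lt_top
  have iL : Integrable (fun y => v s y * Real.log (q s y)) := by
    refine ((hv.integrable.mul_const M).sub iG).congr (Filter.Eventually.of_forall fun y => ?_)
    simp only [Pi.sub_apply]; ring
  have tend : Filter.Tendsto (fun ε => ∫ y, v s y * Real.log (q s y + ε))
      (nhdsWithin 0 (Set.Ioi 0)) (nhds (∫ y, v s y * Real.log (q s y))) := by
    have hev : ∀ᶠ ε in nhdsWithin (0 : ℝ) (Set.Ioi 0), ε ∈ Set.Ioc (0 : ℝ) 1 :=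
      Ioc_mem_nhdsGT one_pos
    refine tendsto_integral_filter_of_dominated_convergence
      (fun y => |v s y * Real.log (q s y)| + v s y * M) ?_ ?_
      (iL.abs.add (hv.integrable.mul_const M)) ?_
    · filter_upwards [hev] with ε hε
      exact (ilog hε.1 s hs).aestronglyMeasurable
    · filter_upwards [hev] with ε hε
      filter_upwards [hae] with y hy
      by_cases h0 : v s y = 0
      · simp [h0]
      have hqp := hy h0
      have l1 : Real.log (q s y) ≤ Real.log (q s y + ε) :=
        Real.log_le_log hqp (by linarith [hε.1])
      have l2 : Real.log (q s y + ε) ≤ M :=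
        Real.log_le_log (by linarith [hε.1]) (by linarith [hq.le_const y, hε.2])
      have l3 : |Real.log (q s y + ε)| ≤ |Real.log (q s y)| + M := by
        rw [abs_le]
        constructor
        · linarith [neg_abs_le (Real.log (q s y))]
        · linarith [abs_nonneg (Real.log (q s y))]
      rw [Real.norm_eq_abs, abs_mul, abs_mul, abs_of_nonneg (hv0 y), ← mul_add]
      exact mul_le_mul_of_nonneg_left l3 (hv0 y)
    · filter_upwards [hae] with y hy
      by_cases h0 : v s y = 0
      · simp [h0]
      refine Filter.Tendsto.const_mul _ ?_
      have : Filter.Tendsto (fun ε => q s y + ε) (nhdsWithin 0 (Set.Ioi 0)) (nhds (q s y)) := by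
        have : Filter.Tendsto (fun ε => q s y + ε) (nhds 0) (nhds (q s y + 0)) :=
          (continuous_const.add continuous_id).tendsto 0
        rw [add_zero] at this
        exact this.mono_left nhdsWithin_le_nhds
      exact this.log (hy h0).ne'
  refine ⟨iL, hae, tend, ?_⟩
  refine ge_of_tendsto tend ?_
  filter_upwards [self_mem_nhdsWithin] with ε hε
  exact low hε

end IsFokkerPlanckPair

/-! ### Lower bound for the right derivative along one slice -/

namespace IsFokkerPlanckPair

variable {d m : ℕ} {F : ℝ → (Fin d → ℝ) → Fin d → ℝ} {B : ℝ → (Fin d → ℝ) → Fin d → Fin m → ℝ}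
  {t₀ t₁ Λ ε : ℝ} {K : ℕ → ℝ} {p : ℕ} {v vt q qt : ℝ → (Fin d → ℝ) → ℝ}
  (h : IsFokkerPlanckPair F B t₀ t₁ K p Λ v vt q qt)

include h

theorem eventually_mem_Icc : ∀ᶠ s in nhdsWithin t₀ (Set.Ioi t₀), s ∈ Set.Icc t₀ t₁ :=
  Filter.mem_of_superset (Ioc_mem_nhdsGT h.lt) Set.Ioc_subset_Icc_self

theorem logRate_lower_limit_of_ne_zero {y : Fin d → ℝ} (hv : v t₀ y ≠ 0) (hq : 0 < q t₀ y) :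
    Filter.Tendsto (fun z : ℝ × ℝ => logRate F B z.1 (v z.1) (q z.1) z.2 y)
      (nhdsWithin t₀ (Set.Ioi t₀) ×ˢ nhdsWithin 0 (Set.Ioi 0))
      (nhds (logRate F B t₀ (v t₀) (q t₀) 0 y)) := by
  set l := nhdsWithin t₀ (Set.Ioi t₀) ×ˢ nhdsWithin (0 : ℝ) (Set.Ioi 0)
  have t1 : Filter.Tendsto (Prod.fst : ℝ × ℝ → ℝ) l (nhdsWithin t₀ (Set.Icc t₀ t₁)) :=
    (tendsto_nhdsWithin_iff.2 ⟨tendsto_nhdsWithin_of_tendsto_nhds Filter.tendsto_id,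
      h.eventually_mem_Icc⟩).comp Filter.tendsto_fst
  have t2 : Filter.Tendsto (Prod.snd : ℝ × ℝ → ℝ) l (nhds 0) :=
    (tendsto_nhdsWithin_of_tendsto_nhds Filter.tendsto_id).comp Filter.tendsto_snd
  have t3 : Filter.Tendsto (fun z : ℝ × ℝ => (z.1, y)) l
      (nhdsWithin (t₀, y) (Set.Icc t₀ t₁ ×ˢ Set.univ)) := by
    refine tendsto_nhdsWithin_iff.2 ⟨?_, ?_⟩
    · exact (tendsto_nhdsWithin_iff.1 t1).1.prodMk_nhds tendsto_const_nhds
    · filter_upwards [(tendsto_nhdsWithin_iff.1 t1).2] with z hz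
      exact ⟨hz, trivial⟩
  have t4 := (tendsto_nhdsWithin_iff.1 t3).1
  have hm : ((t₀, y) : ℝ × (Fin d → ℝ)) ∈ Set.Icc t₀ t₁ ×ˢ (Set.univ : Set (Fin d → ℝ)) :=
    ⟨⟨le_rfl, h.lt.le⟩, trivial⟩
  have a1 := (h.decaying.continuousOn _ hm).tendsto.comp t3
  have a2 := fun i => (h.decaying.continuousOn_partialD i _ hm).tendsto.comp t3
  have b1 := (h.decaying'.continuousOn _ hm).tendsto.comp t3
  have b2 := fun i => (h.decaying'.continuousOn_partialD i _ hm).tendsto.comp t3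
  have c1 := fun i j =>
    ((contDiff_diffusionMatrix_uncurry h.contDiff_noise i j).continuous.tendsto (t₀, y)).comp t4
  have c2 := ((continuous_fluxDriftDiv_uncurry h.contDiff_drift h.contDiff_noise).tendsto
    (t₀, y)).comp t4
  have a3 := a1.inv₀ hv
  have b3 : Filter.Tendsto (fun z : ℝ × ℝ => (q z.1 y + z.2)⁻¹) l (nhds (q t₀ y + 0)⁻¹) :=
    (b1.add t2).inv₀ (by simpa using hq.ne')
  have e := fun i => ((a2 i).mul a3).sub ((b2 i).mul b3)
  have f1 := tendsto_finsetSum Finset.univ fun i _ => tendsto_finsetSum Finset.univ fun j _ =>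
    (c1 i j).mul ((e i).mul (e j))
  have f2 := tendsto_finsetSum Finset.univ fun i _ => tendsto_finsetSum Finset.univ fun j _ =>
    (c1 i j).mul ((a2 i).mul (a2 j))
  exact (((a1.mul f1).const_mul (1 / 2)).sub ((f2.mul a3).const_mul (1 / 2))).add
    (c2.mul (a1.mul (b1.mul b3)))

/-- The negative part of `logRate` is at most a multiple of `|∇v|² / v + v`. If `v`, its gradient
and its pure second derivatives vanish at `(t₀, y)`, the second derivatives stay below a small `M`
near that point, and the square root bound gives `|∂ᵢv|² ≤ 4 M v`. Neither `q` nor `ε` enters. -/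
theorem logRate_lower_limit_of_eq_zero {y : Fin d → ℝ} (hv : v t₀ y = 0)
    (hd : ∀ i, partialD i (partialD i (v t₀)) y = 0) {η : ℝ} (hη : 0 < η) :
    ∀ᶠ s in nhdsWithin t₀ (Set.Ioi t₀), ∀ ε > 0, -η ≤ logRate F B s (v s) (q s) ε y := by
  set L := Λ * (1 + ‖y‖) ^ p with hL
  have hL0 : 0 ≤ L := mul_nonneg h.bound_nonneg (by positivity)
  -- The two negative terms will be `(1/2) d² L · 4M` and `L M`, together `(2 d² + 1) L M`; the
  -- extra `1` avoids division by zero.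
  set M := η / ((2 * d ^ 2 + 1) * L + 1) with hM
  have hM0 : 0 < M := div_pos hη (by positivity)
  have hMη : (2 * d ^ 2 + 1) * L * M ≤ η := by
    have : M * ((2 * d ^ 2 + 1) * L + 1) = η := div_mul_cancel₀ _ (by positivity)
    nlinarith
  have ht₀ : t₀ ∈ Set.Icc t₀ t₁ := ⟨le_rfl, h.lt.le⟩
  have hm : ((t₀, y) : ℝ × (Fin d → ℝ)) ∈ Set.Icc t₀ t₁ ×ˢ (Set.univ : Set (Fin d → ℝ)) :=
    ⟨ht₀, trivial⟩
  have e1 : ∀ᶠ z in nhdsWithin (t₀, y) (Set.Icc t₀ t₁ ×ˢ (Set.univ : Set (Fin d → ℝ))),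
      ∀ i, partialD i (partialD i (v z.1)) z.2 < M := by
    refine Filter.eventually_all.2 fun i => ?_
    refine (h.decaying.continuousOn_partialD_partialD i i _ hm).tendsto.eventually_lt_const ?_
    simpa [hd i] using hM0
  obtain ⟨κ', hκ', hball⟩ := Metric.mem_nhdsWithin_iff.1 e1
  -- Half of the radius keeps the closed segment of length `κ` around `y`, at times before `t₀ + κ`,
  -- inside the open ball.
  set κ := κ' / 2 with hκdef
  have hκ : 0 < κ := half_pos hκ'
  have t3 : Filter.Tendsto (fun s : ℝ => (s, y)) (nhdsWithin t₀ (Set.Ioi t₀))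
      (nhdsWithin (t₀, y) (Set.Icc t₀ t₁ ×ˢ Set.univ)) := by
    refine tendsto_nhdsWithin_iff.2 ⟨?_, ?_⟩
    · exact (tendsto_nhdsWithin_of_tendsto_nhds Filter.tendsto_id).prodMk_nhds tendsto_const_nhds
    · filter_upwards [h.eventually_mem_Icc] with z hz
      exact ⟨hz, trivial⟩
  have e2 : ∀ᶠ s in nhdsWithin t₀ (Set.Ioi t₀), v s y < M :=
    ((h.decaying.continuousOn _ hm).tendsto.comp t3).eventually_lt_const (by simpa [hv] using hM0)
  have e3 : ∀ᶠ s in nhdsWithin t₀ (Set.Ioi t₀), ∀ i, |partialD i (v s) y| < M * κ := by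
    refine Filter.eventually_all.2 fun i => ?_
    refine (((h.decaying.continuousOn_partialD i _ hm).tendsto.comp t3).abs).eventually_lt_const ?_
    simpa [partialD_eq_zero_of_nonneg (h.nonneg t₀ ht₀) hv i] using mul_pos hM0 hκ
  have e4 : ∀ᶠ s in nhdsWithin t₀ (Set.Ioi t₀), s < t₀ + κ := by
    filter_upwards [Ioo_mem_nhdsGT (show t₀ < t₀ + κ by linarith)] with s hs using hs.2
  filter_upwards [e2, e3, e4, h.eventually_mem_Icc] with s h2 h3 h4 hs ε hε
  by_cases h0 : v s y = 0
  · rw [logRate_eq_zero h0]; linarith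
  have hvp : 0 < v s y := (h.nonneg s hs y).lt_of_ne' h0
  have hc := h.coefficient s hs y h0
  have hsq : ∀ i, partialD i (v s) y ^ 2 ≤ 4 * M * v s y := by
    intro i
    have := sq_partialD_le (h.decaying.contDiff s hs) (h.nonneg s hs) hκ hM0.le y i fun η' hη' => by
      have hb : ((s, y + Pi.single i η') : ℝ × (Fin d → ℝ)) ∈ Metric.ball (t₀, y) κ' := ?_
      · exact (hball ⟨hb, hs, trivial⟩ i).le
      rw [Metric.mem_ball, Prod.dist_eq, max_lt_iff]
      constructor
      · simp only [Real.dist_eq, abs_of_nonneg (sub_nonneg.2 hs.1)]; linarith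
      · simp only [dist_self_add_left, Pi.norm_single, Real.norm_eq_abs]; linarith
    have h5 : |partialD i (v s) y| / κ ≤ M := (div_le_iff₀ hκ).2 (h3 i).le
    nlinarith
  have hq0 := h.nonneg' s hs y
  have hfrac : q s y * (q s y + ε)⁻¹ ≤ 1 := by
    rw [← div_eq_mul_inv, div_le_one (by linarith)]; linarith
  have hfrac0 : 0 ≤ q s y * (q s y + ε)⁻¹ := by positivity
  have k1 := diffusionForm_nonneg (B := B) s y
    (fun i => partialD i (v s) y * (v s y)⁻¹ - partialD i (q s) y * (q s y + ε)⁻¹)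
  have k2 : diffusionForm B s y (fun i => partialD i (v s) y) (fun i => partialD i (v s) y)
      * (v s y)⁻¹ ≤ d ^ 2 * (L * (4 * M)) := by
    rw [← div_eq_mul_inv, div_le_iff₀ hvp]
    refine (diffusionForm_le hL0 hc.diffusionMatrix_le hsq).trans (le_of_eq (by ring))
  have k3 : -(L * M) ≤ fluxDriftDiv F B s y * (v s y * (q s y * (q s y + ε)⁻¹)) := by
    refine neg_le_of_abs_le ?_
    rw [abs_mul]
    refine mul_le_mul hc.fluxDriftDiv_le ?_ (abs_nonneg _) hL0
    rw [abs_of_nonneg (mul_nonneg hvp.le hfrac0)]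
    nlinarith
  have k4 := mul_nonneg hvp.le k1
  simp only [logRate]
  nlinarith

/-- Where `v > 0` also `q > 0`, and `logRate` is continuous up to `ε = 0`. At zeros of `v` the
gradient vanishes, so they are zeros of every `∂ᵢv`, and almost everywhere on the zero set of a `C¹`
function its gradient vanishes. Hence the second derivatives needed for the preceding lemma vanish
at almost every zero. -/
theorem logRate_lower_limit (hpos : ∀ y, v t₀ y ≠ 0 → 0 < q t₀ y) :
    ∀ᵐ y, ∀ η > 0, ∀ᶠ z : ℝ × ℝ in nhdsWithin t₀ (Set.Ioi t₀) ×ˢ nhdsWithin 0 (Set.Ioi 0),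
      logRate F B t₀ (v t₀) (q t₀) 0 y - η ≤ logRate F B z.1 (v z.1) (q z.1) z.2 y := by
  have ht₀ : t₀ ∈ Set.Icc t₀ t₁ := ⟨le_rfl, h.lt.le⟩
  have hz := fun i => ae_partialD_eq_zero_of_eq_zero
    ((h.decaying.contDiff t₀ ht₀).contDiff_one_partialD i)
  filter_upwards [ae_all_iff.2 hz] with y hy η hη
  by_cases h0 : v t₀ y = 0
  · rw [logRate_eq_zero h0, zero_sub]
    have e1 := h.logRate_lower_limit_of_eq_zero h0
      (fun i => hy i (partialD_eq_zero_of_nonneg (h.nonneg t₀ ht₀) h0 i) i) hη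
    refine (e1.prod_mk (self_mem_nhdsWithin : Set.Ioi (0 : ℝ) ∈ nhdsWithin 0 (Set.Ioi 0))).mono ?_
    rintro ⟨s, ε⟩ ⟨h1, h2⟩
    exact h1 ε h2
  · exact (h.logRate_lower_limit_of_ne_zero h0 (hpos y h0)).eventually_const_le (by linarith)

/-- The lower bound for the right derivative of `∫ v log q`. -/
theorem eventually_integral_log_sub_ge
    (hlog : Integrable (fun y => v t₀ y * Real.log (q t₀ y)))
    (hpos : ∀ y, v t₀ y ≠ 0 → 0 < q t₀ y)
    (hint : Integrable (logRate F B t₀ (v t₀) (q t₀) 0)) {η : ℝ} (hη : 0 < η) :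
    ∀ᶠ s in nhdsWithin t₀ (Set.Ioi t₀),
      ((∫ y, logRate F B t₀ (v t₀) (q t₀) 0 y) - η) * (s - t₀)
        ≤ (∫ y, v s y * Real.log (q s y)) - ∫ y, v t₀ y * Real.log (q t₀ y) := by
  have ev : ∀ᶠ z : ℝ × ℝ in nhdsWithin t₀ (Set.Ioi t₀) ×ˢ nhdsWithin 0 (Set.Ioi 0),
      z.1 ∈ Set.Ico t₀ t₁ ∧ z.2 ∈ Set.Ioi (0 : ℝ) :=
    Filter.Eventually.prod_mk (Filter.mem_of_superset (Ioo_mem_nhdsGT h.lt) Set.Ioo_subset_Ico_self)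
      self_mem_nhdsWithin
  have key := eventually_integral_ge_of_ge (μ := (volume : Measure (Fin d → ℝ)))
    (l := nhdsWithin t₀ (Set.Ioi t₀) ×ˢ nhdsWithin (0 : ℝ) (Set.Ioi 0))
    (f := fun z y => logRate F B z.1 (v z.1) (q z.1) z.2 y)
    (h := fun y => (d ^ 2 + 1) * (Λ * weightConst K p d) * decayWeight y)
    (ev.mono fun z hz => (h.integral_logRate_eq hz.1 hz.2).1) hint
    (integrable_decayWeight.const_mul _)
    (ev.mono fun z hz => Filter.Eventually.of_forall fun y =>
      neg_le_logRate (h.isWeightedDensity ⟨hz.1.1, hz.1.2.le⟩)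
        (h.nonneg' z.1 ⟨hz.1.1, hz.1.2.le⟩) (Set.mem_Ioi.1 hz.2).le h.bound_nonneg
        (h.coefficient z.1 ⟨hz.1.1, hz.1.2.le⟩ y))
    (h.logRate_lower_limit hpos) hη
  -- Taking the limit jointly in time and `ε` yields a time interval that does not depend on `ε`.
  -- The rate can therefore be integrated up to a fixed `s` before `ε` tends to zero.
  obtain ⟨pa, hpa, pb, hpb, hab⟩ := Filter.eventually_prod_iff.1 key
  obtain ⟨b, hb, hsub⟩ := mem_nhdsGT_iff_exists_Ioo_subset.1 hpa
  filter_upwards [Ioo_mem_nhdsGT (lt_min hb h.lt)] with s hs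
  have hsb : s < b := hs.2.trans_le (min_le_left _ _)
  have hsI : s ∈ Set.Icc t₀ t₁ := ⟨hs.1.le, (hs.2.trans_le (min_le_right _ _)).le⟩
  have T1 := (h.log_integrable hlog hpos hsI).2.2.1
  have T0 := (h.log_integrable hlog hpos ⟨le_rfl, h.lt.le⟩).2.2.1
  refine ge_of_tendsto (T1.sub T0) ?_
  filter_upwards [hpb, self_mem_nhdsWithin] with ε hε hε0
  exact h.integral_log_sub_ge hε0 hsI fun r hr => hab (hsub ⟨hr.1, hr.2.trans hsb⟩) hε

end IsFokkerPlanckPair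

/-- `√z log z = 2 √z log √z`, and `x log x` is continuous at zero. It is used against functions
whose square is bounded by a multiple of the density. -/
theorem exists_sqrt_mul_abs_log_le (M : ℝ) :
    ∃ N, 0 ≤ N ∧ ∀ z, 0 ≤ z → z ≤ M → √z * |Real.log z| ≤ N := by
  have hc : Continuous fun z : ℝ => 2 * (√z * Real.log √z) :=
    continuous_const.mul (Real.continuous_mul_log.comp Real.continuous_sqrt)
  obtain ⟨N, hN⟩ := (isCompact_Icc (a := (0 : ℝ)) (b := M)).exists_bound_of_continuousOn
    hc.continuousOn
  refine ⟨max N 0, le_max_right _ _, fun z h0 h1 => (le_trans (le_of_eq ?_) (hN z ⟨h0, h1⟩)).trans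
    (le_max_left _ _)⟩
  rw [Real.log_sqrt h0, Real.norm_eq_abs,
    show 2 * (√z * (Real.log z / 2)) = √z * Real.log z by ring, abs_mul,
    abs_of_nonneg (Real.sqrt_nonneg z)]

namespace IsFokkerPlanckPair

variable {d m : ℕ} {F : ℝ → (Fin d → ℝ) → Fin d → ℝ} {B : ℝ → (Fin d → ℝ) → Fin d → Fin m → ℝ}
  {t₀ t₁ Λ ε : ℝ} {K : ℕ → ℝ} {p : ℕ} {v vt q qt : ℝ → (Fin d → ℝ) → ℝ}
  (h : IsFokkerPlanckPair F B t₀ t₁ K p Λ v vt q qt)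

include h

theorem abs_taylor_le {s : ℝ} (hs : s ∈ Set.Icc t₀ t₁) (y : Fin d → ℝ) :
    |v s y - v t₀ y - (s - t₀) * vt t₀ y| ≤ weightConst K p d * (s - t₀) ^ 2 * decayWeight y :=
  (le_mul_of_one_le_left (abs_nonneg _) (one_le_one_add_norm_pow p y)).trans
    (le_mul_decayWeight ((h.decaying.taylor (p + d + 1) hs y).trans
      (mul_le_mul_of_nonneg_right (h.decaying.le_weightConst h.lt.le p) (sq_nonneg _))))

theorem abs_sub_le {s : ℝ} (hs : s ∈ Set.Icc t₀ t₁) (y : Fin d → ℝ) :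
    |v s y - v t₀ y| ≤ weightConst K p d * (s - t₀) * decayWeight y := by
  have := h.decaying.lipschitz (p + d + 1) hs ⟨le_rfl, h.lt.le⟩ y
  rw [abs_of_nonneg (sub_nonneg.2 hs.1)] at this
  exact (le_mul_of_one_le_left (abs_nonneg _) (one_le_one_add_norm_pow p y)).trans
    (le_mul_decayWeight (this.trans (mul_le_mul_of_nonneg_right
      (h.decaying.le_weightConst h.lt.le p) (sub_nonneg.2 hs.1))))

theorem abs_sub_le' {s : ℝ} (hs : s ∈ Set.Icc t₀ t₁) (y : Fin d → ℝ) :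
    |q s y - q t₀ y| ≤ weightConst K p d * (s - t₀) * decayWeight y := by
  have := h.decaying'.lipschitz (p + d + 1) hs ⟨le_rfl, h.lt.le⟩ y
  rw [abs_of_nonneg (sub_nonneg.2 hs.1)] at this
  exact (le_mul_of_one_le_left (abs_nonneg _) (one_le_one_add_norm_pow p y)).trans
    (le_mul_decayWeight (this.trans (mul_le_mul_of_nonneg_right
      (h.decaying'.le_weightConst h.lt.le p) (sub_nonneg.2 hs.1))))

end IsFokkerPlanckPair

/-! ### Integrability over all values of the frozen variable -/

/-- A family of pairs of solutions of Fokker–Planck equations whose coefficients depend on a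
parameter `a ∈ A`. The second solution starts, for each value of the parameter, from the marginal
`p₀` of the first one. -/
structure IsFokkerPlanckBundle {d m : ℕ} (A : Set ℝ) (F : ℝ → ℝ → (Fin d → ℝ) → Fin d → ℝ)
    (B : ℝ → ℝ → (Fin d → ℝ) → Fin d → Fin m → ℝ) (t₀ t₁ : ℝ) (K : ℕ → ℝ) (p : ℕ) (Λ R C : ℝ)
    (v vt q qt : ℝ → ℝ → (Fin d → ℝ) → ℝ) (p₀ pdot : (Fin d → ℝ) → ℝ) : Prop where
  measurableSet : MeasurableSet A
  volume_lt_top : volume A < ⊤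
  lt : t₀ < t₁
  bound_nonneg : 0 ≤ Λ
  const_nonneg : ∀ N, 0 ≤ K N
  pair : ∀ a ∈ A, IsFokkerPlanckPair (F a) (B a) t₀ t₁ K p Λ (v a) (vt a) (q a) (qt a)
  initial : ∀ a ∈ A, q a t₀ = p₀
  continuous_marginal : Continuous p₀
  marginal_le : ∀ y, p₀ y ≤ weightConst K p d
  marginal : ∀ y, p₀ y = ∫ a in A, v a t₀ y
  marginal_eq_zero : ∀ y, R < ‖y‖ → p₀ y = 0
  marginal_pos : ∀ a ∈ A, ∀ y, v a t₀ y ≠ 0 → 0 < p₀ y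
  deriv_marginal : ∀ᵐ y, pdot y = ∫ a in A, vt a t₀ y
  measurable_deriv_marginal : Measurable pdot
  sq_deriv_marginal_le : ∀ y, pdot y ^ 2 ≤ C * p₀ y
  measurable_state : ∀ s ∈ Set.Icc t₀ t₁, Measurable (fun z : ℝ × (Fin d → ℝ) => v z.1 s z.2)
  measurable_state_deriv : Measurable (fun z : ℝ × (Fin d → ℝ) => vt z.1 t₀ z.2)
  measurable_param : ∀ s ∈ Set.Icc t₀ t₁, Measurable (fun z : ℝ × (Fin d → ℝ) => q z.1 s z.2)
  measurable_param_deriv : AEStronglyMeasurable (fun z : ℝ × (Fin d → ℝ) => qt z.1 t₀ z.2)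
    ((volume.restrict A).prod volume)

namespace IsFokkerPlanckBundle

variable {d m : ℕ} {A : Set ℝ} {F : ℝ → ℝ → (Fin d → ℝ) → Fin d → ℝ}
  {B : ℝ → ℝ → (Fin d → ℝ) → Fin d → Fin m → ℝ} {t₀ t₁ : ℝ} {K : ℕ → ℝ} {p : ℕ} {Λ R C : ℝ}
  {v vt q qt : ℝ → ℝ → (Fin d → ℝ) → ℝ} {p₀ pdot : (Fin d → ℝ) → ℝ}
  (h : IsFokkerPlanckBundle A F B t₀ t₁ K p Λ R C v vt q qt p₀ pdot)

include h

theorem isFiniteMeasure : IsFiniteMeasure (volume.restrict A) :=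
  ⟨by rw [Measure.restrict_apply_univ]; exact h.volume_lt_top⟩

theorem mem_Icc : t₀ ∈ Set.Icc t₀ t₁ := ⟨le_rfl, h.lt.le⟩

theorem weightConst_nonneg : 0 ≤ weightConst K p d :=
  mul_nonneg (by positivity) (h.const_nonneg _)

theorem ae_mem : ∀ᵐ z ∂(volume.restrict A).prod (volume : Measure (Fin d → ℝ)), z.1 ∈ A :=
  Measure.quasiMeasurePreserving_fst.ae (ae_restrict_mem h.measurableSet)

theorem integrable_decay : Integrable (fun z : ℝ × (Fin d → ℝ) => decayWeight z.2)
    ((volume.restrict A).prod volume) := by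
  have := h.isFiniteMeasure
  exact integrable_decayWeight.comp_snd _

theorem marginal_nonneg (y : Fin d → ℝ) : 0 ≤ p₀ y := by
  rw [h.marginal]
  exact setIntegral_nonneg h.measurableSet fun a ha => (h.pair a ha).nonneg t₀ h.mem_Icc y

/-- By Tonelli, integrating over the parameter replaces `v` by its marginal `p₀`, which lives in a
ball; there `p₀ |g| ≤ N` suffices, even if `g` is singular at the zeros of `p₀`. -/
theorem integrable_of_marginal {g : (Fin d → ℝ) → ℝ} (hg : Measurable g) {N : ℝ}
    (hN : ∀ y, p₀ y * |g y| ≤ N) :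
    Integrable (fun z : ℝ × (Fin d → ℝ) => v z.1 t₀ z.2 * g z.2)
      ((volume.restrict A).prod volume) := by
  have := h.isFiniteMeasure
  have hmeas := (h.measurable_state t₀ h.mem_Icc).mul (hg.comp measurable_snd)
  refine (integrable_prod_iff' hmeas.aestronglyMeasurable).2
    ⟨Filter.Eventually.of_forall fun y => ?_, ?_⟩
  · refine Integrable.mul_const (f := fun a => v a t₀ y) ?_ (g y)
    refine Integrable.of_bound (C := weightConst K p d)
      ((h.measurable_state t₀ h.mem_Icc).comp (measurable_id.prodMk measurable_const)).aestronglyMeasurable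
      ?_
    filter_upwards [ae_restrict_mem h.measurableSet] with a ha
    have hw := (h.pair a ha).isWeightedDensity h.mem_Icc
    rw [Real.norm_eq_abs, abs_of_nonneg (hw.nonneg y)]
    exact hw.le_const y
  · have e : ∀ y, ∫ a in A, ‖v a t₀ y * g y‖ = p₀ y * |g y| := by
      intro y
      rw [h.marginal, ← integral_mul_const]
      refine setIntegral_congr_fun h.measurableSet fun a ha => ?_
      simp only [norm_mul, Real.norm_eq_abs]
      rw [abs_of_nonneg ((h.pair a ha).nonneg t₀ h.mem_Icc y)]
    have hN0 : 0 ≤ N := (mul_nonneg (h.marginal_nonneg 0) (abs_nonneg _)).trans (hN 0)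
    have hi : Integrable ((Metric.closedBall (0 : Fin d → ℝ) R).indicator fun _ => N) :=
      (integrableOn_const (isCompact_closedBall _ _).measure_lt_top.ne).integrable_indicator
        measurableSet_closedBall
    refine Integrable.congr (f := fun y => p₀ y * |g y|) ?_
      (Filter.Eventually.of_forall fun y => (e y).symm)
    refine hi.mono' (h.continuous_marginal.measurable.mul hg.abs).aestronglyMeasurable
      (Filter.Eventually.of_forall fun y => ?_)
    rw [Real.norm_eq_abs, abs_of_nonneg (mul_nonneg (h.marginal_nonneg y) (abs_nonneg _))]
    by_cases hy : y ∈ Metric.closedBall (0 : Fin d → ℝ) R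
    · simpa [Set.indicator_of_mem hy] using hN y
    · rw [Set.indicator_of_notMem hy, h.marginal_eq_zero y (by simpa using hy), zero_mul]

/-- The marginal of `v / p₀` is the indicator of `p₀ ≠ 0`, so its integral is the volume of a
bounded set. Individual slices need not have an integrable ratio; only almost all of them do. -/
theorem integrable_ratio :
    Integrable (fun z : ℝ × (Fin d → ℝ) => v z.1 t₀ z.2 * (p₀ z.2)⁻¹)
      ((volume.restrict A).prod volume) := by
  refine h.integrable_of_marginal (g := fun y => (p₀ y)⁻¹) h.continuous_marginal.measurable.inv
    (N := 1) fun y => ?_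
  have h0 := h.marginal_nonneg y
  rw [abs_of_nonneg (inv_nonneg.2 h0)]
  exact mul_inv_le_one

theorem integrable_log_marginal :
    Integrable (fun z : ℝ × (Fin d → ℝ) => v z.1 t₀ z.2 * Real.log (p₀ z.2))
      ((volume.restrict A).prod volume) := by
  obtain ⟨N, hN0, hN⟩ := exists_sqrt_mul_abs_log_le (weightConst K p d)
  refine h.integrable_of_marginal h.continuous_marginal.measurable.log
    (N := √(weightConst K p d) * N) fun y => ?_
  have h0 := h.marginal_nonneg y
  have h1 := h.marginal_le y
  calc p₀ y * |Real.log (p₀ y)| = √(p₀ y) * (√(p₀ y) * |Real.log (p₀ y)|) := by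
        rw [← mul_assoc, Real.mul_self_sqrt h0]
    _ ≤ _ := mul_le_mul (Real.sqrt_le_sqrt h1) (hN _ h0 h1) (by positivity) (by positivity)

/-- The initial slices of the bundle, as hypotheses on the pairs. -/
theorem ae_integrable_log_slice : ∀ᵐ a ∂volume.restrict A, a ∈ A ∧
    Integrable (fun y => v a t₀ y * Real.log (q a t₀ y)) := by
  have := h.isFiniteMeasure
  filter_upwards [h.integrable_log_marginal.prod_right_ae, ae_restrict_mem h.measurableSet]
    with a ha haA
  exact ⟨haA, by simpa only [h.initial a haA] using ha⟩

theorem pos_slice {a : ℝ} (ha : a ∈ A) : ∀ y, v a t₀ y ≠ 0 → 0 < q a t₀ y := fun y hy => by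
  rw [h.initial a ha]; exact h.marginal_pos a ha y hy

theorem integrable_state {s : ℝ} (hs : s ∈ Set.Icc t₀ t₁) :
    Integrable (fun z : ℝ × (Fin d → ℝ) => v z.1 s z.2) ((volume.restrict A).prod volume) := by
  refine (h.integrable_decay.const_mul (weightConst K p d)).mono'
    (h.measurable_state s hs).aestronglyMeasurable ?_
  filter_upwards [h.ae_mem] with z hz
  have hw := (h.pair z.1 hz).isWeightedDensity hs
  rw [Real.norm_eq_abs, abs_of_nonneg (hw.nonneg z.2)]
  exact hw.le_decayWeight z.2

theorem ae_pos {s : ℝ} (hs : s ∈ Set.Icc t₀ t₁) :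
    ∀ᵐ z ∂(volume.restrict A).prod volume, v z.1 s z.2 ≠ 0 → 0 < q z.1 s z.2 := by
  refine (Measure.ae_prod_iff_ae_ae ?_).2 ?_
  · have h1 : MeasurableSet {z : ℝ × (Fin d → ℝ) | v z.1 s z.2 = 0} :=
      (h.measurable_state s hs) (measurableSet_singleton 0)
    have h2 : MeasurableSet {z : ℝ × (Fin d → ℝ) | 0 < q z.1 s z.2} :=
      (h.measurable_param s hs) measurableSet_Ioi
    convert h1.union h2 using 1
    ext z
    simp [imp_iff_not_or]
  · filter_upwards [h.ae_integrable_log_slice] with a ha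
    exact ((h.pair a ha.1).log_integrable ha.2 (h.pos_slice ha.1) hs).2.1

/-- Since `log q ≤ M` with `M ≥ 0`, one has `|log q| ≤ 2M - log q`. The slice integrals of `v |log
q|` are thus controlled by the conserved mass and by the lower bound from `log_integrable`, whose
initial term `∫ v log p₀` is integrable in the parameter. -/
theorem integrable_log {s : ℝ} (hs : s ∈ Set.Icc t₀ t₁) :
    Integrable (fun z : ℝ × (Fin d → ℝ) => v z.1 s z.2 * Real.log (q z.1 s z.2))
      ((volume.restrict A).prod volume) := by
  have := h.isFiniteMeasure
  set C₀ := weightConst K p d with hC₀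
  have hC0 : 0 ≤ C₀ := h.weightConst_nonneg
  set M := Real.log (C₀ + 1) with hM
  have hM0 : 0 ≤ M := Real.log_nonneg (by linarith)
  have hmeas := ((h.measurable_state s hs).mul (h.measurable_param s hs).log).aestronglyMeasurable
    (μ := (volume.restrict A).prod volume)
  refine (integrable_prod_iff hmeas).2 ⟨?_, ?_⟩
  · filter_upwards [h.ae_integrable_log_slice] with a ha
    exact ((h.pair a ha.1).log_integrable ha.2 (h.pos_slice ha.1) hs).1
  · have i1 : Integrable (fun a => 2 * M * (∫ y, v a t₀ y)
        - ((∫ y, v a t₀ y * Real.log (p₀ y)) - lowerRate K p Λ d * (s - t₀)))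
        (volume.restrict A) :=
      ((h.integrable_state h.mem_Icc).integral_prod_left.const_mul _).sub
        (h.integrable_log_marginal.integral_prod_left.sub (integrable_const _))
    refine i1.mono' hmeas.norm.integral_prod_right' ?_
    filter_upwards [h.ae_integrable_log_slice] with a ha
    have hp := h.pair a ha.1
    obtain ⟨iL, hae, -, hlow⟩ := hp.log_integrable ha.2 (h.pos_slice ha.1) hs
    have hv := hp.isWeightedDensity hs
    have hq := hp.isWeightedDensity' hs
    rw [Real.norm_eq_abs, abs_of_nonneg (integral_nonneg fun y => norm_nonneg _)]
    calc ∫ y, ‖v a s y * Real.log (q a s y)‖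
        ≤ ∫ y, (2 * M * v a s y - v a s y * Real.log (q a s y)) := by
          refine integral_mono_ae iL.norm ((hv.integrable.const_mul _).sub iL) ?_
          filter_upwards [hae] with y hy
          by_cases h0 : v a s y = 0
          · simp [h0]
          have hlog : Real.log (q a s y) ≤ M :=
            Real.log_le_log (hy h0) (by linarith [hq.le_const y])
          have h1 := hv.nonneg y
          simp only [Real.norm_eq_abs, abs_le]
          constructor <;> nlinarith
      _ = 2 * M * (∫ y, v a t₀ y) - ∫ y, v a s y * Real.log (q a s y) := by
          rw [integral_sub (hv.integrable.const_mul _) iL, integral_const_mul, hp.integral_eq hs]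
      _ ≤ _ := by
          simp only [h.initial a ha.1] at hlow
          linarith

end IsFokkerPlanckBundle

theorem tendsto_logRate {d m : ℕ} {F : ℝ → (Fin d → ℝ) → Fin d → ℝ}
    {B : ℝ → (Fin d → ℝ) → Fin d → Fin m → ℝ} {s : ℝ} {v q : (Fin d → ℝ) → ℝ} {y : Fin d → ℝ}
    (hq : v y ≠ 0 → 0 < q y) :
    Filter.Tendsto (fun ε => logRate F B s v q ε y) (nhdsWithin 0 (Set.Ioi 0))
      (nhds (logRate F B s v q 0 y)) := by
  by_cases h0 : v y = 0
  · simp only [logRate_eq_zero h0]; exact tendsto_const_nhds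
  refine tendsto_nhdsWithin_of_tendsto_nhds ?_
  have b3 : Filter.Tendsto (fun ε : ℝ => (q y + ε)⁻¹) (nhds 0) (nhds (q y + 0)⁻¹) :=
    (Filter.tendsto_id.const_add _).inv₀ (by simpa using (hq h0).ne')
  have e := fun i => (tendsto_const_nhds (x := partialD i v y * (v y)⁻¹)).sub
    (b3.const_mul (partialD i q y))
  have f1 := tendsto_finsetSum Finset.univ fun i _ => tendsto_finsetSum Finset.univ fun j _ =>
    ((e i).mul (e j)).const_mul (diffusionMatrix B s y i j)
  exact (((f1.const_mul (v y)).const_mul (1 / 2)).sub tendsto_const_nhds).add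
    (((b3.const_mul (q y)).const_mul (v y)).const_mul _)

/-! ### Lower bound for the right derivative over the bundle -/

namespace IsFokkerPlanckBundle

variable {d m : ℕ} {A : Set ℝ} {F : ℝ → ℝ → (Fin d → ℝ) → Fin d → ℝ}
  {B : ℝ → ℝ → (Fin d → ℝ) → Fin d → Fin m → ℝ} {t₀ t₁ : ℝ} {K : ℕ → ℝ} {p : ℕ} {Λ R C : ℝ}
  {v vt q qt : ℝ → ℝ → (Fin d → ℝ) → ℝ} {p₀ pdot : (Fin d → ℝ) → ℝ}
  (h : IsFokkerPlanckBundle A F B t₀ t₁ K p Λ R C v vt q qt p₀ pdot)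

include h

theorem ratio_le {a : ℝ} (ha : a ∈ A) (y : Fin d → ℝ) {ε : ℝ} (hε : 0 ≤ ε) :
    v a t₀ y * (p₀ y + ε)⁻¹ ≤ v a t₀ y * (p₀ y)⁻¹ := by
  have h0 := (h.pair a ha).nonneg t₀ h.mem_Icc y
  by_cases hv : v a t₀ y = 0
  · simp [hv]
  · exact mul_le_mul_of_nonneg_left
      (inv_anti₀ (h.marginal_pos a ha y hv) (by linarith)) h0

theorem ratio_nonneg {a : ℝ} (ha : a ∈ A) (y : Fin d → ℝ) {ε : ℝ} (hε : 0 ≤ ε) :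
    0 ≤ v a t₀ y * (p₀ y + ε)⁻¹ :=
  mul_nonneg ((h.pair a ha).nonneg t₀ h.mem_Icc y)
    (inv_nonneg.2 (add_nonneg (h.marginal_nonneg y) hε))

theorem norm_le_of_state_ne_zero {a : ℝ} (ha : a ∈ A) {y : Fin d → ℝ} (hy : v a t₀ y ≠ 0) :
    ‖y‖ ≤ |R| := by
  by_contra hR
  exact (h.marginal_pos a ha y hy).ne'
    (h.marginal_eq_zero y ((le_abs_self R).trans_lt (not_le.1 hR)))

/-- At the initial time `v` is supported in the ball that carries `p₀`, so the polynomial weight in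
front of the singular ratio is a constant, and `v / p₀` dominates `v / (p₀ + ε)`. -/
theorem abs_logRate_le {a : ℝ} (ha : a ∈ A) (y : Fin d → ℝ) {ε : ℝ} (hε : 0 ≤ ε) :
    |logRate (F a) (B a) t₀ (v a t₀) (q a t₀) ε y|
      ≤ (2 * d ^ 2 + 1) * (Λ * weightConst K p d)
        * (decayWeight y + (1 + |R|) ^ p * (v a t₀ y * (p₀ y)⁻¹)) := by
  have hp := h.pair a ha
  refine (_root_.abs_logRate_le (hp.isWeightedDensity h.mem_Icc) (hp.isWeightedDensity' h.mem_Icc) hε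
    h.bound_nonneg (hp.coefficient t₀ h.mem_Icc y)).trans ?_
  refine mul_le_mul_of_nonneg_left (add_le_add_right ?_ _)
    (mul_nonneg (by positivity) (mul_nonneg h.bound_nonneg h.weightConst_nonneg))
  rw [h.initial a ha]
  by_cases hv : v a t₀ y = 0
  · simp [hv]
  · refine mul_le_mul ?_ (h.ratio_le ha y hε) (h.ratio_nonneg ha y hε) (by positivity)
    have := h.norm_le_of_state_ne_zero ha hv
    gcongr

theorem logRate_slice {a : ℝ} (ha : a ∈ A) (hr : Integrable (fun y => v a t₀ y * (p₀ y)⁻¹)) :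
    Integrable (logRate (F a) (B a) t₀ (v a t₀) (q a t₀) 0) ∧
    Filter.Tendsto (fun ε => ∫ y, logRate (F a) (B a) t₀ (v a t₀) (q a t₀) ε y)
      (nhdsWithin 0 (Set.Ioi 0)) (nhds (∫ y, logRate (F a) (B a) t₀ (v a t₀) (q a t₀) 0 y)) ∧
    ∀ ε > 0, |∫ y, logRate (F a) (B a) t₀ (v a t₀) (q a t₀) ε y|
      ≤ (2 * d ^ 2 + 1) * (Λ * weightConst K p d)
        * ((∫ y : Fin d → ℝ, decayWeight y) + (1 + |R|) ^ p * ∫ y, v a t₀ y * (p₀ y)⁻¹) := by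
  have hp := h.pair a ha
  set c := (2 * (d : ℝ) ^ 2 + 1) * (Λ * weightConst K p d)
  have ib : Integrable (fun y => c * (decayWeight y + (1 + |R|) ^ p * (v a t₀ y * (p₀ y)⁻¹))) :=
    (integrable_decayWeight.add (hr.const_mul _)).const_mul c
  have iε : ∀ ε > 0, Integrable (logRate (F a) (B a) t₀ (v a t₀) (q a t₀) ε) := fun ε hε =>
    (hp.integral_logRate_eq ⟨le_rfl, h.lt⟩ hε).1
  have hpt := fun y => tendsto_logRate (F := F a) (B := B a) (s := t₀) (v := v a t₀) (q := q a t₀)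
    (y := y) (h.pos_slice ha y)
  have hm : AEStronglyMeasurable (logRate (F a) (B a) t₀ (v a t₀) (q a t₀) 0) volume := by
    have he : Filter.Tendsto (fun k : ℕ => 1 / ((k : ℝ) + 1)) Filter.atTop
        (nhdsWithin 0 (Set.Ioi 0)) :=
      tendsto_nhdsWithin_iff.2 ⟨tendsto_one_div_add_atTop_nhds_zero_nat,
        Filter.Eventually.of_forall fun k => Set.mem_Ioi.2 (by positivity)⟩
    exact aestronglyMeasurable_of_tendsto_ae Filter.atTop
      (fun k : ℕ => (iε (1 / ((k : ℝ) + 1)) (by positivity)).aestronglyMeasurable)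
      (Filter.Eventually.of_forall fun y => (hpt y).comp he)
  refine ⟨ib.mono' hm (Filter.Eventually.of_forall fun y => h.abs_logRate_le ha y le_rfl), ?_, ?_⟩
  · refine tendsto_integral_filter_of_dominated_convergence _ ?_ ?_ ib
      (Filter.Eventually.of_forall hpt)
    · filter_upwards [self_mem_nhdsWithin] with ε hε using (iε ε hε).aestronglyMeasurable
    · filter_upwards [self_mem_nhdsWithin] with ε hε
      exact Filter.Eventually.of_forall fun y => h.abs_logRate_le ha y (Set.mem_Ioi.1 hε).le
  · intro ε hε
    rw [← integral_const_mul, ← integral_add integrable_decayWeight (hr.const_mul _),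
      ← integral_const_mul]
    exact (norm_integral_le_integral_norm _).trans
      (integral_mono (iε ε hε).norm ib fun y => h.abs_logRate_le ha y hε.le)

theorem deriv_marginal_eq_zero {y : Fin d → ℝ} (hy : p₀ y = 0) : pdot y = 0 := by
  have := h.sq_deriv_marginal_le y
  rw [hy, mul_zero] at this
  exact pow_eq_zero_iff two_ne_zero |>.1 (le_antisymm this (sq_nonneg _))

/-- `|pdot| ≤ √|C| √(p₀ + ε)`, and `√z |log z|` is bounded on bounded sets. The indicator comes from
the support of `p₀`, at whose zeros `pdot` vanishes. -/
theorem abs_deriv_marginal_mul_log_le : ∃ N, ∀ ε, 0 ≤ ε → ε ≤ 1 → ∀ y,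
    |pdot y * Real.log (p₀ y + ε)| ≤ (Metric.closedBall (0 : Fin d → ℝ) R).indicator
      (fun _ => N) y := by
  obtain ⟨N, hN0, hN⟩ := exists_sqrt_mul_abs_log_le (weightConst K p d + 1)
  refine ⟨√|C| * N, fun ε hε hε1 y => ?_⟩
  have hp := h.marginal_nonneg y
  have hb : |pdot y| ≤ √|C| * √(p₀ y + ε) := by
    rw [← Real.sqrt_mul (abs_nonneg C)]
    refine Real.abs_le_sqrt ((h.sq_deriv_marginal_le y).trans ?_)
    exact mul_le_mul (le_abs_self C) (by linarith) hp (abs_nonneg C)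
  by_cases hy : y ∈ Metric.closedBall (0 : Fin d → ℝ) R
  · rw [Set.indicator_of_mem hy, abs_mul]
    calc _ ≤ √|C| * √(p₀ y + ε) * |Real.log (p₀ y + ε)| :=
          mul_le_mul_of_nonneg_right hb (abs_nonneg _)
      _ ≤ _ := by
        rw [mul_assoc]
        refine mul_le_mul_of_nonneg_left (hN _ (by linarith) ?_) (Real.sqrt_nonneg _)
        linarith [h.marginal_le y]
  · rw [Set.indicator_of_notMem hy]
    have h0 := h.marginal_eq_zero y (by simpa using hy)
    simp [h.deriv_marginal_eq_zero h0]

theorem tendsto_integral_deriv_marginal_mul_log :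
    Filter.Tendsto (fun ε => ∫ y, pdot y * Real.log (p₀ y + ε)) (nhdsWithin 0 (Set.Ioi 0))
      (nhds (∫ y, pdot y * Real.log (p₀ y))) := by
  obtain ⟨N, hN⟩ := h.abs_deriv_marginal_mul_log_le
  have hi : Integrable ((Metric.closedBall (0 : Fin d → ℝ) R).indicator fun _ => N) :=
    (integrableOn_const (isCompact_closedBall _ _).measure_lt_top.ne).integrable_indicator
      measurableSet_closedBall
  have hev : ∀ᶠ ε in nhdsWithin (0 : ℝ) (Set.Ioi 0), ε ∈ Set.Ioc (0 : ℝ) 1 := Ioc_mem_nhdsGT one_pos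
  refine tendsto_integral_filter_of_dominated_convergence _ ?_ ?_ hi
    (Filter.Eventually.of_forall fun y => ?_)
  · exact Filter.Eventually.of_forall fun ε => (h.measurable_deriv_marginal.mul
      (h.continuous_marginal.measurable.add_const ε).log).aestronglyMeasurable
  · filter_upwards [hev] with ε hε
    exact Filter.Eventually.of_forall fun y => hN ε hε.1.le hε.2 y
  · by_cases h0 : p₀ y = 0
    · simp [h.deriv_marginal_eq_zero h0]
    · refine Filter.Tendsto.const_mul _ (Filter.Tendsto.log ?_ h0)
      refine tendsto_nhdsWithin_of_tendsto_nhds ?_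
      simpa using (Filter.tendsto_id (α := ℝ) (x := nhds 0)).const_add (p₀ y)

theorem integrable_deriv_mul_log {ε : ℝ} (hε : 0 < ε) :
    Integrable (fun z : ℝ × (Fin d → ℝ) => vt z.1 t₀ z.2 * Real.log (p₀ z.2 + ε))
      ((volume.restrict A).prod volume) := by
  set C₀ := weightConst K p d
  refine (h.integrable_decay.const_mul (C₀ * (|Real.log ε| + |Real.log (C₀ + ε)|))).mono'
    (h.measurable_state_deriv.mul ((h.continuous_marginal.measurable.comp
      measurable_snd).add_const ε).log).aestronglyMeasurable ?_
  filter_upwards [h.ae_mem] with z hz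
  rw [Real.norm_eq_abs, abs_mul]
  calc _ ≤ (C₀ * decayWeight z.2) * (|Real.log ε| + |Real.log (C₀ + ε)|) :=
        mul_le_mul ((h.pair z.1 hz).abs_deriv_le h.mem_Icc z.2)
          (abs_log_add_le hε (h.marginal_nonneg z.2) (h.marginal_le z.2)) (abs_nonneg _)
          (mul_nonneg h.weightConst_nonneg (decayWeight_pos _).le)
    _ = _ := by ring

theorem integral_deriv_mul_log {ε : ℝ} (hε : 0 < ε) :
    ∫ z, vt z.1 t₀ z.2 * Real.log (p₀ z.2 + ε) ∂(volume.restrict A).prod volume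
      = ∫ y, pdot y * Real.log (p₀ y + ε) := by
  have := h.isFiniteMeasure
  rw [integral_prod_symm _ (h.integrable_deriv_mul_log hε)]
  refine integral_congr_ae ?_
  filter_upwards [h.deriv_marginal] with y hy
  rw [hy, integral_mul_const]

theorem integrable_param_deriv_mul_ratio {ε : ℝ} (hε : 0 ≤ ε) :
    Integrable (fun z : ℝ × (Fin d → ℝ) => qt z.1 t₀ z.2 * (v z.1 t₀ z.2 * (p₀ z.2 + ε)⁻¹))
      ((volume.restrict A).prod volume) := by
  refine (h.integrable_ratio.const_mul (weightConst K p d)).mono'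
    (h.measurable_param_deriv.mul ((h.measurable_state t₀ h.mem_Icc).mul
      ((h.continuous_marginal.measurable.comp measurable_snd).add_const ε).inv).aestronglyMeasurable)
    ?_
  filter_upwards [h.ae_mem] with z hz
  rw [Real.norm_eq_abs, abs_mul, abs_of_nonneg (h.ratio_nonneg hz z.2 hε)]
  refine mul_le_mul ?_ (h.ratio_le hz z.2 hε) (h.ratio_nonneg hz z.2 hε) h.weightConst_nonneg
  refine ((h.pair z.1 hz).abs_deriv_le' h.mem_Icc z.2).trans
    (mul_le_of_le_one_right h.weightConst_nonneg (decayWeight_le_one _))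

theorem tendsto_integral_param_deriv_mul_ratio :
    Filter.Tendsto (fun ε => ∫ z, qt z.1 t₀ z.2 * (v z.1 t₀ z.2 * (p₀ z.2 + ε)⁻¹)
        ∂(volume.restrict A).prod volume) (nhdsWithin 0 (Set.Ioi 0))
      (nhds (∫ z, qt z.1 t₀ z.2 * (v z.1 t₀ z.2 * (p₀ z.2)⁻¹)
        ∂(volume.restrict A).prod volume)) := by
  refine tendsto_integral_filter_of_dominated_convergence
    (fun z => weightConst K p d * (v z.1 t₀ z.2 * (p₀ z.2)⁻¹)) ?_ ?_
    (h.integrable_ratio.const_mul _) ?_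
  · filter_upwards [self_mem_nhdsWithin] with ε hε
    exact (h.integrable_param_deriv_mul_ratio (Set.mem_Ioi.1 hε).le).aestronglyMeasurable
  · filter_upwards [self_mem_nhdsWithin] with ε hε
    filter_upwards [h.ae_mem] with z hz
    have hε := (Set.mem_Ioi.1 hε).le
    rw [Real.norm_eq_abs, abs_mul, abs_of_nonneg (h.ratio_nonneg hz z.2 hε)]
    refine mul_le_mul ?_ (h.ratio_le hz z.2 hε) (h.ratio_nonneg hz z.2 hε) h.weightConst_nonneg
    exact ((h.pair z.1 hz).abs_deriv_le' h.mem_Icc z.2).trans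
      (mul_le_of_le_one_right h.weightConst_nonneg (decayWeight_le_one _))
  · filter_upwards [h.ae_mem] with z hz
    by_cases h0 : v z.1 t₀ z.2 = 0
    · simp [h0]
    · refine Filter.Tendsto.const_mul _ (Filter.Tendsto.const_mul _ (Filter.Tendsto.inv₀ ?_
        (h.marginal_pos z.1 hz z.2 h0).ne'))
      refine tendsto_nhdsWithin_of_tendsto_nhds ?_
      simpa using (Filter.tendsto_id (α := ℝ) (x := nhds 0)).const_add (p₀ z.2)

/-- The integral of `logRate` over the bundle. -/
theorem integral_logRate_eq :
    Integrable (fun a => ∫ y, logRate (F a) (B a) t₀ (v a t₀) (q a t₀) 0 y) (volume.restrict A) ∧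
    ∫ a in A, ∫ y, logRate (F a) (B a) t₀ (v a t₀) (q a t₀) 0 y
      = (∫ y, pdot y * Real.log (p₀ y))
        + ∫ z, qt z.1 t₀ z.2 * (v z.1 t₀ z.2 * (p₀ z.2)⁻¹) ∂(volume.restrict A).prod volume := by
  have := h.isFiniteMeasure
  set c := (2 * (d : ℝ) ^ 2 + 1) * (Λ * weightConst K p d)
  have hslice : ∀ᵐ a ∂volume.restrict A, a ∈ A ∧ Integrable (fun y => v a t₀ y * (p₀ y)⁻¹) := by
    filter_upwards [ae_restrict_mem h.measurableSet, h.integrable_ratio.prod_right_ae] with a h1 h2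
      using ⟨h1, h2⟩
  have isum : ∀ ε > 0, Integrable (fun z : ℝ × (Fin d → ℝ) =>
      vt z.1 t₀ z.2 * Real.log (p₀ z.2 + ε) + qt z.1 t₀ z.2 * (v z.1 t₀ z.2 * (p₀ z.2 + ε)⁻¹))
      ((volume.restrict A).prod volume) := fun ε hε =>
    (h.integrable_deriv_mul_log hε).add (h.integrable_param_deriv_mul_ratio hε.le)
  have hI : ∀ ε > 0, (fun a => ∫ y, (vt a t₀ y * Real.log (p₀ y + ε)
      + qt a t₀ y * (v a t₀ y * (p₀ y + ε)⁻¹))) =ᵐ[volume.restrict A]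
      fun a => ∫ y, logRate (F a) (B a) t₀ (v a t₀) (q a t₀) ε y := fun ε hε => by
    filter_upwards [ae_restrict_mem h.measurableSet] with a ha
    have := ((h.pair a ha).integral_logRate_eq ⟨le_rfl, h.lt⟩ hε).2.2
    rw [← this, h.initial a ha]
  have hm : ∀ ε > 0, AEStronglyMeasurable
      (fun a => ∫ y, logRate (F a) (B a) t₀ (v a t₀) (q a t₀) ε y) (volume.restrict A) :=
    fun ε hε => (isum ε hε).aestronglyMeasurable.integral_prod_right'.congr (hI ε hε)
  have hlim : ∀ᵐ a ∂volume.restrict A, Filter.Tendsto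
      (fun ε => ∫ y, logRate (F a) (B a) t₀ (v a t₀) (q a t₀) ε y) (nhdsWithin 0 (Set.Ioi 0))
      (nhds (∫ y, logRate (F a) (B a) t₀ (v a t₀) (q a t₀) 0 y)) := by
    filter_upwards [hslice] with a ha using (h.logRate_slice ha.1 ha.2).2.1
  have hbound : ∀ ε > 0, ∀ᵐ a ∂volume.restrict A,
      ‖∫ y, logRate (F a) (B a) t₀ (v a t₀) (q a t₀) ε y‖ ≤ c * ((∫ y : Fin d → ℝ, decayWeight y)
        + (1 + |R|) ^ p * ∫ y, v a t₀ y * (p₀ y)⁻¹) := fun ε hε => by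
    filter_upwards [hslice] with a ha using (h.logRate_slice ha.1 ha.2).2.2 ε hε
  have ib : Integrable (fun a => c * ((∫ y : Fin d → ℝ, decayWeight y)
        + (1 + |R|) ^ p * ∫ y, v a t₀ y * (p₀ y)⁻¹)) (volume.restrict A) :=
    ((integrable_const _).add (h.integrable_ratio.integral_prod_left.const_mul _)).const_mul _
  have he : Filter.Tendsto (fun k : ℕ => 1 / ((k : ℝ) + 1)) Filter.atTop
      (nhdsWithin 0 (Set.Ioi 0)) :=
    tendsto_nhdsWithin_iff.2 ⟨tendsto_one_div_add_atTop_nhds_zero_nat,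
      Filter.Eventually.of_forall fun k => Set.mem_Ioi.2 (by positivity)⟩
  have hm0 : AEStronglyMeasurable
      (fun a => ∫ y, logRate (F a) (B a) t₀ (v a t₀) (q a t₀) 0 y) (volume.restrict A) :=
    aestronglyMeasurable_of_tendsto_ae Filter.atTop
      (fun k : ℕ => hm (1 / ((k : ℝ) + 1)) (by positivity)) (hlim.mono fun a ha => ha.comp he)
  refine ⟨ib.mono' hm0 ?_, ?_⟩
  · have hk : ∀ᵐ a ∂volume.restrict A, ∀ k : ℕ,
        ‖∫ y, logRate (F a) (B a) t₀ (v a t₀) (q a t₀) (1 / ((k : ℝ) + 1)) y‖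
          ≤ c * ((∫ y : Fin d → ℝ, decayWeight y) + (1 + |R|) ^ p * ∫ y, v a t₀ y * (p₀ y)⁻¹) :=
      ae_all_iff.2 fun k => hbound _ (by positivity)
    filter_upwards [hlim, hk] with a h1 h2
    exact le_of_tendsto (h1.comp he).norm (Filter.Eventually.of_forall h2)
  -- For `ε > 0` the identity is Fubini's theorem, since `log (p₀ + ε)` does not depend on the
  -- parameter and integrates `vt` to `pdot`. Both sides converge as `ε → 0`.
  · have T1 := tendsto_integral_filter_of_dominated_convergence
      (l := nhdsWithin (0 : ℝ) (Set.Ioi 0)) _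
      (eventually_mem_nhdsWithin.mono fun ε hε => hm ε hε)
      (eventually_mem_nhdsWithin.mono fun ε hε => hbound ε hε) ib hlim
    have T2 := h.tendsto_integral_deriv_marginal_mul_log.add h.tendsto_integral_param_deriv_mul_ratio
    refine tendsto_nhds_unique T1 (T2.congr' ?_)
    filter_upwards [self_mem_nhdsWithin] with ε hε
    have hε := Set.mem_Ioi.1 hε
    rw [← h.integral_deriv_mul_log hε, ← integral_add (h.integrable_deriv_mul_log hε)
      (h.integrable_param_deriv_mul_ratio hε.le), integral_prod _ (isum ε hε)]
    exact integral_congr_ae (hI ε hε)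

/-- The lower bound for the right derivative of `∫ v log q` over the bundle. -/
theorem eventually_integral_log_sub_ge {η : ℝ} (hη : 0 < η) :
    ∀ᶠ s in nhdsWithin t₀ (Set.Ioi t₀),
      ((∫ y, pdot y * Real.log (p₀ y))
        + (∫ z, qt z.1 t₀ z.2 * (v z.1 t₀ z.2 * (p₀ z.2)⁻¹) ∂(volume.restrict A).prod volume) - η)
        * (s - t₀)
      ≤ (∫ z, v z.1 s z.2 * Real.log (q z.1 s z.2) ∂(volume.restrict A).prod volume)
        - ∫ z, v z.1 t₀ z.2 * Real.log (q z.1 t₀ z.2) ∂(volume.restrict A).prod volume := by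
  have := h.isFiniteMeasure
  have hev : ∀ᶠ s in nhdsWithin t₀ (Set.Ioi t₀), s ∈ Set.Ioc t₀ t₁ := Ioc_mem_nhdsGT h.lt
  have hslice : ∀ᵐ a ∂volume.restrict A, a ∈ A ∧ Integrable (fun y => v a t₀ y * (p₀ y)⁻¹) := by
    filter_upwards [ae_restrict_mem h.measurableSet, h.integrable_ratio.prod_right_ae] with a h1 h2
      using ⟨h1, h2⟩
  have iD : ∀ s ∈ Set.Icc t₀ t₁, Integrable (fun a => ∫ y, v a s y * Real.log (q a s y))
      (volume.restrict A) := fun s hs => (h.integrable_log hs).integral_prod_left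
  -- Fatou's lemma in the parameter: the difference quotients are at least `-lowerRate`, a constant
  -- on a set of finite measure, and their lower limits are known for almost every slice.
  have key := eventually_integral_ge_of_ge (μ := volume.restrict A)
    (l := nhdsWithin t₀ (Set.Ioi t₀))
    (f := fun s a => ((∫ y, v a s y * Real.log (q a s y))
      - ∫ y, v a t₀ y * Real.log (q a t₀ y)) / (s - t₀))
    (h := fun _ => lowerRate K p Λ d) ?_ h.integral_logRate_eq.1 (integrable_const _) ?_ ?_ hη
  · rw [h.integral_logRate_eq.2] at key
    filter_upwards [key, hev] with s h1 hs
    have hsI : s ∈ Set.Icc t₀ t₁ := Set.Ioc_subset_Icc_self hs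
    rw [integral_div, integral_sub (iD s hsI) (iD t₀ h.mem_Icc),
      ← integral_prod _ (h.integrable_log hsI), ← integral_prod _ (h.integrable_log h.mem_Icc),
      le_div_iff₀ (sub_pos.2 hs.1)] at h1
    exact h1
  · filter_upwards [hev] with s hs
    exact ((iD s (Set.Ioc_subset_Icc_self hs)).sub (iD t₀ h.mem_Icc)).div_const _
  · filter_upwards [hev] with s hs
    filter_upwards [h.ae_integrable_log_slice] with a ha
    have := ((h.pair a ha.1).log_integrable ha.2 (h.pos_slice ha.1)
      (Set.Ioc_subset_Icc_self hs)).2.2.2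
    rw [le_div_iff₀ (sub_pos.2 hs.1)]
    linarith
  · filter_upwards [h.ae_integrable_log_slice, hslice] with a ha hr η hη
    filter_upwards [(h.pair a ha.1).eventually_integral_log_sub_ge ha.2 (h.pos_slice ha.1)
      (h.logRate_slice ha.1 hr.2).1 hη, hev] with s h1 hs
    rwa [le_div_iff₀ (sub_pos.2 hs.1)]

end IsFokkerPlanckBundle

/-! ### Upper bound for the right derivative over the bundle -/

theorem IsFokkerPlanckPair.deriv_nonneg {d m : ℕ} {F : ℝ → (Fin d → ℝ) → Fin d → ℝ}
    {B : ℝ → (Fin d → ℝ) → Fin d → Fin m → ℝ} {t₀ t₁ Λ : ℝ} {K : ℕ → ℝ} {p : ℕ}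
    {v vt q qt : ℝ → (Fin d → ℝ) → ℝ} (h : IsFokkerPlanckPair F B t₀ t₁ K p Λ v vt q qt)
    {y : Fin d → ℝ} (hv : v t₀ y = 0) : 0 ≤ vt t₀ y := by
  have T : Filter.Tendsto (fun s => -(weightConst K p d * (s - t₀) * decayWeight y))
      (nhdsWithin t₀ (Set.Ioi t₀)) (nhds (-(weightConst K p d * (t₀ - t₀) * decayWeight y))) :=
    tendsto_nhdsWithin_of_tendsto_nhds (Continuous.tendsto (by fun_prop) t₀)
  simp only [sub_self, mul_zero, zero_mul, neg_zero] at T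
  refine le_of_tendsto T ?_
  filter_upwards [Ioc_mem_nhdsGT h.lt] with s hs
  have hsI : s ∈ Set.Icc t₀ t₁ := Set.Ioc_subset_Icc_self hs
  have h1 := (abs_le.1 (h.abs_taylor_le hsI y)).2
  have h2 := h.nonneg s hsI y
  have hσ : 0 < s - t₀ := sub_pos.2 hs.1
  rw [hv] at h1
  refine le_of_mul_le_mul_left ?_ hσ
  nlinarith

theorem tendsto_sub_nhdsGT (t₀ : ℝ) :
    Filter.Tendsto (fun s => s - t₀) (nhdsWithin t₀ (Set.Ioi t₀)) (nhdsWithin 0 (Set.Ioi 0)) := by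
  refine tendsto_nhdsWithin_iff.2 ⟨?_, ?_⟩
  · refine tendsto_nhdsWithin_of_tendsto_nhds ?_
    simpa using (Filter.tendsto_id (α := ℝ) (x := nhds t₀)).sub_const t₀
  · filter_upwards [self_mem_nhdsWithin] with s hs using Set.mem_Ioi.2 (sub_pos.2 (Set.mem_Ioi.1 hs))

/-- The part of the upper difference quotient of `v log q` that remains bounded by a multiple of
`v / p₀`. -/
noncomputable def logRemainder {d : ℕ} (t₀ : ℝ) (v q : ℝ → ℝ → (Fin d → ℝ) → ℝ)
    (p₀ : (Fin d → ℝ) → ℝ) (s : ℝ) (z : ℝ × (Fin d → ℝ)) : ℝ :=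
  v z.1 t₀ z.2 * ((s - t₀)⁻¹ * (Real.log (p₀ z.2 + (s - t₀)) - Real.log (p₀ z.2)))
    + v z.1 s z.2 * (p₀ z.2 + (s - t₀))⁻¹ * ((s - t₀)⁻¹ * (q z.1 s z.2 - p₀ z.2) - 1)

namespace IsFokkerPlanckBundle

variable {d m : ℕ} {A : Set ℝ} {F : ℝ → ℝ → (Fin d → ℝ) → Fin d → ℝ}
  {B : ℝ → ℝ → (Fin d → ℝ) → Fin d → Fin m → ℝ} {t₀ t₁ : ℝ} {K : ℕ → ℝ} {p : ℕ} {Λ R C : ℝ}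
  {v vt q qt : ℝ → ℝ → (Fin d → ℝ) → ℝ} {p₀ pdot : (Fin d → ℝ) → ℝ}
  (h : IsFokkerPlanckBundle A F B t₀ t₁ K p Λ R C v vt q qt p₀ pdot)

include h

theorem state_eq_zero {a : ℝ} (ha : a ∈ A) {y : Fin d → ℝ} (hy : p₀ y = 0) : v a t₀ y = 0 := by
  by_contra h0
  exact (h.marginal_pos a ha y h0).ne' hy

/-- If `p₀ y = 0`, all slices vanish at `y` at the initial time and are nonnegative later, so their
time derivatives are nonnegative. For almost every `y` these derivatives integrate to `pdot y = 0`,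
hence they vanish for almost every parameter. -/
theorem ae_deriv_eq_zero : ∀ᵐ z ∂(volume.restrict A).prod (volume : Measure (Fin d → ℝ)),
    p₀ z.2 = 0 → vt z.1 t₀ z.2 = 0 := by
  have := h.isFiniteMeasure
  have hm : MeasurableSet {z : ℝ × (Fin d → ℝ) | p₀ z.2 = 0 → vt z.1 t₀ z.2 = 0} := by
    have h1 : MeasurableSet {z : ℝ × (Fin d → ℝ) | p₀ z.2 = 0} :=
      (h.continuous_marginal.measurable.comp measurable_snd) (measurableSet_singleton 0)
    have h2 : MeasurableSet {z : ℝ × (Fin d → ℝ) | vt z.1 t₀ z.2 = 0} :=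
      h.measurable_state_deriv (measurableSet_singleton 0)
    convert h1.compl.union h2 using 1
    ext z
    simp [imp_iff_not_or]
  rw [Measure.ae_prod_iff_ae_ae hm,
    Measure.ae_ae_comm (p := fun a y => p₀ y = 0 → vt a t₀ y = 0) hm]
  filter_upwards [h.deriv_marginal] with y hy
  by_cases h0 : p₀ y = 0
  · rw [h.deriv_marginal_eq_zero h0] at hy
    have hnn : 0 ≤ᵐ[volume.restrict A] fun a => vt a t₀ y := by
      filter_upwards [ae_restrict_mem h.measurableSet] with a ha
      exact (h.pair a ha).deriv_nonneg (h.state_eq_zero ha h0)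
    have hi : Integrable (fun a => vt a t₀ y) (volume.restrict A) := by
      refine Integrable.of_bound (C := weightConst K p d)
        (h.measurable_state_deriv.comp (measurable_id.prodMk measurable_const)).aestronglyMeasurable
        ?_
      filter_upwards [ae_restrict_mem h.measurableSet] with a ha
      exact ((h.pair a ha).abs_deriv_le h.mem_Icc y).trans
        (mul_le_of_le_one_right h.weightConst_nonneg (decayWeight_le_one _))
    filter_upwards [(integral_eq_zero_iff_of_nonneg_ae hnn hi).1 hy.symm] with a ha _
    exact ha
  · exact Filter.Eventually.of_forall fun a ha => absurd ha h0

theorem integrable_sub_mul_log {s : ℝ} (hs : s ∈ Set.Icc t₀ t₁) {ε : ℝ} (hε : 0 < ε) :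
    Integrable (fun z : ℝ × (Fin d → ℝ) => v z.1 s z.2 * Real.log (p₀ z.2 + ε))
      ((volume.restrict A).prod volume) := by
  refine (h.integrable_state hs).mul_bdd (c := |Real.log ε| + |Real.log (weightConst K p d + ε)|)
    ((h.continuous_marginal.measurable.comp measurable_snd).add_const ε).log.aestronglyMeasurable
    (Filter.Eventually.of_forall fun z => ?_)
  exact abs_log_add_le hε (h.marginal_nonneg z.2) (h.marginal_le z.2)

/-- The regularisation is tied to time by `ε = s - t₀ = σ`. Replacing the difference quotient of `v`
by `vt` costs `O(σ)` by Taylor's formula, against a logarithm of order `|log σ|`, and `σ log σ → 0`.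
-/
theorem tendsto_integral_sub_mul_log :
    Filter.Tendsto (fun s => (s - t₀)⁻¹ * ∫ z, (v z.1 s z.2 - v z.1 t₀ z.2)
        * Real.log (p₀ z.2 + (s - t₀)) ∂(volume.restrict A).prod volume)
      (nhdsWithin t₀ (Set.Ioi t₀)) (nhds (∫ y, pdot y * Real.log (p₀ y))) := by
  set C₀ := weightConst K p d with hC₀
  have hC0 : 0 ≤ C₀ := h.weightConst_nonneg
  have T1 := h.tendsto_integral_deriv_marginal_mul_log.comp (tendsto_sub_nhdsGT t₀)
  have T2 : Filter.Tendsto (fun σ : ℝ => C₀ * (|σ * Real.log σ| + σ * |Real.log (C₀ + 1)|)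
      * ∫ z : ℝ × (Fin d → ℝ), decayWeight z.2 ∂(volume.restrict A).prod volume)
      (nhdsWithin 0 (Set.Ioi 0)) (nhds 0) := by
    refine tendsto_nhdsWithin_of_tendsto_nhds ?_
    have hc : Continuous (fun σ : ℝ => C₀ * (|σ * Real.log σ| + σ * |Real.log (C₀ + 1)|)
      * ∫ z : ℝ × (Fin d → ℝ), decayWeight z.2 ∂(volume.restrict A).prod volume) :=
      (continuous_const.mul (Real.continuous_mul_log.abs.add
        (continuous_id.mul continuous_const))).mul continuous_const
    simpa using hc.tendsto 0
  refine (tendsto_iff_of_dist ?_).1 T1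
  refine squeeze_zero' (Filter.Eventually.of_forall fun s => dist_nonneg) ?_
    (T2.comp (tendsto_sub_nhdsGT t₀))
  filter_upwards [Ioc_mem_nhdsGT h.lt, Ioc_mem_nhdsGT (show t₀ < t₀ + 1 by linarith)] with s hs hs1
  have hsI : s ∈ Set.Icc t₀ t₁ := Set.Ioc_subset_Icc_self hs
  have hσ : 0 < s - t₀ := sub_pos.2 hs.1
  simp only [Function.comp]
  set σ := s - t₀ with hσdef
  have i1 : Integrable (fun z : ℝ × (Fin d → ℝ) => (v z.1 s z.2 - v z.1 t₀ z.2)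
      * Real.log (p₀ z.2 + σ)) ((volume.restrict A).prod volume) := by
    simp only [sub_mul]
    exact (h.integrable_sub_mul_log hsI hσ).sub (h.integrable_sub_mul_log h.mem_Icc hσ)
  rw [dist_comm, Real.dist_eq, ← h.integral_deriv_mul_log hσ, ← integral_const_mul,
    ← integral_sub (i1.const_mul _) (h.integrable_deriv_mul_log hσ), ← integral_const_mul]
  refine (norm_integral_le_integral_norm _).trans (integral_mono_ae
    ((i1.const_mul _).sub (h.integrable_deriv_mul_log hσ)).norm (h.integrable_decay.const_mul _) ?_)
  filter_upwards [h.ae_mem] with z hz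
  have hT := (h.pair z.1 hz).abs_taylor_le hsI z.2
  have hL : |Real.log (p₀ z.2 + σ)| ≤ |Real.log σ| + |Real.log (C₀ + 1)| := by
    have hp := h.marginal_nonneg z.2
    have hp' : p₀ z.2 ≤ C₀ := h.marginal_le z.2
    have e1 : Real.log σ ≤ Real.log (p₀ z.2 + σ) := Real.log_le_log hσ (by linarith)
    have e2 : Real.log (p₀ z.2 + σ) ≤ Real.log (C₀ + 1) :=
      Real.log_le_log (by linarith) (by linarith [hs1.2])
    rw [abs_le]
    constructor
    · linarith [neg_abs_le (Real.log σ), abs_nonneg (Real.log (C₀ + 1))]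
    · linarith [le_abs_self (Real.log (C₀ + 1)), abs_nonneg (Real.log σ)]
  have e : σ⁻¹ * ((v z.1 s z.2 - v z.1 t₀ z.2) * Real.log (p₀ z.2 + σ))
      - vt z.1 t₀ z.2 * Real.log (p₀ z.2 + σ)
      = σ⁻¹ * ((v z.1 s z.2 - v z.1 t₀ z.2 - σ * vt z.1 t₀ z.2) * Real.log (p₀ z.2 + σ)) := by
    field_simp
  simp only [Real.norm_eq_abs, Pi.sub_apply]
  rw [e, abs_mul, abs_mul, abs_of_pos (inv_pos.2 hσ), inv_mul_le_iff₀ hσ]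
  calc _ ≤ (C₀ * σ ^ 2 * decayWeight z.2) * (|Real.log σ| + |Real.log (C₀ + 1)|) :=
        mul_le_mul hT hL (abs_nonneg _) (mul_nonneg (by positivity) (decayWeight_pos _).le)
    _ = _ := by rw [abs_mul, abs_of_pos hσ]; ring

/-- Concavity gives `log (p₀ + σ) - log p₀ ≤ σ / p₀`. In the other term `v` has grown by at most
`O(σ)`, which the factor `(p₀ + σ)⁻¹ ≤ σ⁻¹` keeps bounded, and `q` has moved from `p₀` by at most
`O(σ)`. -/
theorem abs_logRemainder_le {s : ℝ} (hs : s ∈ Set.Ioc t₀ t₁) {z : ℝ × (Fin d → ℝ)}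
    (hz : z.1 ∈ A) :
    |logRemainder t₀ v q p₀ s z| ≤ v z.1 t₀ z.2 * (p₀ z.2)⁻¹
      + (v z.1 t₀ z.2 * (p₀ z.2)⁻¹ + weightConst K p d * decayWeight z.2)
        * (weightConst K p d + 1) := by
  set C₀ := weightConst K p d with hC₀
  have hC0 : 0 ≤ C₀ := h.weightConst_nonneg
  have hsI : s ∈ Set.Icc t₀ t₁ := Set.Ioc_subset_Icc_self hs
  have hσ : 0 < s - t₀ := sub_pos.2 hs.1
  have hp := h.pair z.1 hz
  have hv0 := hp.nonneg t₀ h.mem_Icc z.2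
  have hvs := hp.nonneg s hsI z.2
  have hlv := hp.abs_sub_le hsI z.2
  have hlq := hp.abs_sub_le' hsI z.2
  rw [h.initial z.1 hz] at hlq
  have hp0 := h.marginal_nonneg z.2
  have hτ := decayWeight_pos z.2
  have hτ1 := decayWeight_le_one z.2
  set σ := s - t₀ with hσdef
  have hpσ : 0 < p₀ z.2 + σ := by linarith
  refine (abs_add_le _ _).trans (add_le_add ?_ ?_)
  · rw [abs_mul, abs_of_nonneg hv0]
    by_cases h0 : v z.1 t₀ z.2 = 0
    · simp [h0]
    refine mul_le_mul_of_nonneg_left ?_ hv0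
    have hpp := h.marginal_pos z.1 hz z.2 h0
    have e1 : 0 ≤ Real.log (p₀ z.2 + σ) - Real.log (p₀ z.2) :=
      sub_nonneg.2 (Real.log_le_log hpp (by linarith))
    have e2 : Real.log (p₀ z.2 + σ) - Real.log (p₀ z.2) ≤ σ * (p₀ z.2)⁻¹ := by
      rw [← Real.log_div hpσ.ne' hpp.ne']
      refine (Real.log_le_sub_one_of_pos (div_pos hpσ hpp)).trans (le_of_eq ?_)
      field_simp
      ring
    rw [abs_of_nonneg (mul_nonneg (inv_pos.2 hσ).le e1), inv_mul_le_iff₀ hσ]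
    exact e2
  · rw [abs_mul, abs_of_nonneg (mul_nonneg hvs (inv_pos.2 hpσ).le)]
    refine mul_le_mul ?_ ?_ (abs_nonneg _)
      (add_nonneg (by simpa using h.ratio_nonneg hz z.2 le_rfl) (mul_nonneg hC0 hτ.le))
    · have e1 : v z.1 s z.2 ≤ v z.1 t₀ z.2 + C₀ * σ * decayWeight z.2 := by
        linarith [(abs_le.1 hlv).2]
      calc v z.1 s z.2 * (p₀ z.2 + σ)⁻¹
          ≤ (v z.1 t₀ z.2 + C₀ * σ * decayWeight z.2) * (p₀ z.2 + σ)⁻¹ :=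
            mul_le_mul_of_nonneg_right e1 (inv_pos.2 hpσ).le
        _ = v z.1 t₀ z.2 * (p₀ z.2 + σ)⁻¹
            + C₀ * decayWeight z.2 * (σ * (p₀ z.2 + σ)⁻¹) := by ring
        _ ≤ _ := by
          refine add_le_add (h.ratio_le hz z.2 hσ.le)
            (mul_le_of_le_one_right (mul_nonneg hC0 hτ.le) ?_)
          rw [← div_eq_mul_inv, div_le_one hpσ]
          linarith
    · refine (abs_sub _ _).trans (add_le_add ?_ (by simp))
      rw [abs_mul, abs_of_pos (inv_pos.2 hσ), inv_mul_le_iff₀ hσ]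
      refine hlq.trans ?_
      have := mul_le_mul_of_nonneg_left hτ1 (mul_nonneg hC0 hσ.le)
      linarith

theorem integrable_bound : Integrable (fun z : ℝ × (Fin d → ℝ) => v z.1 t₀ z.2 * (p₀ z.2)⁻¹
    + (v z.1 t₀ z.2 * (p₀ z.2)⁻¹ + weightConst K p d * decayWeight z.2)
      * (weightConst K p d + 1)) ((volume.restrict A).prod volume) :=
  h.integrable_ratio.add ((h.integrable_ratio.add
    (h.integrable_decay.const_mul _)).mul_const _)

theorem integrable_logRemainder {s : ℝ} (hs : s ∈ Set.Ioc t₀ t₁) :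
    Integrable (logRemainder t₀ v q p₀ s) ((volume.restrict A).prod volume) := by
  have hsI : s ∈ Set.Icc t₀ t₁ := Set.Ioc_subset_Icc_self hs
  have mp : Measurable (fun z : ℝ × (Fin d → ℝ) => p₀ z.2) :=
    h.continuous_marginal.measurable.comp measurable_snd
  have mv := h.measurable_state s hsI
  have mv0 := h.measurable_state t₀ h.mem_Icc
  have mq := h.measurable_param s hsI
  refine h.integrable_bound.mono' (Measurable.aestronglyMeasurable
    ((mv0.mul (measurable_const.mul (((mp.add_const _).log).sub mp.log))).add
      ((mv.mul (mp.add_const _).inv).mul ((measurable_const.mul (mq.sub mp)).sub_const 1)))) ?_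
  filter_upwards [h.ae_mem] with z hz using h.abs_logRemainder_le hs hz

/-- Pointwise, where `p₀ > 0` the limit is `v / p₀ + (v / p₀)(qt - 1)`, so the ratio itself cancels.
Where `p₀ = 0`, both `v` and, almost everywhere, `vt` vanish initially; then `v = O(σ²)`, which
beats `(p₀ + σ)⁻¹ = σ⁻¹`. -/
theorem tendsto_integral_logRemainder :
    Filter.Tendsto (fun s => ∫ z, logRemainder t₀ v q p₀ s z ∂(volume.restrict A).prod volume)
      (nhdsWithin t₀ (Set.Ioi t₀)) (nhds (∫ z, qt z.1 t₀ z.2 * (v z.1 t₀ z.2 * (p₀ z.2)⁻¹)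
        ∂(volume.restrict A).prod volume)) := by
  set C₀ := weightConst K p d with hC₀
  have hC0 : 0 ≤ C₀ := h.weightConst_nonneg
  have hev : ∀ᶠ s in nhdsWithin t₀ (Set.Ioi t₀), s ∈ Set.Ioc t₀ t₁ := Ioc_mem_nhdsGT h.lt
  refine tendsto_integral_filter_of_dominated_convergence _ ?_ ?_ h.integrable_bound ?_
  · filter_upwards [hev] with s hs using (h.integrable_logRemainder hs).aestronglyMeasurable
  · filter_upwards [hev] with s hs
    filter_upwards [h.ae_mem] with z hz using h.abs_logRemainder_le hs hz
  · filter_upwards [h.ae_mem, h.ae_deriv_eq_zero] with z hz hzero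
    have hp := h.pair z.1 hz
    have hI : nhdsWithin t₀ (Set.Ioi t₀) ≤ nhdsWithin t₀ (Set.Icc t₀ t₁ \ {t₀}) := by
      refine nhdsWithin_le_of_mem ?_
      filter_upwards [hev] with s hs using ⟨Set.Ioc_subset_Icc_self hs, hs.1.ne'⟩
    have tq : Filter.Tendsto (fun s => (s - t₀)⁻¹ * (q z.1 s z.2 - p₀ z.2))
        (nhdsWithin t₀ (Set.Ioi t₀)) (nhds (qt z.1 t₀ z.2)) := by
      have := (hasDerivWithinAt_iff_tendsto_slope.1
        (hp.decaying'.hasDerivWithinAt t₀ h.mem_Icc z.2)).mono_left hI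
      refine this.congr fun s => ?_
      rw [slope_def_field, h.initial z.1 hz, div_eq_inv_mul]
    simp only [logRemainder]
    by_cases h0 : p₀ z.2 = 0
    · have hv0 := h.state_eq_zero hz h0
      have hvt := hzero h0
      simp only [hv0, zero_mul, zero_add, mul_zero, h0]
      have T2 : Filter.Tendsto (fun s => C₀ * (s - t₀) * decayWeight z.2)
          (nhdsWithin t₀ (Set.Ioi t₀)) (nhds 0) := by
        refine tendsto_nhdsWithin_of_tendsto_nhds ?_
        have : Continuous (fun s => C₀ * (s - t₀) * decayWeight z.2) := by fun_prop
        simpa using this.tendsto t₀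
      have T3 : Filter.Tendsto (fun s => v z.1 s z.2 * (s - t₀)⁻¹)
          (nhdsWithin t₀ (Set.Ioi t₀)) (nhds 0) := by
        refine squeeze_zero' ?_ ?_ T2
        · filter_upwards [hev] with s hs
          exact mul_nonneg (hp.nonneg s (Set.Ioc_subset_Icc_self hs) z.2)
            (inv_nonneg.2 (sub_nonneg.2 hs.1.le))
        · filter_upwards [hev] with s hs
          have := (abs_le.1 (hp.abs_taylor_le (Set.Ioc_subset_Icc_self hs) z.2)).2
          rw [hv0, hvt] at this
          have hσ : 0 < s - t₀ := sub_pos.2 hs.1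
          rw [← div_eq_mul_inv, div_le_iff₀ hσ]
          linarith
      simpa [h0] using T3.mul (tq.sub_const 1)
    · have hpp : 0 < p₀ z.2 := (h.marginal_nonneg z.2).lt_of_ne' h0
      have tσ := (tendsto_nhdsWithin_iff.1 (tendsto_sub_nhdsGT t₀)).1
      have t1 : Filter.Tendsto (fun s => (p₀ z.2 + (s - t₀))⁻¹) (nhdsWithin t₀ (Set.Ioi t₀))
          (nhds (p₀ z.2)⁻¹) := by
        simpa using (tσ.const_add (p₀ z.2)).inv₀ (by simpa using h0)
      have t2 : Filter.Tendsto (fun s => v z.1 s z.2) (nhdsWithin t₀ (Set.Ioi t₀))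
          (nhds (v z.1 t₀ z.2)) :=
        (hp.decaying.hasDerivWithinAt t₀ h.mem_Icc z.2).continuousWithinAt.tendsto.mono_left
          (hI.trans (nhdsWithin_mono _ Set.sdiff_subset))
      have t3 : Filter.Tendsto
          (fun s => (s - t₀)⁻¹ * (Real.log (p₀ z.2 + (s - t₀)) - Real.log (p₀ z.2)))
          (nhdsWithin t₀ (Set.Ioi t₀)) (nhds (p₀ z.2)⁻¹) := by
        have hd := (Real.hasDerivAt_log h0).tendsto_slope_zero
        exact (hd.mono_left (nhdsWithin_mono _ (by
          intro x hx; exact (Set.mem_Ioi.1 hx).ne'))).comp (tendsto_sub_nhdsGT t₀)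
      have := (t3.const_mul (v z.1 t₀ z.2)).add ((t2.mul t1).mul (tq.sub_const 1))
      convert this using 2
      ring

/-- The upper bound for the right derivative of `∫ v log q` over the bundle. -/
theorem eventually_integral_log_sub_le {η : ℝ} (hη : 0 < η) :
    ∀ᶠ s in nhdsWithin t₀ (Set.Ioi t₀),
      (∫ z, v z.1 s z.2 * Real.log (q z.1 s z.2) ∂(volume.restrict A).prod volume)
        - (∫ z, v z.1 t₀ z.2 * Real.log (q z.1 t₀ z.2) ∂(volume.restrict A).prod volume)
      ≤ ((∫ y, pdot y * Real.log (p₀ y))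
        + (∫ z, qt z.1 t₀ z.2 * (v z.1 t₀ z.2 * (p₀ z.2)⁻¹) ∂(volume.restrict A).prod volume) + η)
        * (s - t₀) := by
  have T := ((h.tendsto_integral_sub_mul_log.add h.tendsto_integral_logRemainder).eventually_lt_const
    (lt_add_of_pos_right _ hη))
  filter_upwards [T, Ioc_mem_nhdsGT h.lt] with s hT hs
  have hsI : s ∈ Set.Icc t₀ t₁ := Set.Ioc_subset_Icc_self hs
  have hσ : 0 < s - t₀ := sub_pos.2 hs.1
  set σ := s - t₀ with hσdef
  have i1 : Integrable (fun z : ℝ × (Fin d → ℝ) => (v z.1 s z.2 - v z.1 t₀ z.2)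
      * Real.log (p₀ z.2 + σ)) ((volume.restrict A).prod volume) := by
    simp only [sub_mul]
    exact (h.integrable_sub_mul_log hsI hσ).sub (h.integrable_sub_mul_log h.mem_Icc hσ)
  have key : (∫ z, v z.1 s z.2 * Real.log (q z.1 s z.2) ∂(volume.restrict A).prod volume)
      - (∫ z, v z.1 t₀ z.2 * Real.log (q z.1 t₀ z.2) ∂(volume.restrict A).prod volume)
      ≤ (∫ z, (v z.1 s z.2 - v z.1 t₀ z.2) * Real.log (p₀ z.2 + σ)
          ∂(volume.restrict A).prod volume)
        + σ * ∫ z, logRemainder t₀ v q p₀ s z ∂(volume.restrict A).prod volume := by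
    rw [← integral_sub (h.integrable_log hsI) (h.integrable_log h.mem_Icc), ← integral_const_mul,
      ← integral_add i1 ((h.integrable_logRemainder hs).const_mul σ)]
    refine integral_mono_ae ((h.integrable_log hsI).sub (h.integrable_log h.mem_Icc))
      (i1.add ((h.integrable_logRemainder hs).const_mul σ)) ?_
    filter_upwards [h.ae_mem, h.ae_pos hsI] with z hz hpos
    have hp := h.pair z.1 hz
    have hvs := hp.nonneg s hsI z.2
    have hpσ : 0 < p₀ z.2 + σ := by linarith [h.marginal_nonneg z.2]
    have e : σ * logRemainder t₀ v q p₀ s z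
        = v z.1 t₀ z.2 * (Real.log (p₀ z.2 + σ) - Real.log (p₀ z.2))
          + v z.1 s z.2 * ((p₀ z.2 + σ)⁻¹ * q z.1 s z.2 - 1) := by
      simp only [logRemainder, ← hσdef]
      field_simp
      ring
    -- This is `log x ≤ x - 1` at `x = q / (p₀ + σ)`, the tangent line to the logarithm at the
    -- regularised initial density. It needs `q > 0` where `v > 0`, which holds almost everywhere.
    have e2 : v z.1 s z.2 * Real.log (q z.1 s z.2)
        ≤ v z.1 s z.2 * (Real.log (p₀ z.2 + σ) + ((p₀ z.2 + σ)⁻¹ * q z.1 s z.2 - 1)) := by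
      by_cases h0 : v z.1 s z.2 = 0
      · simp [h0]
      refine mul_le_mul_of_nonneg_left ?_ hvs
      have h1 := Real.log_le_sub_one_of_pos (mul_pos (inv_pos.2 hpσ) (hpos h0))
      rw [Real.log_mul (inv_pos.2 hpσ).ne' (hpos h0).ne', Real.log_inv] at h1
      linarith
    rw [e, h.initial z.1 hz]
    linarith
  refine key.trans ?_
  have := mul_le_mul_of_nonneg_right hT.le hσ.le
  refine le_trans (le_of_eq ?_) this
  field_simp

/-- The right derivative of `∫ v log q` over the bundle. -/
theorem hasDerivWithinAt_integral_log :
    HasDerivWithinAt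
      (fun s => ∫ z, v z.1 s z.2 * Real.log (q z.1 s z.2) ∂(volume.restrict A).prod volume)
      ((∫ y, pdot y * Real.log (p₀ y))
        + ∫ z, qt z.1 t₀ z.2 * (v z.1 t₀ z.2 * (p₀ z.2)⁻¹) ∂(volume.restrict A).prod volume)
      (Set.Ici t₀) t₀ := by
  rw [← hasDerivWithinAt_Ioi_iff_Ici, hasDerivWithinAt_iff_tendsto_slope' (by simp)]
  rw [Metric.tendsto_nhds]
  intro η hη
  filter_upwards [h.eventually_integral_log_sub_ge (half_pos hη),
    h.eventually_integral_log_sub_le (half_pos hη), self_mem_nhdsWithin] with s h1 h2 hs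
  have hσ : 0 < s - t₀ := sub_pos.2 (Set.mem_Ioi.1 hs)
  rw [slope_def_field, Real.dist_eq, abs_lt]
  rw [← le_div_iff₀ hσ] at h1
  rw [← div_le_iff₀ hσ] at h2
  constructor <;> linarith

end IsFokkerPlanckBundle

/-! ### Marginals of functions with bounded support -/

theorem measurePreserving_cons (n : ℕ) :
    MeasurePreserving (fun z : ℝ × (Fin n → ℝ) => (Fin.cons z.1 z.2 : Fin (n + 1) → ℝ))
      volume volume := by
  have e : (fun z : ℝ × (Fin n → ℝ) => (Fin.cons z.1 z.2 : Fin (n + 1) → ℝ))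
      = (MeasurableEquiv.piFinSuccAbove (fun _ : Fin (n + 1) => ℝ) 0).symm := by
    funext z
    simp [MeasurableEquiv.piFinSuccAbove, Fin.insertNthEquiv]
  rw [e]
  exact (volume_preserving_piFinSuccAbove (fun _ : Fin (n + 1) => ℝ) 0).symm

theorem measurableEmbedding_cons (n : ℕ) :
    MeasurableEmbedding (fun z : ℝ × (Fin n → ℝ) => (Fin.cons z.1 z.2 : Fin (n + 1) → ℝ)) := by
  convert (MeasurableEquiv.piFinSuccAbove (fun _ : Fin (n + 1) => ℝ) 0).symm.measurableEmbedding
    using 1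
  funext z
  simp [MeasurableEquiv.piFinSuccAbove, Fin.insertNthEquiv]

theorem integral_cons {n : ℕ} (f : (Fin (n + 1) → ℝ) → ℝ) :
    ∫ z : ℝ × (Fin n → ℝ), f (Fin.cons z.1 z.2) = ∫ x, f x :=
  (measurePreserving_cons n).integral_comp (measurableEmbedding_cons n) f

theorem integrable_cons_iff {n : ℕ} {f : (Fin (n + 1) → ℝ) → ℝ} :
    Integrable (fun z : ℝ × (Fin n → ℝ) => f (Fin.cons z.1 z.2)) ↔ Integrable f :=
  (measurePreserving_cons n).integrable_comp_emb (measurableEmbedding_cons n)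

theorem integral_othersPDF {n : ℕ} {f : (Fin (n + 1) → ℝ) → ℝ} (hf : Integrable f) :
    ∫ y, othersPDF f y = ∫ x, f x := by
  rw [← integral_cons, Measure.volume_eq_prod, integral_prod_symm _ (integrable_cons_iff.2 hf)]
  rfl

theorem abs_le_norm_cons {n : ℕ} (a : ℝ) (y : Fin n → ℝ) :
    |a| ≤ ‖(Fin.cons a y : Fin (n + 1) → ℝ)‖ := by
  simpa using norm_le_pi_norm (Fin.cons a y : Fin (n + 1) → ℝ) 0

section CompactSupport

variable {n : ℕ} {f : (Fin (n + 1) → ℝ) → ℝ} {R M : ℝ}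

theorem integrable_indicator_Icc (R M : ℝ) :
    Integrable ((Set.Icc (-R) R).indicator fun _ : ℝ => M) :=
  (integrableOn_const (by simp)).integrable_indicator measurableSet_Icc

theorem integral_indicator_Icc (hR : 0 ≤ R) (M : ℝ) :
    ∫ a, (Set.Icc (-R) R).indicator (fun _ : ℝ => M) a = 2 * R * M := by
  rw [integral_indicator measurableSet_Icc, setIntegral_const, measureReal_def, Real.volume_Icc,
    ENNReal.toReal_ofReal (by linarith), smul_eq_mul]
  ring

theorem abs_cons_le_indicator (h0 : ∀ x, R < ‖x‖ → f x = 0) (hM : ∀ x, |f x| ≤ M) (a : ℝ)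
    (y : Fin n → ℝ) : |f (Fin.cons a y)| ≤ (Set.Icc (-R) R).indicator (fun _ : ℝ => M) a := by
  by_cases ha : a ∈ Set.Icc (-R) R
  · rw [Set.indicator_of_mem ha]; exact hM _
  · rw [Set.indicator_of_notMem ha, h0, abs_zero]
    refine lt_of_lt_of_le ?_ (abs_le_norm_cons a y)
    by_contra hc
    exact ha (abs_le.1 (not_lt.1 hc))

theorem integrable_slice (hf : Continuous f) (h0 : ∀ x, R < ‖x‖ → f x = 0)
    (hM : ∀ x, |f x| ≤ M) (y : Fin n → ℝ) : Integrable (fun a : ℝ => f (Fin.cons a y)) :=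
  (integrable_indicator_Icc R M).mono'
    (hf.comp (continuous_cons_prod.comp (Continuous.prodMk_left y))).aestronglyMeasurable
    (Filter.Eventually.of_forall fun a => abs_cons_le_indicator h0 hM a y)

theorem abs_othersPDF_le (hR : 0 ≤ R) (hf : Continuous f) (h0 : ∀ x, R < ‖x‖ → f x = 0)
    (hM : ∀ x, |f x| ≤ M) (y : Fin n → ℝ) : |othersPDF f y| ≤ 2 * R * M := by
  rw [← integral_indicator_Icc hR M]
  exact (norm_integral_le_integral_norm _).trans (integral_mono (integrable_slice hf h0 hM y).norm
    (integrable_indicator_Icc R M) fun a => abs_cons_le_indicator h0 hM a y)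

theorem othersPDF_eq_zero (h0 : ∀ x, R < ‖x‖ → f x = 0) {y : Fin n → ℝ} (hy : R < ‖y‖) :
    othersPDF f y = 0 := by
  simp only [othersPDF]
  exact integral_eq_zero_of_ae (Filter.Eventually.of_forall fun a =>
    h0 _ (hy.trans_le (norm_le_norm_cons a y)))

theorem continuous_othersPDF (hf : Continuous f) (h0 : ∀ x, R < ‖x‖ → f x = 0)
    (hM : ∀ x, |f x| ≤ M) : Continuous (othersPDF f) :=
  continuous_of_dominated (bound := (Set.Icc (-R) R).indicator fun _ => M)
    (fun y => (integrable_slice hf h0 hM y).aestronglyMeasurable)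
    (fun y => Filter.Eventually.of_forall fun a => abs_cons_le_indicator h0 hM a y)
    (integrable_indicator_Icc R M)
    (Filter.Eventually.of_forall fun a =>
      hf.comp (continuous_cons_prod.comp (Continuous.prodMk_right a)))

theorem integrable_of_bounded_support {d : ℕ} {f : (Fin d → ℝ) → ℝ} {R M : ℝ}
    (hf : AEStronglyMeasurable f volume) (h0 : ∀ x, R < ‖x‖ → f x = 0) (hM : ∀ x, |f x| ≤ M) :
    Integrable f := by
  have hi : Integrable ((Metric.closedBall (0 : Fin d → ℝ) R).indicator fun _ => M) :=
    (integrableOn_const (isCompact_closedBall _ _).measure_lt_top.ne).integrable_indicator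
      measurableSet_closedBall
  refine hi.mono' hf (Filter.Eventually.of_forall fun y => ?_)
  by_cases hy : y ∈ Metric.closedBall (0 : Fin d → ℝ) R
  · rw [Set.indicator_of_mem hy]; exact hM y
  · rw [Set.indicator_of_notMem hy, h0 y (by simpa using hy), norm_zero]

end CompactSupport

/-! ### The entropy of the marginal and its derivative -/

theorem abs_sub_sub_mul_le {f f' : ℝ → ℝ} {s κ L : ℝ}
    (hf : ∀ r, |r - s| ≤ κ → HasDerivAt f (f' r) r)
    (hL : ∀ r, |r - s| ≤ κ → |f' r - f' s| ≤ L * |r - s|) (hL0 : 0 ≤ L) {r : ℝ}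
    (hr : |r - s| ≤ κ) : |f r - f s - f' s * (r - s)| ≤ L * (r - s) ^ 2 := by
  set e := |r - s|
  have hmem : ∀ x ∈ Set.Icc (s - e) (s + e), |x - s| ≤ e := fun x hx =>
    abs_le.2 ⟨by linarith [hx.1], by linarith [hx.2]⟩
  have he : 0 ≤ e := abs_nonneg _
  have := Convex.norm_image_sub_le_of_norm_hasDerivWithin_le (C := L * e)
    (f := fun x => f x - f' s * x) (f' := fun x => f' x - f' s) (s := Set.Icc (s - e) (s + e))
    (x := s) (y := r)
    (fun x hx => ((hf x ((hmem x hx).trans hr)).sub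
      (((hasDerivAt_id x).const_mul (f' s)).congr_deriv (mul_one _))).hasDerivWithinAt)
    (fun x hx => (hL x ((hmem x hx).trans hr)).trans (mul_le_mul_of_nonneg_left (hmem x hx) hL0))
    (convex_Icc _ _) ⟨by linarith, by linarith⟩
    ⟨by linarith [neg_abs_le (r - s)], by linarith [le_abs_self (r - s)]⟩
  rw [Real.norm_eq_abs, Real.norm_eq_abs, mul_assoc, abs_mul_abs_self] at this
  rw [sq]
  convert this using 2
  ring

/-- The derivative of a nonnegative function is controlled by the function. -/
theorem sq_deriv_le {f f' : ℝ → ℝ} {s κ L : ℝ} (hκ : 0 < κ)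
    (hf : ∀ r, |r - s| ≤ κ → HasDerivAt f (f' r) r)
    (hL : ∀ r, |r - s| ≤ κ → |f' r - f' s| ≤ L * |r - s|) (hL0 : 0 ≤ L)
    (h0 : ∀ r, |r - s| ≤ κ → 0 ≤ f r) : f' s ^ 2 ≤ 2 * f s * (2 * L + |f' s| / κ) := by
  refine sq_le_of_quadratic_nonneg hκ (by linarith) fun h hh => ?_
  have e : (s + h) - s = h := by ring
  have h1 := (abs_le.1 (abs_sub_sub_mul_le hf hL hL0 (r := s + h) (by rwa [e]))).2
  have h2 := h0 (s + h) (by rwa [e])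
  rw [e] at h1
  linarith

/-- Away from zeros this is the chain rule. At a zero `f` is of second order, so in `f log f = 2 √f
· (√f log √f)` the first root is `O(|r - s|)` and the bracket tends to zero. -/
theorem hasDerivAt_mul_log {f : ℝ → ℝ} {s f' c : ℝ} (hf : HasDerivAt f f' s)
    (h0 : ∀ᶠ r in nhds s, 0 ≤ f r) (hz : f s = 0 → ∀ᶠ r in nhds s, f r ≤ c * (r - s) ^ 2)
    (hz' : f s = 0 → f' = 0) :
    HasDerivAt (fun r => f r * Real.log (f r)) (f' * (Real.log (f s) + 1)) s := by
  by_cases hs : f s = 0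
  · rw [hz' hs, zero_mul, hasDerivAt_iff_isLittleO]
    have hc : Continuous fun x : ℝ => √x * Real.log √x :=
      Real.continuous_mul_log.comp Real.continuous_sqrt
    have t1 : Filter.Tendsto (fun r => √(f r) * Real.log √(f r)) (nhds s) (nhds 0) := by
      have := (hc.tendsto (f s)).comp hf.continuousAt.tendsto
      simpa [hs, Function.comp_def] using this
    have o1 : (fun r => √(f r) * Real.log √(f r)) =o[nhds s] (fun _ => (1 : ℝ)) :=
      (Asymptotics.isLittleO_one_iff ℝ).2 t1
    have o2 : (fun r => √(f r)) =O[nhds s] (fun r => r - s) := by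
      refine Asymptotics.IsBigO.of_bound √|c| ?_
      filter_upwards [hz hs] with r hr
      rw [Real.norm_eq_abs, abs_of_nonneg (Real.sqrt_nonneg _), Real.norm_eq_abs,
        ← Real.sqrt_sq_eq_abs (r - s), ← Real.sqrt_mul (abs_nonneg c)]
      exact Real.sqrt_le_sqrt (hr.trans (mul_le_mul_of_nonneg_right (le_abs_self c) (sq_nonneg _)))
    have o3 := (o2.mul_isLittleO o1).const_mul_left 2
    simp only [mul_one] at o3
    refine o3.congr' ?_ (Filter.EventuallyEq.rfl)
    filter_upwards [h0] with r hr
    simp only [hs, zero_mul, smul_zero, sub_zero]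
    rw [Real.log_sqrt hr]
    have := Real.mul_self_sqrt hr
    linear_combination (Real.log (f r)) * this
  · refine (hf.mul (hf.log hs)).congr_deriv ?_
    field_simp

/-- A family of probability densities, for times near `t`, with common compact support. -/
structure IsCompactDensityFamily {n : ℕ} (K : ℕ → ℝ) (R t κ : ℝ)
    (ρ ρt : ℝ → (Fin (n + 1) → ℝ) → ℝ) : Prop where
  radius_nonneg : 0 ≤ R
  pos : 0 < κ
  decaying : IsDecayingFamily K (t - 2 * κ) (t + 2 * κ) ρ ρt
  nonneg : ∀ s ∈ Set.Icc (t - 2 * κ) (t + 2 * κ), ∀ x, 0 ≤ ρ s x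
  eq_zero : ∀ s ∈ Set.Icc (t - 2 * κ) (t + 2 * κ), ∀ x, R < ‖x‖ → ρ s x = 0
  integral_eq_one : ∀ s ∈ Set.Icc (t - 2 * κ) (t + 2 * κ), ∫ x, ρ s x = 1

namespace IsCompactDensityFamily

variable {n : ℕ} {K : ℕ → ℝ} {R t κ : ℝ} {ρ ρt : ℝ → (Fin (n + 1) → ℝ) → ℝ}
  (h : IsCompactDensityFamily K R t κ ρ ρt)

include h

theorem self_mem : t ∈ Set.Icc (t - 2 * κ) (t + 2 * κ) :=
  ⟨by linarith [h.pos], by linarith [h.pos]⟩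

theorem const_nonneg : 0 ≤ K 0 :=
  h.decaying.const_nonneg (by linarith [h.pos]) 0

theorem abs_le {s : ℝ} (hs : s ∈ Set.Icc (t - 2 * κ) (t + 2 * κ)) (x : Fin (n + 1) → ℝ) :
    |ρ s x| ≤ K 0 := by
  simpa using h.decaying.bound 0 s hs x

theorem abs_deriv_le {s : ℝ} (hs : s ∈ Set.Icc (t - 2 * κ) (t + 2 * κ)) (x : Fin (n + 1) → ℝ) :
    |ρt s x| ≤ K 0 := by
  simpa using h.decaying.bound_deriv 0 s hs x

theorem abs_deriv_sub_le {s r : ℝ} (hs : s ∈ Set.Icc (t - 2 * κ) (t + 2 * κ))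
    (hr : r ∈ Set.Icc (t - 2 * κ) (t + 2 * κ)) (x : Fin (n + 1) → ℝ) :
    |ρt s x - ρt r x| ≤ K 0 * |s - r| := by
  simpa using h.decaying.lipschitz_deriv 0 s hs r hr x

theorem deriv_eq_zero {s : ℝ} (hs : s ∈ Set.Icc (t - 2 * κ) (t + 2 * κ)) (x : Fin (n + 1) → ℝ)
    (hx : R < ‖x‖) : ρt s x = 0 := by
  have h1 := h.decaying.hasDerivWithinAt s hs x
  have h2 : HasDerivWithinAt (fun s => ρ s x) 0 (Set.Icc (t - 2 * κ) (t + 2 * κ)) s :=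
    (hasDerivWithinAt_const s _ (0 : ℝ)).congr (fun r hr => h.eq_zero r hr x hx)
      (h.eq_zero s hs x hx)
  exact (uniqueDiffOn_Icc (by linarith [h.pos]) s hs).eq_deriv _ h1 h2

theorem continuous {s : ℝ} (hs : s ∈ Set.Icc (t - 2 * κ) (t + 2 * κ)) : Continuous (ρ s) :=
  (h.decaying.contDiff s hs).continuous

theorem continuous_deriv {s : ℝ} (hs : s ∈ Set.Icc (t - 2 * κ) (t + 2 * κ)) :
    Continuous (ρt s) :=
  continuousOn_univ.1 (h.decaying.continuousOn_deriv.comp (f := fun x => (s, x)) (by fun_prop)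
    fun x _ => ⟨hs, trivial⟩)

theorem hasDerivAt {s : ℝ} (hs : s ∈ Set.Ioo (t - 2 * κ) (t + 2 * κ)) (x : Fin (n + 1) → ℝ) :
    HasDerivAt (fun s => ρ s x) (ρt s x) s :=
  (h.decaying.hasDerivWithinAt s (Set.Ioo_subset_Icc_self hs) x).hasDerivAt
    (Icc_mem_nhds hs.1 hs.2)

theorem hasDerivAt_othersPDF {s : ℝ} (hs : s ∈ Set.Ioo (t - 2 * κ) (t + 2 * κ)) (y : Fin n → ℝ) :
    HasDerivAt (fun s => othersPDF (ρ s) y) (othersPDF (ρt s) y) s := by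
  have hsub := fun {r} (hr : r ∈ Set.Ioo (t - 2 * κ) (t + 2 * κ)) => Set.Ioo_subset_Icc_self hr
  refine (hasDerivAt_integral_of_dominated_loc_of_deriv_le (μ := volume)
    (F := fun s a => ρ s (Fin.cons a y)) (F' := fun s a => ρt s (Fin.cons a y)) (x₀ := s)
    (s := Set.Ioo (t - 2 * κ) (t + 2 * κ)) (bound := (Set.Icc (-R) R).indicator fun _ => K 0)
    (isOpen_Ioo.mem_nhds hs) ?_
    (integrable_slice (h.continuous (hsub hs)) (h.eq_zero s (hsub hs)) (h.abs_le (hsub hs)) y)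
    (integrable_slice (h.continuous_deriv (hsub hs)) (h.deriv_eq_zero (hsub hs))
      (h.abs_deriv_le (hsub hs)) y).aestronglyMeasurable ?_ (integrable_indicator_Icc R (K 0)) ?_).2
  · filter_upwards [isOpen_Ioo.mem_nhds hs] with r hr
    exact (integrable_slice (h.continuous (hsub hr)) (h.eq_zero r (hsub hr)) (h.abs_le (hsub hr))
      y).aestronglyMeasurable
  · exact Filter.Eventually.of_forall fun a r hr =>
      abs_cons_le_indicator (h.deriv_eq_zero (hsub hr)) (h.abs_deriv_le (hsub hr)) a y
  · exact Filter.Eventually.of_forall fun a r hr => h.hasDerivAt hr _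

theorem abs_othersPDF_deriv_sub_le {s r : ℝ} (hs : s ∈ Set.Icc (t - 2 * κ) (t + 2 * κ))
    (hr : r ∈ Set.Icc (t - 2 * κ) (t + 2 * κ)) (y : Fin n → ℝ) :
    |othersPDF (ρt s) y - othersPDF (ρt r) y| ≤ 2 * R * K 0 * |s - r| := by
  have e : othersPDF (ρt s) y - othersPDF (ρt r) y = othersPDF (fun x => ρt s x - ρt r x) y :=
    (integral_sub (integrable_slice (h.continuous_deriv hs) (h.deriv_eq_zero hs)
      (h.abs_deriv_le hs) y) (integrable_slice (h.continuous_deriv hr) (h.deriv_eq_zero hr)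
      (h.abs_deriv_le hr) y)).symm
  rw [e, mul_assoc]
  exact abs_othersPDF_le h.radius_nonneg ((h.continuous_deriv hs).sub (h.continuous_deriv hr))
    (fun x hx => by
      rw [Pi.sub_apply, h.deriv_eq_zero hs x hx, h.deriv_eq_zero hr x hx, sub_zero])
    (h.abs_deriv_sub_le hs hr) y

theorem othersPDF_nonneg {s : ℝ} (hs : s ∈ Set.Icc (t - 2 * κ) (t + 2 * κ)) (y : Fin n → ℝ) :
    0 ≤ othersPDF (ρ s) y :=
  integral_nonneg fun _ => h.nonneg s hs _

/-- The marginal is nonnegative on both sides of `s` with a Lipschitz time derivative, so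
`sq_deriv_le` applies on `[s - κ, s + κ]`. The family is given on an interval of twice this radius
to leave that room. Here it matters that `t` is an interior time for `ρ`. -/
theorem sq_othersPDF_deriv_le {s : ℝ} (hs : |s - t| < κ) (y : Fin n → ℝ) :
    othersPDF (ρt s) y ^ 2 ≤ 2 * (2 * (2 * R * K 0) + 2 * R * K 0 / κ) * othersPDF (ρ s) y := by
  have hκ := h.pos
  have hmem : ∀ r, |r - s| ≤ κ → r ∈ Set.Ioo (t - 2 * κ) (t + 2 * κ) := fun r hr => by
    obtain ⟨h1, h2⟩ := _root_.abs_le.1 hr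
    obtain ⟨h3, h4⟩ := abs_lt.1 hs
    exact ⟨by linarith, by linarith⟩
  have hs' := hmem s (by simpa using hκ.le)
  have hsI := Set.Ioo_subset_Icc_self hs'
  have hL0 : 0 ≤ 2 * R * K 0 := mul_nonneg (by linarith [h.radius_nonneg]) h.const_nonneg
  have h1 := sq_deriv_le (f := fun s => othersPDF (ρ s) y) (f' := fun s => othersPDF (ρt s) y) hκ
    (fun r hr => h.hasDerivAt_othersPDF (hmem r hr) y)
    (fun r hr => h.abs_othersPDF_deriv_sub_le (Set.Ioo_subset_Icc_self (hmem r hr)) hsI y) hL0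
    (fun r hr => h.othersPDF_nonneg (Set.Ioo_subset_Icc_self (hmem r hr)) y)
  refine h1.trans ?_
  have h2 := abs_othersPDF_le h.radius_nonneg (h.continuous_deriv hsI) (h.deriv_eq_zero hsI)
    (h.abs_deriv_le hsI) y
  have h3 := h.othersPDF_nonneg hsI y
  calc _ ≤ 2 * othersPDF (ρ s) y * (2 * (2 * R * K 0) + 2 * R * K 0 / κ) := by gcongr
    _ = _ := by ring

theorem hasDerivAt_othersPDF_mul_log {s : ℝ} (hs : |s - t| < κ) (y : Fin n → ℝ) :
    HasDerivAt (fun s => othersPDF (ρ s) y * Real.log (othersPDF (ρ s) y))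
      (othersPDF (ρt s) y * (Real.log (othersPDF (ρ s) y) + 1)) s := by
  have hκ := h.pos
  have hmem : ∀ r, |r - s| ≤ κ → r ∈ Set.Ioo (t - 2 * κ) (t + 2 * κ) := fun r hr => by
    obtain ⟨h1, h2⟩ := _root_.abs_le.1 hr
    obtain ⟨h3, h4⟩ := abs_lt.1 hs
    exact ⟨by linarith, by linarith⟩
  have hs' := hmem s (by simpa using hκ.le)
  have hsI := Set.Ioo_subset_Icc_self hs'
  have hL0 : 0 ≤ 2 * R * K 0 := mul_nonneg (by linarith [h.radius_nonneg]) h.const_nonneg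
  have hev : ∀ᶠ r in nhds s, |r - s| ≤ κ := by
    filter_upwards [Metric.ball_mem_nhds s hκ] with r hr using (Metric.mem_ball.1 hr).le
  have hz' : othersPDF (ρ s) y = 0 → othersPDF (ρt s) y = 0 := fun h0 => by
    have := h.sq_othersPDF_deriv_le hs y
    rw [h0, mul_zero] at this
    exact pow_eq_zero_iff two_ne_zero |>.1 (le_antisymm this (sq_nonneg _))
  refine hasDerivAt_mul_log (c := 2 * R * K 0) (h.hasDerivAt_othersPDF hs' y) ?_ (fun h0 => ?_) hz'
  · filter_upwards [hev] with r hr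
      using h.othersPDF_nonneg (Set.Ioo_subset_Icc_self (hmem r hr)) y
  · filter_upwards [hev] with r hr
    have := abs_sub_sub_mul_le (f := fun s => othersPDF (ρ s) y)
      (f' := fun s => othersPDF (ρt s) y) (fun r hr => h.hasDerivAt_othersPDF (hmem r hr) y)
      (fun r hr => h.abs_othersPDF_deriv_sub_le (Set.Ioo_subset_Icc_self (hmem r hr)) hsI y) hL0 hr
    simp only [h0, hz' h0, zero_mul, sub_zero] at this
    exact (le_abs_self _).trans this

theorem integrable_othersPDF_mul_log {s : ℝ} (hs : s ∈ Set.Icc (t - 2 * κ) (t + 2 * κ)) :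
    Integrable (fun y : Fin n → ℝ => othersPDF (ρ s) y * Real.log (othersPDF (ρ s) y)) := by
  have hc := continuous_othersPDF (h.continuous hs) (h.eq_zero s hs) (h.abs_le hs)
  refine ((Real.continuous_mul_log.comp hc).integrable_of_hasCompactSupport ?_)
  refine HasCompactSupport.intro (isCompact_closedBall (0 : Fin n → ℝ) R) fun y hy => ?_
  simp [othersPDF_eq_zero (h.eq_zero s hs) (y := y) (by simpa using hy)]

theorem integral_othersPDF_deriv : ∫ y, othersPDF (ρt t) y = 0 := by
  have hκ := h.pos
  have ht : t ∈ Set.Ioo (t - 2 * κ) (t + 2 * κ) := ⟨by linarith, by linarith⟩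
  have hsub := fun {r} (hr : r ∈ Set.Ioo (t - 2 * κ) (t + 2 * κ)) => Set.Ioo_subset_Icc_self hr
  have hi : ∀ {s}, s ∈ Set.Icc (t - 2 * κ) (t + 2 * κ) → Integrable (ρ s) := fun hs =>
    integrable_of_bounded_support (h.continuous hs).aestronglyMeasurable (h.eq_zero _ hs)
      (h.abs_le hs)
  have hit : Integrable (ρt t) :=
    integrable_of_bounded_support (h.continuous_deriv h.self_mem).aestronglyMeasurable
      (h.deriv_eq_zero h.self_mem) (h.abs_deriv_le h.self_mem)
  rw [integral_othersPDF hit]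
  have hi0 : Integrable ((Metric.closedBall (0 : Fin (n + 1) → ℝ) R).indicator fun _ => K 0) :=
    (integrableOn_const (isCompact_closedBall _ _).measure_lt_top.ne).integrable_indicator
      measurableSet_closedBall
  have h1 := (hasDerivAt_integral_of_dominated_loc_of_deriv_le (μ := volume)
    (F := fun s x => ρ s x) (F' := fun s x => ρt s x) (x₀ := t)
    (s := Set.Ioo (t - 2 * κ) (t + 2 * κ))
    (isOpen_Ioo.mem_nhds ht)
    (Filter.mem_of_superset (isOpen_Ioo.mem_nhds ht) fun r hr => (hi (hsub hr)).aestronglyMeasurable)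
    (hi h.self_mem) hit.aestronglyMeasurable
    (Filter.Eventually.of_forall fun x r hr => ?_) hi0
    (Filter.Eventually.of_forall fun x r hr => h.hasDerivAt hr x)).2
  · have h2 : HasDerivAt (fun s => ∫ x, ρ s x) 0 t := by
      refine (hasDerivAt_const t (1 : ℝ)).congr_of_eventuallyEq ?_
      filter_upwards [isOpen_Ioo.mem_nhds ht] with r hr using h.integral_eq_one r (hsub hr)
    exact h1.unique h2
  · by_cases hx : x ∈ Metric.closedBall (0 : Fin (n + 1) → ℝ) R
    · rw [Set.indicator_of_mem hx]; exact h.abs_deriv_le (hsub hr) x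
    · rw [Set.indicator_of_notMem hx, h.deriv_eq_zero (hsub hr) x (by simpa using hx), norm_zero]

/-- The rate of change of the entropy of the marginal. -/
theorem hasDerivAt_othersEntropy :
    HasDerivAt (othersEntropy ρ)
      (-∫ y, othersPDF (ρt t) y * Real.log (othersPDF (ρ t) y)) t := by
  have hκ := h.pos
  have hR := h.radius_nonneg
  set C := 2 * (2 * (2 * R * K 0) + 2 * R * K 0 / κ) with hC
  have hL0 : 0 ≤ 2 * R * K 0 := mul_nonneg (by linarith [h.radius_nonneg]) h.const_nonneg
  have hC0 : 0 ≤ C := by positivity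
  obtain ⟨N, hN0, hN⟩ := exists_sqrt_mul_abs_log_le (2 * R * K 0)
  have hmem : ∀ {s}, s ∈ Metric.ball t κ → s ∈ Set.Icc (t - 2 * κ) (t + 2 * κ) := fun hs =>
    Set.Ioo_subset_Icc_self (by
      rw [Real.ball_eq_Ioo] at hs
      exact ⟨by linarith [hs.1], by linarith [hs.2]⟩)
  have htb : t ∈ Metric.ball t κ := Metric.mem_ball_self hκ
  -- The logarithm is unbounded near zeros of the marginal; the square root bound on the time
  -- derivative compensates for it uniformly in time.
  have hbound : ∀ s ∈ Metric.ball t κ, ∀ y : Fin n → ℝ,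
      ‖othersPDF (ρt s) y * (Real.log (othersPDF (ρ s) y) + 1)‖
        ≤ (Metric.closedBall (0 : Fin n → ℝ) R).indicator (fun _ => √C * N + 2 * R * K 0) y := by
    intro s hs y
    have hsI := hmem hs
    by_cases hy : y ∈ Metric.closedBall (0 : Fin n → ℝ) R
    · rw [Set.indicator_of_mem hy, mul_add, mul_one]
      refine (norm_add_le _ _).trans (add_le_add ?_ (abs_othersPDF_le hR (h.continuous_deriv hsI)
        (h.deriv_eq_zero hsI) (h.abs_deriv_le hsI) y))
      have h1 : |othersPDF (ρt s) y| ≤ √C * √(othersPDF (ρ s) y) := by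
        rw [← Real.sqrt_mul hC0]
        exact Real.abs_le_sqrt (h.sq_othersPDF_deriv_le (Metric.mem_ball.1 hs) y)
      rw [Real.norm_eq_abs, abs_mul]
      calc _ ≤ √C * √(othersPDF (ρ s) y) * |Real.log (othersPDF (ρ s) y)| :=
            mul_le_mul_of_nonneg_right h1 (abs_nonneg _)
        _ ≤ _ := by
          rw [mul_assoc]
          refine mul_le_mul_of_nonneg_left (hN _ (h.othersPDF_nonneg hsI y) ?_) (Real.sqrt_nonneg _)
          exact (le_abs_self _).trans
            (abs_othersPDF_le hR (h.continuous hsI) (h.eq_zero s hsI) (h.abs_le hsI) y)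
    · rw [Set.indicator_of_notMem hy,
        othersPDF_eq_zero (h.deriv_eq_zero hsI) (by simpa using hy), zero_mul, norm_zero]
  have hi0 : Integrable ((Metric.closedBall (0 : Fin n → ℝ) R).indicator
      fun _ => √C * N + 2 * R * K 0) :=
    (integrableOn_const (isCompact_closedBall _ _).measure_lt_top.ne).integrable_indicator
      measurableSet_closedBall
  have cd := continuous_othersPDF (h.continuous_deriv h.self_mem) (h.deriv_eq_zero h.self_mem)
    (h.abs_deriv_le h.self_mem)
  have c0 := continuous_othersPDF (h.continuous h.self_mem) (h.eq_zero t h.self_mem)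
    (h.abs_le h.self_mem)
  have hder := (hasDerivAt_integral_of_dominated_loc_of_deriv_le (μ := volume)
    (F := fun s (y : Fin n → ℝ) => othersPDF (ρ s) y * Real.log (othersPDF (ρ s) y))
    (F' := fun s y => othersPDF (ρt s) y * (Real.log (othersPDF (ρ s) y) + 1)) (x₀ := t)
    (Metric.ball_mem_nhds t hκ)
    (Filter.mem_of_superset (Metric.ball_mem_nhds t hκ) fun r hr =>
      (h.integrable_othersPDF_mul_log (hmem hr)).aestronglyMeasurable)
    (h.integrable_othersPDF_mul_log h.self_mem)
    (cd.measurable.mul (c0.measurable.log.add_const 1)).aestronglyMeasurable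
    (Filter.Eventually.of_forall fun y r hr => hbound r hr y) hi0
    (Filter.Eventually.of_forall fun y r hr =>
      h.hasDerivAt_othersPDF_mul_log (Metric.mem_ball.1 hr) y))
  have i1 : Integrable (othersPDF (ρt t)) :=
    integrable_of_bounded_support cd.aestronglyMeasurable
      (fun y hy => othersPDF_eq_zero (h.deriv_eq_zero h.self_mem) hy)
      (abs_othersPDF_le hR (h.continuous_deriv h.self_mem) (h.deriv_eq_zero h.self_mem)
        (h.abs_deriv_le h.self_mem))
  have i2 : Integrable (fun y => othersPDF (ρt t) y * Real.log (othersPDF (ρ t) y)) := by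
    refine (hder.1.sub i1).congr (Filter.Eventually.of_forall fun y => ?_)
    simp only [Pi.sub_apply]; ring
  -- The summand `1` from differentiating `z log z` contributes the derivative of the total mass,
  -- which is zero.
  have e : ∫ y, othersPDF (ρt t) y * (Real.log (othersPDF (ρ t) y) + 1)
      = ∫ y, othersPDF (ρt t) y * Real.log (othersPDF (ρ t) y) := by
    simp only [mul_add, mul_one]
    rw [integral_add i2 i1, h.integral_othersPDF_deriv, add_zero]
  rw [← e]
  exact hder.2.neg

end IsCompactDensityFamily

/-- The derivatives are continuous up to the boundary of the slab, hence bounded with any weight on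
a compact set, and they vanish outside it. -/
theorem exists_isRapidlyDecreasing_of_eq_zero {d : ℕ} {a b R : ℝ} (hab : a < b)
    {w : ℝ → (Fin d → ℝ) → ℝ}
    (hw : ContDiffOn ℝ 2 (fun z : ℝ × (Fin d → ℝ) => w z.1 z.2) (Set.Icc a b ×ˢ Set.univ))
    (h0 : ∀ s ∈ Set.Icc a b, ∀ x, R < ‖x‖ → w s x = 0) : ∃ C, IsRapidlyDecreasing C a b w := by
  set W := fun z : ℝ × (Fin d → ℝ) => w z.1 z.2
  set S := Set.Icc a b ×ˢ (Set.univ : Set (Fin d → ℝ))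
  have hcomp : IsCompact (Set.Icc a b ×ˢ Metric.closedBall (0 : Fin d → ℝ) R) :=
    isCompact_Icc.prod (isCompact_closedBall _ _)
  have key : ∀ N k : ℕ, ∃ C, k ≤ 2 → ∀ s ∈ Set.Icc a b, ∀ y,
      (1 + ‖y‖) ^ N * ‖iteratedFDerivWithin ℝ k W S (s, y)‖ ≤ C := by
    intro N k
    by_cases hk : k ≤ 2
    · have hc : ContinuousOn (fun z : ℝ × (Fin d → ℝ) =>
          (1 + ‖z.2‖) ^ N * ‖iteratedFDerivWithin ℝ k W S z‖) S := by
        refine ContinuousOn.mul (by fun_prop) (ContinuousOn.norm ?_)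
        exact hw.continuousOn_iteratedFDerivWithin (by exact_mod_cast hk)
          (uniqueDiffOn_Icc_prod_univ hab)
      obtain ⟨C, hC⟩ := hcomp.exists_bound_of_continuousOn
        (hc.mono (Set.prod_mono le_rfl (Set.subset_univ _)))
      refine ⟨max C 0, fun _ s hs y => ?_⟩
      by_cases hy : y ∈ Metric.closedBall (0 : Fin d → ℝ) R
      · exact (le_abs_self _).trans ((hC (s, y) ⟨hs, hy⟩).trans (le_max_left _ _))
      · have hE : W =ᶠ[nhdsWithin (s, y) S] fun _ => 0 := by
          have hopen : IsOpen {z : ℝ × (Fin d → ℝ) | R < ‖z.2‖} :=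
            isOpen_lt continuous_const (by fun_prop)
          filter_upwards [self_mem_nhdsWithin,
            mem_nhdsWithin_of_mem_nhds (hopen.mem_nhds (x := (s, y)) (by simpa using hy))]
            with z hz hz2 using h0 z.1 hz.1 z.2 hz2
        rw [hE.iteratedFDerivWithin_eq (hE.self_of_nhdsWithin ⟨hs, trivial⟩) k]
        have : iteratedFDerivWithin ℝ k (fun _ : ℝ × (Fin d → ℝ) => (0 : ℝ)) S (s, y) = 0 := by
          simp
        rw [this, norm_zero, mul_zero]
        exact le_max_right _ _
    · exact ⟨0, fun h => absurd h hk⟩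
  choose C hC using key
  refine ⟨fun N => max (C N 0) (max (C N 1) (C N 2)), hw, fun N k hk s hs y =>
    (hC N k hk s hs y).trans ?_⟩
  interval_cases k <;> simp

/-! ### Operators of the frozen system and of its slices -/

section Frozen

variable {n m : ℕ} {F : ℝ → (Fin (n + 1) → ℝ) → Fin (n + 1) → ℝ}
  {B : ℝ → (Fin (n + 1) → ℝ) → Fin (n + 1) → Fin m → ℝ}

theorem contDiff_frozenDrift {k : WithTop ℕ∞}
    (hF : ContDiff ℝ k (fun z : ℝ × (Fin (n + 1) → ℝ) => F z.1 z.2)) :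
    ContDiff ℝ k (fun z : ℝ × (Fin (n + 1) → ℝ) => frozenDrift F z.1 z.2) := by
  refine contDiff_pi.2 fun i => ?_
  refine Fin.cases ?_ (fun j => ?_) i
  · exact contDiff_const (c := (0 : ℝ))
  · exact (contDiff_pi.1 hF) j.succ

theorem contDiff_frozenNoise {k : WithTop ℕ∞}
    (hB : ContDiff ℝ k (fun z : ℝ × (Fin (n + 1) → ℝ) => B z.1 z.2)) :
    ContDiff ℝ k (fun z : ℝ × (Fin (n + 1) → ℝ) => frozenNoise B z.1 z.2) := by
  refine contDiff_pi.2 fun i => ?_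
  refine Fin.cases ?_ (fun j => ?_) i
  · exact contDiff_const (c := (0 : Fin m → ℝ))
  · exact (contDiff_pi.1 hB) j.succ

theorem contDiff_paramDrift {k : WithTop ℕ∞}
    (hF : ContDiff ℝ k (fun z : ℝ × (Fin (n + 1) → ℝ) => F z.1 z.2)) (a : ℝ) :
    ContDiff ℝ k (fun z : ℝ × (Fin n → ℝ) => paramDrift F a z.1 z.2) :=
  contDiff_pi.2 fun i => ((contDiff_pi.1 hF) i.succ).comp
    (contDiff_fst.prodMk ((contDiff_cons a).comp contDiff_snd))

theorem contDiff_paramNoise {k : WithTop ℕ∞}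
    (hB : ContDiff ℝ k (fun z : ℝ × (Fin (n + 1) → ℝ) => B z.1 z.2)) (a : ℝ) :
    ContDiff ℝ k (fun z : ℝ × (Fin n → ℝ) => paramNoise B a z.1 z.2) :=
  contDiff_pi.2 fun i => ((contDiff_pi.1 hB) i.succ).comp
    (contDiff_fst.prodMk ((contDiff_cons a).comp contDiff_snd))

theorem diffusionMatrix_frozenNoise_zero_left (s : ℝ) (x : Fin (n + 1) → ℝ) (j : Fin (n + 1)) :
    diffusionMatrix (frozenNoise B) s x 0 j = 0 := by
  simp [diffusionMatrix, frozenNoise]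

theorem diffusionMatrix_frozenNoise_zero_right (s : ℝ) (x : Fin (n + 1) → ℝ) (i : Fin (n + 1)) :
    diffusionMatrix (frozenNoise B) s x i 0 = 0 := by
  simp [diffusionMatrix, frozenNoise]

theorem diffusionMatrix_frozenNoise_succ (s : ℝ) (x : Fin (n + 1) → ℝ) (i j : Fin n) :
    diffusionMatrix (frozenNoise B) s x i.succ j.succ = diffusionMatrix B s x i.succ j.succ := by
  simp [diffusionMatrix, frozenNoise]

theorem frozenDrift_zero (s : ℝ) (x : Fin (n + 1) → ℝ) : frozenDrift F s x 0 = 0 := rfl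

theorem frozenDrift_succ (s : ℝ) (x : Fin (n + 1) → ℝ) (i : Fin n) :
    frozenDrift F s x i.succ = F s x i.succ := rfl

theorem partialD_fun_zero {d : ℕ} (i : Fin d) :
    partialD i (fun _ : Fin d → ℝ => (0 : ℝ)) = fun _ => 0 :=
  funext fun _ => partialD_const 0

theorem fokkerPlanck_frozen (s : ℝ) (w : (Fin (n + 1) → ℝ) → ℝ) (x : Fin (n + 1) → ℝ) :
    fokkerPlanck (frozenDrift F) (frozenNoise B) s w x
      = -(∑ i : Fin n, partialD i.succ (fun z => F s z i.succ * w z) x)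
        + (1 / 2) * ∑ i : Fin n, ∑ j : Fin n, partialD i.succ (partialD j.succ
          (fun z => diffusionMatrix B s z i.succ j.succ * w z)) x := by
  simp only [fokkerPlanck, Fin.sum_univ_succ, frozenDrift_zero, frozenDrift_succ,
    diffusionMatrix_frozenNoise_zero_left, diffusionMatrix_frozenNoise_zero_right,
    diffusionMatrix_frozenNoise_succ, zero_mul, partialD_fun_zero, Finset.sum_const_zero, zero_add]

/-- With zero drift and noise in the first component, the operator contains no derivative in `x₁`,
so it commutes with restriction to a slice. Slices of the frozen density therefore solve the
equation of the system with parameter `a`. -/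
theorem fokkerPlanck_frozen_cons {s : ℝ} (hF : ContDiff ℝ 1 (F s)) (hB : ContDiff ℝ 2 (B s))
    {w : (Fin (n + 1) → ℝ) → ℝ} (hw : ContDiff ℝ 2 w) (a : ℝ) (y : Fin n → ℝ) :
    fokkerPlanck (frozenDrift F) (frozenNoise B) s w (Fin.cons a y)
      = fokkerPlanck (paramDrift F a) (paramNoise B a) s (fun y => w (Fin.cons a y)) y := by
  rw [fokkerPlanck_frozen]
  have c2 : ∀ i j : Fin n, ContDiff ℝ 2 (fun z => diffusionMatrix B s z i.succ j.succ * w z) :=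
    fun i j => (contDiff_diffusionMatrix hB i.succ j.succ).mul hw
  have e1 : ∀ i : Fin n, partialD i.succ (fun z => F s z i.succ * w z) (Fin.cons a y)
      = partialD i (fun y => paramDrift F a s y i * w (Fin.cons a y)) y := fun i =>
    (partialD_comp_cons ((((contDiff_pi.1 hF) i.succ).mul
      (hw.of_le one_le_two)).differentiable one_ne_zero _) i).symm
  have e2 : ∀ i j : Fin n, partialD i.succ (partialD j.succ
      (fun z => diffusionMatrix B s z i.succ j.succ * w z)) (Fin.cons a y)
      = partialD i (partialD j
        (fun y => diffusionMatrix (paramNoise B a) s y i j * w (Fin.cons a y))) y := by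
    intro i j
    rw [← partialD_comp_cons (((c2 i j).contDiff_one_partialD j.succ).differentiable one_ne_zero _)]
    congr 1
    funext y
    exact (partialD_comp_cons ((c2 i j).differentiable two_ne_zero _) j).symm
  simp_rw [e1, e2]
  rfl

theorem fokkerPlanck_zero {d m : ℕ} (F : ℝ → (Fin d → ℝ) → Fin d → ℝ)
    (B : ℝ → (Fin d → ℝ) → Fin d → Fin m → ℝ) (s : ℝ) (y : Fin d → ℝ) :
    fokkerPlanck F B s (fun _ => 0) y = 0 := by
  simp [fokkerPlanck, partialD_fun_zero]

/-- All derivatives involving `x₁` vanish, and the remaining coefficients agree. Independence of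
`x₁` is required only near `x`, so that cutoffs in `x₁` are admissible. -/
theorem generator_frozen_eq {f : (Fin (n + 1) → ℝ) → ℝ} {φ : (Fin n → ℝ) → ℝ}
    (hφ : ContDiff ℝ 2 φ) {x : Fin (n + 1) → ℝ}
    (hf : f =ᶠ[nhds x] fun x => φ (Fin.tail x)) (s : ℝ) :
    generator (frozenDrift F) (frozenNoise B) s f x = generator F B s f x := by
  have z1 : ∀ z : Fin (n + 1) → ℝ, partialD 0 (fun x : Fin (n + 1) → ℝ => φ (Fin.tail x)) z = 0 :=
    fun z => partialD_zero_comp_tail (hφ.differentiable two_ne_zero _)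
  have h1 : partialD 0 f x = 0 := by rw [partialD_congr_of_eventuallyEq hf, z1]
  have h2 : ∀ i, partialD i (partialD 0 f) x = 0 := fun i => by
    rw [partialD_congr_of_eventuallyEq (partialD_eventuallyEq hf 0), funext z1]
    exact partialD_const 0
  have h3 : ∀ j : Fin n, partialD 0 (partialD j.succ f) x = 0 := fun j => by
    rw [partialD_congr_of_eventuallyEq (partialD_eventuallyEq hf j.succ),
      show partialD j.succ (fun x : Fin (n + 1) → ℝ => φ (Fin.tail x))
        = fun z => partialD j φ (Fin.tail z) from
        funext fun z => partialD_succ_comp_tail (hφ.differentiable two_ne_zero _) j]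
    exact partialD_zero_comp_tail ((hφ.contDiff_one_partialD j).differentiable one_ne_zero _)
  simp only [generator, Fin.sum_univ_succ, h1, h2, h3, frozenDrift_succ,
    diffusionMatrix_frozenNoise_zero_left, diffusionMatrix_frozenNoise_zero_right,
    diffusionMatrix_frozenNoise_succ, mul_zero]

end Frozen

/-! ### Marginals of the time derivatives, and the range of `x₁` -/

section Marginal

variable {n : ℕ}

theorem Integrable.othersPDF {f : (Fin (n + 1) → ℝ) → ℝ} (hf : Integrable f) :
    Integrable (othersPDF f) :=
  (integrable_cons_iff.2 hf).integral_prod_right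

theorem integral_othersPDF_mul {f : (Fin (n + 1) → ℝ) → ℝ} {φ : (Fin n → ℝ) → ℝ}
    (hf : Integrable (fun x => f x * φ (Fin.tail x))) :
    ∫ y, othersPDF f y * φ y = ∫ x, f x * φ (Fin.tail x) := by
  rw [← integral_othersPDF hf]
  refine integral_congr_ae (Filter.Eventually.of_forall fun y => ?_)
  simp [othersPDF, integral_mul_const]

/-- If the weak Fokker–Planck equations hold for the full and for the frozen system, then the
marginals of the time derivatives agree. -/
theorem othersPDF_ae_eq_of_weak {m : ℕ} {F : ℝ → (Fin (n + 1) → ℝ) → Fin (n + 1) → ℝ}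
    {B : ℝ → (Fin (n + 1) → ℝ) → Fin (n + 1) → Fin m → ℝ} {s R : ℝ} (hR : 0 ≤ R)
    {w w₁ w₂ : (Fin (n + 1) → ℝ) → ℝ} (hw : ∀ x, R < |x 0| → w x = 0)
    (hw₁ : ∀ x, R < |x 0| → w₁ x = 0) (hw₂ : ∀ x, R < |x 0| → w₂ x = 0)
    (i₁ : Integrable w₁) (i₂ : Integrable w₂)
    (e₁ : ∀ f : (Fin (n + 1) → ℝ) → ℝ, ContDiff ℝ ((⊤ : ℕ∞) : WithTop ℕ∞) f → HasCompactSupport f →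
      ∫ x, w₁ x * f x = ∫ x, w x * generator F B s f x)
    (e₂ : ∀ f : (Fin (n + 1) → ℝ) → ℝ, ContDiff ℝ ((⊤ : ℕ∞) : WithTop ℕ∞) f → HasCompactSupport f →
      ∫ x, w₂ x * f x = ∫ x, w x * generator (frozenDrift F) (frozenNoise B) s f x) :
    othersPDF w₁ =ᵐ[volume] othersPDF w₂ := by
  refine eq_of_forall_integral_mul_eq (Integrable.othersPDF i₁).locallyIntegrable
    (Integrable.othersPDF i₂).locallyIntegrable fun φ hφ hφc => ?_
  -- A function of the tail alone has no compact support. The cutoff in `x₁` equals one up to `R +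
  -- 1`, hence on a neighbourhood of every point with `|x 0| ≤ R`, and `w` vanishes at all others.
  let χ : ContDiffBump (0 : ℝ) := ⟨R + 1, R + 2, by linarith, by linarith⟩
  let f : (Fin (n + 1) → ℝ) → ℝ := fun x => φ (Fin.tail x) * χ (x 0)
  have hχ1 : ∀ r, |r| < R + 1 → χ r = 1 := fun r hr =>
    χ.one_of_mem_closedBall (by simpa using hr.le)
  have hf : ContDiff ℝ ((⊤ : ℕ∞) : WithTop ℕ∞) f :=
    (hφ.comp contDiff_tail).mul (χ.contDiff.comp (contDiff_apply ℝ ℝ 0))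
  have hfc : HasCompactSupport f := by
    refine HasCompactSupport.intro (((isCompact_closedBall (0 : ℝ) (R + 2)).prod hφc).image
      continuous_cons_prod) fun x hx => ?_
    by_contra h0
    obtain ⟨h1, h2⟩ := mul_ne_zero_iff.1 h0
    refine hx ⟨(x 0, Fin.tail x), ⟨?_, subset_tsupport _ h1⟩, Fin.cons_self_tail x⟩
    by_contra h3
    exact h2 (χ.zero_of_le_dist (not_le.1 h3).le)
  have bdd : ∃ M, ∀ y, ‖φ y‖ ≤ M := hφ.continuous.bounded_above_of_compact_support hφc
  obtain ⟨M, hM⟩ := bdd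
  have hint : ∀ {g : (Fin (n + 1) → ℝ) → ℝ}, Integrable g →
      Integrable (fun x => g x * φ (Fin.tail x)) := fun hg =>
    hg.mul_bdd (c := M) (hφ.continuous.comp (contDiff_tail (k := 0)).continuous).aestronglyMeasurable
      (Filter.Eventually.of_forall fun x => hM _)
  have hcut : ∀ {g : (Fin (n + 1) → ℝ) → ℝ}, (∀ x, R < |x 0| → g x = 0) →
      ∀ x, g x * φ (Fin.tail x) = g x * f x := fun {g} hg x => by
    by_cases hx : R < |x 0|
    · rw [hg x hx, zero_mul, zero_mul]
    · simp only [f]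
      rw [hχ1 (x 0) (by linarith [not_lt.1 hx]), mul_one]
  rw [integral_othersPDF_mul (hint i₁), integral_othersPDF_mul (hint i₂)]
  simp_rw [hcut hw₁, hcut hw₂]
  rw [e₁ f hf hfc, e₂ f hf hfc]
  refine integral_congr_ae (Filter.Eventually.of_forall fun x => ?_)
  by_cases hx : R < |x 0|
  · simp only [hw x hx, zero_mul]
  · simp only
    rw [generator_frozen_eq (φ := φ) (contDiff_infty.1 hφ 2)]
    have hopen : IsOpen {z : Fin (n + 1) → ℝ | |z 0| < R + 1} :=
      isOpen_lt (by fun_prop) continuous_const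
    filter_upwards [hopen.mem_nhds (x := x) (show |x 0| < R + 1 by linarith [not_lt.1 hx])]
      with z hz
    simp only [f]
    rw [hχ1 _ hz, mul_one]

theorem isOpen_firstRange {ρ : (Fin (n + 1) → ℝ) → ℝ} (hρ : Continuous ρ) :
    IsOpen (firstRange ρ) := by
  have : firstRange ρ = ⋃ y : Fin n → ℝ, {a | ρ (Fin.cons a y) ≠ 0} := by
    ext a; simp [firstRange]
  rw [this]
  exact isOpen_iUnion fun y => isOpen_ne_fun
    (hρ.comp (continuous_cons_prod.comp (Continuous.prodMk_left y))) continuous_const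

theorem firstRange_subset {ρ : (Fin (n + 1) → ℝ) → ℝ} {R : ℝ} (h0 : ∀ x, R < ‖x‖ → ρ x = 0) :
    firstRange ρ ⊆ Set.Icc (-R) R := by
  rintro a ⟨y, hy⟩
  refine abs_le.1 ?_
  by_contra hc
  exact hy (h0 _ ((not_le.1 hc).trans_le (abs_le_norm_cons a y)))

theorem eq_zero_of_notMem_firstRange {ρ : (Fin (n + 1) → ℝ) → ℝ} {a : ℝ} (ha : a ∉ firstRange ρ)
    (y : Fin n → ℝ) : ρ (Fin.cons a y) = 0 := by
  by_contra hc
  exact ha ⟨y, hc⟩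

theorem othersPDF_eq_setIntegral {f : (Fin (n + 1) → ℝ) → ℝ} {A : Set ℝ}
    (hf : ∀ a ∉ A, ∀ y : Fin n → ℝ, f (Fin.cons a y) = 0) (y : Fin n → ℝ) :
    othersPDF f y = ∫ a in A, f (Fin.cons a y) :=
  (setIntegral_eq_integral_of_forall_compl_eq_zero fun a ha => hf a ha y).symm

theorem othersPDF_pos {f : (Fin (n + 1) → ℝ) → ℝ} {R M : ℝ} (hf : Continuous f)
    (hn : ∀ x, 0 ≤ f x) (h0 : ∀ x, R < ‖x‖ → f x = 0) (hM : ∀ x, |f x| ≤ M) {a : ℝ}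
    {y : Fin n → ℝ} (hy : f (Fin.cons a y) ≠ 0) : 0 < othersPDF f y := by
  have hc : Continuous (fun a : ℝ => f (Fin.cons a y)) :=
    hf.comp (continuous_cons_prod.comp (Continuous.prodMk_left y))
  exact integral_pos_of_integrable_nonneg_nonzero hc (integrable_slice hf h0 hM y)
    (fun a => hn _) hy

end Marginal

theorem IsPDFOf.eq_of_continuous {d : ℕ} {Ω : Type*} [MeasurableSpace Ω] {P : Measure Ω}
    [IsProbabilityMeasure P] {Y : Ω → (Fin d → ℝ)} {w₁ w₂ : (Fin d → ℝ) → ℝ}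
    (h₁ : IsPDFOf P Y w₁) (h₂ : IsPDFOf P Y w₂) (hY : AEMeasurable Y P) (c₁ : Continuous w₁)
    (c₂ : Continuous w₂) : w₁ = w₂ := by
  refine (Continuous.ae_eq_iff_eq (volume : Measure (Fin d → ℝ)) c₁ c₂).1
    (eq_of_forall_integral_mul_eq c₁.locallyIntegrable c₂.locallyIntegrable fun f hf _ => ?_)
  rw [← h₁.integral_comp hY c₁.measurable hf.continuous.measurable,
    ← h₂.integral_comp hY c₂.measurable hf.continuous.measurable]

theorem exists_isCompactDensityFamily {n m : ℕ}
    {F : ℝ → (Fin (n + 1) → ℝ) → Fin (n + 1) → ℝ}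
    {B : ℝ → (Fin (n + 1) → ℝ) → Fin (n + 1) → Fin m → ℝ}
    {Ω : Type*} [MeasurableSpace Ω] {P : Measure Ω} [IsProbabilityMeasure P]
    {t₀ t₁ : ℝ} {X : ℝ → Ω → (Fin (n + 1) → ℝ)} (hX : IsWeakSolution F B t₀ t₁ P X)
    {ρ : ℝ → (Fin (n + 1) → ℝ) → ℝ} (hρ : ∀ s ∈ Set.Ioo t₀ t₁, IsPDFOf P (X s) (ρ s))
    (hρ_smooth : ContDiffOn ℝ 2 (fun z : ℝ × (Fin (n + 1) → ℝ) => ρ z.1 z.2)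
      (Set.Ioo t₀ t₁ ×ˢ Set.univ))
    (hρ_compact : ∃ K : Set (Fin (n + 1) → ℝ), IsCompact K ∧
      ∀ s ∈ Set.Ioo t₀ t₁, ∀ x, x ∉ K → ρ s x = 0)
    {t : ℝ} (ht : t ∈ Set.Ioo t₀ t₁) :
    ∃ K R κ, Set.Icc (t - 2 * κ) (t + 2 * κ) ⊆ Set.Ioo t₀ t₁ ∧
      IsCompactDensityFamily K R t κ ρ (timeDeriv (t - 2 * κ) (t + 2 * κ) ρ) := by
  obtain ⟨K₀, hK₀, hzero⟩ := hρ_compact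
  obtain ⟨R₀, hR₀⟩ := hK₀.isBounded.subset_closedBall 0
  have hz : ∀ s ∈ Set.Ioo t₀ t₁, ∀ x, max R₀ 0 < ‖x‖ → ρ s x = 0 := fun s hs x hx =>
    hzero s hs x fun hxK => by
      have := hR₀ hxK
      rw [mem_closedBall_zero_iff] at this
      linarith [le_max_left R₀ 0]
  -- A quarter of the distance makes `2 * κ` half of it, so that the closed interval stays strictly
  -- inside.
  set κ := min (t - t₀) (t₁ - t) / 4 with hκ
  have hκ0 : 0 < κ := by
    have := lt_min (sub_pos.2 ht.1) (sub_pos.2 ht.2)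
    positivity
  have hsub : Set.Icc (t - 2 * κ) (t + 2 * κ) ⊆ Set.Ioo t₀ t₁ := fun s hs => by
    have h1 := min_le_left (t - t₀) (t₁ - t)
    have h2 := min_le_right (t - t₀) (t₁ - t)
    exact ⟨by linarith [hs.1], by linarith [hs.2]⟩
  have hlt : t - 2 * κ < t + 2 * κ := by linarith
  have hsm := hρ_smooth.mono (Set.prod_mono hsub (le_refl Set.univ))
  obtain ⟨C, hC⟩ := exists_isRapidlyDecreasing_of_eq_zero hlt hsm
    fun s hs => hz s (hsub hs)
  have hd := hC.isDecayingFamily hlt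
  exact ⟨C, max R₀ 0, κ, hsub, le_max_right _ _, hκ0, hd, fun s hs => (hρ s (hsub hs)).1,
    fun s hs => hz s (hsub hs), fun s hs => (hρ s (hsub hs)).integral_eq_one
      (hX.measurable (Set.Ioo_subset_Icc_self (hsub hs))).aemeasurable
      (hd.contDiff s hs).continuous.measurable⟩

/-! ### The frozen system as a family of pairs of solutions -/

section FrozenSystem

variable {n m : ℕ} {F : ℝ → (Fin (n + 1) → ℝ) → Fin (n + 1) → ℝ}
  {B : ℝ → (Fin (n + 1) → ℝ) → Fin (n + 1) → Fin m → ℝ} {t δ : ℝ}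
  {ρ₀ : (Fin (n + 1) → ℝ) → ℝ} {Ω : Type*} [MeasurableSpace Ω] {P : Measure Ω}
  {Z : ℝ → Ω → (Fin (n + 1) → ℝ)} {u : ℝ → (Fin (n + 1) → ℝ) → ℝ}
  {q : ℝ → ℝ → (Fin n → ℝ) → ℝ}

namespace IsFrozenSystem

variable (h : IsFrozenSystem F B t δ ρ₀ P Z u q)

include h

theorem contDiff_state {s : ℝ} (hs : s ∈ Set.Icc t (t + δ)) : ContDiff ℝ 2 (u s) := by
  obtain ⟨C, hC⟩ := h.state_regular
  exact hC.1.contDiff_slice hs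

theorem timeDeriv_param_eq
    (hF : ContDiff ℝ 1 (fun z : ℝ × (Fin (n + 1) → ℝ) => F z.1 z.2))
    (hB : ContDiff ℝ 2 (fun z : ℝ × (Fin (n + 1) → ℝ) => B z.1 z.2)) {a : ℝ} (ha : a ∈ firstRange ρ₀) {s : ℝ} (hs : s ∈ Set.Ico t (t + δ))
    (y : Fin n → ℝ) :
    timeDeriv t (t + δ) (q a) s y
      = fokkerPlanck (paramDrift F a) (paramNoise B a) s (q a s) y := by
  obtain ⟨C, hC⟩ := h.param_regular
  obtain ⟨Ω', _, P', Y, hP', hY, hpdf⟩ := h.param_pdf a ha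
  exact hY.timeDeriv_eq_fokkerPlanck (contDiff_paramDrift hF a) (contDiff_paramNoise hB a) le_rfl
    hpdf (hC a ha).1 hs y

variable [IsProbabilityMeasure P]

theorem state_initial_eq (hδ : 0 < δ) (hc : Continuous ρ₀) : u t = ρ₀ :=
  have ht : t ∈ Set.Icc t (t + δ) := ⟨le_rfl, by linarith⟩
  (h.state_pdf t ht).eq_of_continuous h.state_initial
    (h.state_solution.measurable ht).aemeasurable (h.contDiff_state ht).continuous hc

variable (hF : ContDiff ℝ 1 (fun z : ℝ × (Fin (n + 1) → ℝ) => F z.1 z.2))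
  (hB : ContDiff ℝ 2 (fun z : ℝ × (Fin (n + 1) → ℝ) => B z.1 z.2))

include hF hB

theorem timeDeriv_state_eq {s : ℝ} (hs : s ∈ Set.Ico t (t + δ)) (a : ℝ) (y : Fin n → ℝ) :
    timeDeriv t (t + δ) u s (Fin.cons a y)
      = fokkerPlanck (paramDrift F a) (paramNoise B a) s (fun y => u s (Fin.cons a y)) y := by
  obtain ⟨C, hC⟩ := h.state_regular
  rw [h.state_solution.timeDeriv_eq_fokkerPlanck (contDiff_frozenDrift hF)
    (contDiff_frozenNoise hB) le_rfl h.state_pdf hC.1 hs]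
  exact fokkerPlanck_frozen_cons (hF.slice s) (hB.slice s)
    (h.contDiff_state ⟨hs.1, hs.2.le⟩) a y

/-- For each `a` in the range, the slice of `u` and the density `q a` solve the same equation. The
slice is not normalised, which is why the pairs only require nonnegativity. All constants are
independent of `a`, as is needed for integrating over `a`. -/
theorem exists_isFokkerPlanckPair (hδ : 0 < δ) : ∃ (K : ℕ → ℝ) (p : ℕ) (Λ : ℝ), 0 ≤ Λ ∧ (∀ N, 0 ≤ K N) ∧
    IsDecayingFamily K t (t + δ) u (timeDeriv t (t + δ) u) ∧
    ∀ a ∈ firstRange ρ₀, IsFokkerPlanckPair (paramDrift F a) (paramNoise B a) t (t + δ) K p Λ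
      (fun s y => u s (Fin.cons a y)) (fun s y => timeDeriv t (t + δ) u s (Fin.cons a y))
      (q a) (timeDeriv t (t + δ) (q a)) := by
  obtain ⟨Cu, hCu⟩ := h.state_regular
  obtain ⟨Cq, hCq⟩ := h.param_regular
  obtain ⟨c, p, hcp⟩ := h.growth
  have hlt : t < t + δ := by linarith
  have hu := hCu.isDecayingFamily hlt
  refine ⟨fun N => max (Cu N) (Cq N), 2 * p, coefficientConst c n m, coefficientConst_nonneg _ _ _,
    fun N => (hu.const_nonneg hlt.le N).trans (le_max_left _ _),
    hu.mono fun N => le_max_left _ _, fun a ha => ?_⟩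
  obtain ⟨Ω', _, P', Y, hP', hY, hpdf⟩ := h.param_pdf a ha
  exact
    { contDiff_drift := contDiff_paramDrift hF a
      contDiff_noise := contDiff_paramNoise hB a
      lt := hlt
      bound_nonneg := coefficientConst_nonneg _ _ _
      decaying := (hu.slice a).mono fun N => le_max_left _ _
      decaying' := ((hCq a ha).isDecayingFamily hlt).mono fun N => le_max_right _ _
      nonneg := fun s hs y => (h.state_pdf s hs).1 _
      nonneg' := fun s hs y => (hpdf s hs).1 y
      eq := fun s hs y => h.timeDeriv_state_eq hF hB hs a y
      eq' := fun s hs y => h.timeDeriv_param_eq hF hB ha hs y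
      coefficient := fun s hs y hy => (hcp a ha s hs y (Or.inr hy)).coefficientBoundAt
        ((contDiff_paramDrift hF a).slice s) ((contDiff_paramNoise hB a).slice s) }

end IsFrozenSystem

end FrozenSystem

/-! ### The frozen system as a bundle -/

section Bundle

variable {n m : ℕ} {F : ℝ → (Fin (n + 1) → ℝ) → Fin (n + 1) → ℝ}
  {B : ℝ → (Fin (n + 1) → ℝ) → Fin (n + 1) → Fin m → ℝ} {t δ R κ : ℝ} {K₀ : ℕ → ℝ}
  {ρ ρt : ℝ → (Fin (n + 1) → ℝ) → ℝ} {Ω : Type*} [MeasurableSpace Ω] {P : Measure Ω}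
  {Z : ℝ → Ω → (Fin (n + 1) → ℝ)} {u : ℝ → (Fin (n + 1) → ℝ) → ℝ}
  {q : ℝ → ℝ → (Fin n → ℝ) → ℝ}

theorem IsCompactDensityFamily.firstRange_nonempty
    (hd : IsCompactDensityFamily K₀ R t κ ρ ρt) : (firstRange (ρ t)).Nonempty := by
  by_contra hA
  have h0 : ∀ x, ρ t x = 0 := fun x => by
    rw [← Fin.cons_self_tail x]
    exact eq_zero_of_notMem_firstRange (fun hx => hA ⟨_, hx⟩) _
  have := hd.integral_eq_one t hd.self_mem
  simp [h0] at this

/-- The regularity is borrowed from the parametrised densities, which start from this marginal. At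
least one parameter value occurs, because `ρ t` has mass one. -/
theorem IsFrozenSystem.contDiff_othersPDF (h : IsFrozenSystem F B t δ (ρ t) P Z u q) (hδ : 0 < δ)
    (hd : IsCompactDensityFamily K₀ R t κ ρ ρt) : ContDiff ℝ 2 (othersPDF (ρ t)) := by
  obtain ⟨a, ha⟩ := hd.firstRange_nonempty
  obtain ⟨C, hC⟩ := h.param_regular
  rw [← funext (h.param_initial a ha)]
  exact (hC a ha).1.contDiff_slice ⟨le_rfl, by linarith⟩

/-- The right-hand side is a single function on the full space, restricted to the slice. This gives
measurability of the time derivative in the parameter, and it is the expression in the asserted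
formula before division by the marginal. -/
theorem IsFrozenSystem.timeDeriv_param_initial_eq (h : IsFrozenSystem F B t δ (ρ t) P Z u q)
    (hδ : 0 < δ) (hF : ContDiff ℝ 1 (fun z : ℝ × (Fin (n + 1) → ℝ) => F z.1 z.2))
    (hB : ContDiff ℝ 2 (fun z : ℝ × (Fin (n + 1) → ℝ) => B z.1 z.2))
    (hd : IsCompactDensityFamily K₀ R t κ ρ ρt) {a : ℝ} (ha : a ∈ firstRange (ρ t))
    (y : Fin n → ℝ) :
    timeDeriv t (t + δ) (q a) t y = fokkerPlanck (frozenDrift F) (frozenNoise B) t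
      (fun x => othersPDF (ρ t) (Fin.tail x)) (Fin.cons a y) := by
  rw [h.timeDeriv_param_eq hF hB ha ⟨le_rfl, by linarith⟩,
    fokkerPlanck_frozen_cons (w := fun x => othersPDF (ρ t) (Fin.tail x)) (hF.slice t) (hB.slice t)
      ((h.contDiff_othersPDF hδ hd).comp contDiff_tail), funext (h.param_initial a ha)]
  simp only [Fin.tail_cons]

theorem IsFrozenSystem.exists_isFokkerPlanckBundle [IsProbabilityMeasure P]
    (h : IsFrozenSystem F B t δ (ρ t) P Z u q)
    (hδ : 0 < δ) (hF : ContDiff ℝ 1 (fun z : ℝ × (Fin (n + 1) → ℝ) => F z.1 z.2))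
    (hB : ContDiff ℝ 2 (fun z : ℝ × (Fin (n + 1) → ℝ) => B z.1 z.2))
    (hd : IsCompactDensityFamily K₀ R t κ ρ ρt)
    (hweak : ∀ f : (Fin (n + 1) → ℝ) → ℝ, ContDiff ℝ ((⊤ : ℕ∞) : WithTop ℕ∞) f →
      HasCompactSupport f → ∫ x, ρt t x * f x = ∫ x, ρ t x * generator F B t f x) :
    ∃ (K : ℕ → ℝ) (p : ℕ) (Λ C : ℝ), IsFokkerPlanckBundle (firstRange (ρ t)) (paramDrift F)
      (paramNoise B) t (t + δ) K p Λ R C (fun a s y => u s (Fin.cons a y))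
      (fun a s y => timeDeriv t (t + δ) u s (Fin.cons a y)) q
      (fun a => timeDeriv t (t + δ) (q a)) (othersPDF (ρ t)) (othersPDF (ρt t)) := by
  obtain ⟨K, p, Λ, hΛ, hK, hu, hpair⟩ := h.exists_isFokkerPlanckPair hF hB hδ
  have htI : t ∈ Set.Icc t (t + δ) := ⟨le_rfl, by linarith⟩
  have hc := hd.continuous hd.self_mem
  have hut := h.state_initial_eq hδ hc
  have hz := hd.eq_zero t hd.self_mem
  obtain ⟨a₀, ha₀⟩ := hd.firstRange_nonempty
  have cut : Continuous (timeDeriv t (t + δ) u t) := continuousOn_univ.1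
    (hu.continuousOn_deriv.comp (f := fun x => (t, x)) (by fun_prop) fun x _ => ⟨htI, trivial⟩)
  -- The slice of the initial density is identically zero there, so the Fokker–Planck equation on
  -- the slice gives a vanishing time derivative.
  have hut0 : ∀ a ∉ firstRange (ρ t), ∀ y : Fin n → ℝ,
      timeDeriv t (t + δ) u t (Fin.cons a y) = 0 := fun a ha y => by
    rw [h.timeDeriv_state_eq hF hB ⟨le_rfl, by linarith⟩, hut,
      show (fun y : Fin n → ℝ => ρ t (Fin.cons a y)) = fun _ => 0 from
        funext (eq_zero_of_notMem_firstRange ha)]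
    exact fokkerPlanck_zero _ _ _ _
  have iut : Integrable (timeDeriv t (t + δ) u t) := by
    refine Continuous.integrable_of_le_decayWeight (c := K (n + 1 + 1)) cut.aestronglyMeasurable
      fun x => ?_
    have := le_mul_decayWeight (p := 0) (by simpa using hu.bound_deriv (n + 1 + 1) t htI x)
    simpa using this
  have htail : ∀ x : Fin (n + 1) → ℝ, R < |x 0| → R < ‖x‖ := fun x hx =>
    hx.trans_le (norm_le_pi_norm x 0)
  obtain ⟨Cu, hCu⟩ := h.state_regular
  -- At time `t` the full and the frozen system have the same density, and their weak equations are
  -- tested only with functions of the tail. This equality later cancels the logarithmic terms.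
  have hmarg : othersPDF (ρt t) =ᵐ[volume] othersPDF (timeDeriv t (t + δ) u t) := by
    refine othersPDF_ae_eq_of_weak hd.radius_nonneg (fun x hx => hz x (htail x hx))
      (fun x hx => hd.deriv_eq_zero hd.self_mem x (htail x hx)) (fun x hx => ?_)
      (integrable_of_bounded_support (hd.continuous_deriv hd.self_mem).aestronglyMeasurable
        (hd.deriv_eq_zero hd.self_mem) (hd.abs_deriv_le hd.self_mem)) iut hweak fun f hf hfc => ?_
    · rw [← Fin.cons_self_tail x]
      refine hut0 _ (fun hA => ?_) _
      exact absurd (abs_le.2 (firstRange_subset hz hA)) (not_le.2 hx)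
    · rw [h.state_solution.integral_mul_deriv_eq (contDiff_frozenDrift hF).continuous
        (contDiff_frozenNoise hB).continuous le_rfl h.state_pdf (hCu.1.of_le one_le_two)
        ⟨le_rfl, by linarith⟩ hf hfc, hut]
  refine ⟨K, p, Λ, 2 * (2 * (2 * R * K₀ 0) + 2 * R * K₀ 0 / κ), ?_⟩
  exact
    { measurableSet := (isOpen_firstRange hc).measurableSet
      volume_lt_top := (measure_mono (firstRange_subset hz)).trans_lt (by simp)
      lt := by linarith
      bound_nonneg := hΛ
      const_nonneg := hK
      pair := hpair
      initial := fun a ha => funext (h.param_initial a ha)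
      continuous_marginal := (h.contDiff_othersPDF hδ hd).continuous
      marginal_le := fun y => by
        rw [← h.param_initial a₀ ha₀]
        exact ((hpair a₀ ha₀).isWeightedDensity' htI).le_const y
      marginal := fun y => by
        simp only [hut]
        exact othersPDF_eq_setIntegral (fun a ha => eq_zero_of_notMem_firstRange ha) y
      marginal_eq_zero := fun y hy => othersPDF_eq_zero hz hy
      marginal_pos := fun a _ y hy => by
        rw [hut] at hy
        exact othersPDF_pos hc (hd.nonneg t hd.self_mem) hz (hd.abs_le hd.self_mem) hy
      deriv_marginal := by
        filter_upwards [hmarg] with y hy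
        rw [hy]
        exact othersPDF_eq_setIntegral hut0 y
      measurable_deriv_marginal := (continuous_othersPDF (hd.continuous_deriv hd.self_mem)
        (hd.deriv_eq_zero hd.self_mem) (hd.abs_deriv_le hd.self_mem)).measurable
      sq_deriv_marginal_le := hd.sq_othersPDF_deriv_le (by simpa using hd.pos)
      measurable_state := fun s hs =>
        ((h.contDiff_state hs).continuous.comp continuous_cons_prod).measurable
      measurable_state_deriv := (cut.comp continuous_cons_prod).measurable
      measurable_param := fun s _ => h.param_measurable.comp
        (measurable_fst.prodMk (measurable_const.prodMk measurable_snd))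
      measurable_param_deriv := by
        have hW := continuous_fokkerPlanck (s := t) ((contDiff_frozenDrift hF).slice t)
          ((contDiff_frozenNoise hB).slice t)
          ((h.contDiff_othersPDF hδ hd).comp (contDiff_tail (d := n)))
        refine ((hW.comp continuous_cons_prod).aestronglyMeasurable).congr ?_
        filter_upwards [Measure.quasiMeasurePreserving_fst.ae
          (ae_restrict_mem (isOpen_firstRange hc).measurableSet)] with z hz
        exact (h.timeDeriv_param_initial_eq hδ hF hB hd hz z.2).symm }

end Bundle

/-! ### The frozen entropy as an integral over the bundle -/

theorem prod_restrict_eq_restrict {n : ℕ} (A : Set ℝ) :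
    (volume.restrict A).prod (volume : Measure (Fin n → ℝ))
      = (volume : Measure (ℝ × (Fin n → ℝ))).restrict (A ×ˢ Set.univ) := by
  rw [Measure.volume_eq_prod, ← Measure.prod_restrict, Measure.restrict_univ]

theorem ae_cons_iff {n : ℕ} {p : (Fin (n + 1) → ℝ) → Prop} :
    (∀ᵐ z : ℝ × (Fin n → ℝ), p (Fin.cons z.1 z.2)) ↔ ∀ᵐ x, p x := by
  rw [← (measurePreserving_cons n).map_eq, (measurableEmbedding_cons n).ae_map_iff]

theorem IsFokkerPlanckBundle.integral_state_eq {d m : ℕ} {A : Set ℝ}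
    {F : ℝ → ℝ → (Fin d → ℝ) → Fin d → ℝ} {B : ℝ → ℝ → (Fin d → ℝ) → Fin d → Fin m → ℝ}
    {t₀ t₁ : ℝ} {K : ℕ → ℝ} {p : ℕ} {Λ R C : ℝ} {v vt q qt : ℝ → ℝ → (Fin d → ℝ) → ℝ}
    {p₀ pdot : (Fin d → ℝ) → ℝ}
    (h : IsFokkerPlanckBundle A F B t₀ t₁ K p Λ R C v vt q qt p₀ pdot) {s : ℝ}
    (hs : s ∈ Set.Icc t₀ t₁) :
    ∫ z, v z.1 s z.2 ∂(volume.restrict A).prod volume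
      = ∫ z, v z.1 t₀ z.2 ∂(volume.restrict A).prod volume := by
  rw [integral_prod _ (h.integrable_state hs), integral_prod _ (h.integrable_state h.mem_Icc)]
  exact setIntegral_congr_fun h.measurableSet fun a ha => (h.pair a ha).integral_eq hs

namespace IsFrozenSystem

variable {n m : ℕ} {F : ℝ → (Fin (n + 1) → ℝ) → Fin (n + 1) → ℝ}
  {B : ℝ → (Fin (n + 1) → ℝ) → Fin (n + 1) → Fin m → ℝ} {t δ : ℝ}
  {ρ₀ : (Fin (n + 1) → ℝ) → ℝ} {Ω : Type*} [MeasurableSpace Ω] {P : Measure Ω}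
  [IsProbabilityMeasure P] {Z : ℝ → Ω → (Fin (n + 1) → ℝ)} {u : ℝ → (Fin (n + 1) → ℝ) → ℝ}
  {q : ℝ → ℝ → (Fin n → ℝ) → ℝ} {K : ℕ → ℝ} {p : ℕ} {Λ R C : ℝ} {pdot : (Fin n → ℝ) → ℝ}
  (h : IsFrozenSystem F B t δ ρ₀ P Z u q) (hδ : 0 < δ) (hc : Continuous ρ₀)
  (hb : IsFokkerPlanckBundle (firstRange ρ₀) (paramDrift F) (paramNoise B) t (t + δ) K p Λ R C
    (fun a s y => u s (Fin.cons a y)) (fun a s y => timeDeriv t (t + δ) u s (Fin.cons a y)) q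
    (fun a => timeDeriv t (t + δ) (q a)) (othersPDF ρ₀) pdot)

include h hδ hc hb

/-- The frozen component keeps its initial distribution. -/
theorem ae_state_eq_zero {s : ℝ} (hs : s ∈ Set.Icc t (t + δ)) :
    ∀ᵐ z : ℝ × (Fin n → ℝ), z ∉ firstRange ρ₀ ×ˢ (Set.univ : Set (Fin n → ℝ)) →
      u s (Fin.cons z.1 z.2) = 0 := by
  have htI : t ∈ Set.Icc t (t + δ) := ⟨le_rfl, by linarith⟩
  set S := firstRange ρ₀ ×ˢ (Set.univ : Set (Fin n → ℝ)) with hS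
  have hSm : MeasurableSet S := (isOpen_firstRange hc).measurableSet.prod MeasurableSet.univ
  have mass : ∀ r ∈ Set.Icc t (t + δ), Integrable (u r) ∧ ∫ x, u r x = 1 := fun r hr =>
    ⟨(h.state_pdf r hr).integrable (h.state_solution.measurable hr).aemeasurable
      (h.contDiff_state hr).continuous.measurable,
    (h.state_pdf r hr).integral_eq_one (h.state_solution.measurable hr).aemeasurable
      (h.contDiff_state hr).continuous.measurable⟩
  -- Mass is conserved on each slice over the range, and at time `t` these slices carry all of it.
  -- At time `s` nothing is left for the complement, where `u` is nonnegative with zero integral.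
  have e1 := hb.integral_state_eq hs
  rw [prod_restrict_eq_restrict, ← hS] at e1
  have e2 : ∫ z in S, u t (Fin.cons z.1 z.2) = 1 := by
    rw [setIntegral_eq_integral_of_forall_compl_eq_zero, integral_cons, (mass t htI).2]
    intro z hz
    rw [h.state_initial_eq hδ hc]
    exact eq_zero_of_notMem_firstRange (fun hA => hz ⟨hA, trivial⟩) _
  have is : Integrable (fun z : ℝ × (Fin n → ℝ) => u s (Fin.cons z.1 z.2)) :=
    integrable_cons_iff.2 (mass s hs).1
  have e3 := integral_add_compl hSm is
  rw [integral_cons, (mass s hs).2, e1, e2] at e3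
  have e4 : ∫ z in Sᶜ, u s (Fin.cons z.1 z.2) = 0 := by linarith
  have e5 := (setIntegral_eq_zero_iff_of_nonneg_ae
    (Filter.Eventually.of_forall fun z => (h.state_pdf s hs).1 _) is.integrableOn).1 e4
  rw [Filter.EventuallyEq, ae_restrict_iff' hSm.compl] at e5
  filter_upwards [e5] with z hz hzS using hz hzS

/-- Nothing is assumed about `q a` for `a` outside the range, so the expectation is first shown to
ignore these values: `u` vanishes almost everywhere there. On the range, positivity and
integrability come from the bundle. -/
theorem frozenEntropy_eq {s : ℝ} (hs : s ∈ Set.Icc t (t + δ)) :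
    (∀ᵐ ω ∂P, 0 < q (Z s ω 0) s (Fin.tail (Z s ω))) ∧
    Integrable (fun ω => Real.log (q (Z s ω 0) s (Fin.tail (Z s ω)))) P ∧
    frozenEntropy P Z q s = -∫ z, u s (Fin.cons z.1 z.2) * Real.log (q z.1 s z.2)
      ∂(volume.restrict (firstRange ρ₀)).prod volume := by
  have hz := h.ae_state_eq_zero hδ hc hb hs
  have hY := (h.state_solution.measurable hs).aemeasurable (μ := P)
  have hw := (h.contDiff_state hs).continuous.measurable
  have hpdf := h.state_pdf s hs
  have mq : Measurable (fun x : Fin (n + 1) → ℝ => q (x 0) s (Fin.tail x)) :=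
    h.param_measurable.comp ((measurable_pi_apply 0).prodMk (measurable_const.prodMk
      (contDiff_tail (k := 0)).continuous.measurable))
  have hSm : MeasurableSet (firstRange ρ₀ ×ˢ (Set.univ : Set (Fin n → ℝ))) :=
    (isOpen_firstRange hc).measurableSet.prod MeasurableSet.univ
  have hzero : ∀ᵐ z : ℝ × (Fin n → ℝ), z ∉ firstRange ρ₀ ×ˢ (Set.univ : Set (Fin n → ℝ)) →
      u s (Fin.cons z.1 z.2) * Real.log (q z.1 s z.2) = 0 := by
    filter_upwards [hz] with z hz hzS
    rw [hz hzS, zero_mul]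
  have iμ := hb.integrable_log hs
  rw [prod_restrict_eq_restrict] at iμ
  refine ⟨?_, ?_, ?_⟩
  · rw [hpdf.ae_comp hY hw (p := fun x => 0 < q (x 0) s (Fin.tail x)) (mq measurableSet_Ioi),
      ← ae_cons_iff]
    have hp := hb.ae_pos hs
    rw [prod_restrict_eq_restrict, ae_restrict_iff' hSm] at hp
    filter_upwards [hp, hz] with z h1 h2 h3
    simp only [Fin.cons_zero, Fin.tail_cons]
    by_cases hzS : z ∈ firstRange ρ₀ ×ˢ (Set.univ : Set (Fin n → ℝ))
    · exact h1 hzS h3.ne'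
    · exact absurd (h2 hzS) h3.ne'
  · rw [hpdf.integrable_comp hY hw (g := fun x => Real.log (q (x 0) s (Fin.tail x))) mq.log,
      ← integrable_cons_iff]
    simp only [Fin.cons_zero, Fin.tail_cons]
    exact IntegrableOn.integrable_of_ae_notMem_eq_zero iμ hzero
  · rw [frozenEntropy, hpdf.integral_comp hY hw (g := fun x => Real.log (q (x 0) s (Fin.tail x)))
      mq.log, ← integral_cons, prod_restrict_eq_restrict]
    simp only [Fin.cons_zero, Fin.tail_cons]
    rw [setIntegral_eq_integral_of_ae_compl_eq_zero hzero]

/-- The rate of change of the entropy with the first component frozen. -/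
theorem hasDerivWithinAt_frozenEntropy :
    HasDerivWithinAt (frozenEntropy P Z q)
      (-((∫ y, pdot y * Real.log (othersPDF ρ₀ y))
        + ∫ z, timeDeriv t (t + δ) (q z.1) t z.2 * (ρ₀ (Fin.cons z.1 z.2)
          * (othersPDF ρ₀ z.2)⁻¹) ∂(volume.restrict (firstRange ρ₀)).prod volume))
      (Set.Ici t) t := by
  have h1 := hb.hasDerivWithinAt_integral_log.neg
  rw [h.state_initial_eq hδ hc] at h1
  refine h1.congr_of_eventuallyEq ?_ (h.frozenEntropy_eq hδ hc hb ⟨le_rfl, by linarith⟩).2.2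
  filter_upwards [Icc_mem_nhdsGE (show t < t + δ by linarith)] with s hs
    using (h.frozenEntropy_eq hδ hc hb hs).2.2

theorem integrable_ratio :
    Integrable (fun x : Fin (n + 1) → ℝ => ρ₀ x * (othersPDF ρ₀ (Fin.tail x))⁻¹) := by
  have h1 := hb.integrable_ratio
  rw [prod_restrict_eq_restrict, h.state_initial_eq hδ hc] at h1
  rw [← integrable_cons_iff]
  simp only [Fin.tail_cons]
  refine IntegrableOn.integrable_of_forall_notMem_eq_zero h1 fun z hz => ?_
  rw [eq_zero_of_notMem_firstRange (fun hA => hz ⟨hA, trivial⟩), zero_mul]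

theorem integrable_ratio_mul {g : (Fin (n + 1) → ℝ) → ℝ} (hg : Continuous g)
    (h0 : ∀ x, R < ‖x‖ → ρ₀ x = 0) :
    Integrable (fun x : Fin (n + 1) → ℝ => ρ₀ x * (othersPDF ρ₀ (Fin.tail x))⁻¹ * g x) := by
  have h1 := h.integrable_ratio hδ hc hb
  obtain ⟨M, hM⟩ := (isCompact_closedBall (0 : Fin (n + 1) → ℝ) R).exists_bound_of_continuousOn
    hg.continuousOn
  refine (h1.norm.mul_const M).mono' (h1.aestronglyMeasurable.mul hg.aestronglyMeasurable)
    (Filter.Eventually.of_forall fun x => ?_)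
  rw [norm_mul]
  by_cases hx : x ∈ Metric.closedBall (0 : Fin (n + 1) → ℝ) R
  · exact mul_le_mul_of_nonneg_left (hM x hx) (norm_nonneg _)
  · simp [h0 x (by simpa using hx)]

end IsFrozenSystem

/-! ### The integrands of the formula, and the conclusion -/

section Terms

variable {n m : ℕ} {F : ℝ → (Fin (n + 1) → ℝ) → Fin (n + 1) → ℝ}
  {B : ℝ → (Fin (n + 1) → ℝ) → Fin (n + 1) → Fin m → ℝ} {t : ℝ} {ρ₀ : (Fin (n + 1) → ℝ) → ℝ}

theorem driftTerm_eq (x : Fin (n + 1) → ℝ) :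
    driftTerm F t ρ₀ x = (othersPDF ρ₀ (Fin.tail x))⁻¹ * ∑ i : Fin n,
      partialD i.succ (fun z => F t z i.succ * othersPDF ρ₀ (Fin.tail z)) x := by
  simp only [driftTerm, one_div, Finset.mul_sum]

theorem noiseTerm_eq (x : Fin (n + 1) → ℝ) :
    noiseTerm B t ρ₀ x = (othersPDF ρ₀ (Fin.tail x))⁻¹ * ∑ i : Fin n, ∑ j : Fin n,
      partialD i.succ (partialD j.succ
        (fun z => diffusionMatrix B t z i.succ j.succ * othersPDF ρ₀ (Fin.tail z))) x := by
  simp only [noiseTerm, one_div, Finset.mul_sum]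

theorem continuous_drift_sum (hF : ContDiff ℝ 1 (F t)) (hp : ContDiff ℝ 2 (othersPDF ρ₀)) :
    Continuous (fun x => ∑ i : Fin n,
      partialD i.succ (fun z => F t z i.succ * othersPDF ρ₀ (Fin.tail z)) x) :=
  continuous_finsetSum _ fun i _ => (((contDiff_pi.1 hF) i.succ).mul
    ((hp.of_le one_le_two).comp contDiff_tail)).continuous_partialD i.succ

theorem continuous_noise_sum (hB : ContDiff ℝ 2 (B t)) (hp : ContDiff ℝ 2 (othersPDF ρ₀)) :
    Continuous (fun x => ∑ i : Fin n, ∑ j : Fin n, partialD i.succ (partialD j.succ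
        (fun z => diffusionMatrix B t z i.succ j.succ * othersPDF ρ₀ (Fin.tail z))) x) :=
  continuous_finsetSum _ fun i _ => continuous_finsetSum _ fun j _ =>
    (((contDiff_diffusionMatrix hB i.succ j.succ).mul
      (hp.comp contDiff_tail)).contDiff_one_partialD j.succ).continuous_partialD i.succ

end Terms

theorem theorem1 {n m : ℕ}
    (F : ℝ → (Fin (n + 1) → ℝ) → Fin (n + 1) → ℝ)
    (B : ℝ → (Fin (n + 1) → ℝ) → Fin (n + 1) → Fin m → ℝ)
    (hF : ContDiff ℝ 1 (fun z : ℝ × (Fin (n + 1) → ℝ) => F z.1 z.2))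
    (hB : ContDiff ℝ 2 (fun z : ℝ × (Fin (n + 1) → ℝ) => B z.1 z.2))
    {Ω : Type*} [MeasurableSpace Ω] (P : Measure Ω) [IsProbabilityMeasure P]
    (t₀ t₁ : ℝ) (X : ℝ → Ω → (Fin (n + 1) → ℝ))
    (hX : IsWeakSolution F B t₀ t₁ P X)
    (ρ : ℝ → (Fin (n + 1) → ℝ) → ℝ)
    (hρ : ∀ s ∈ Set.Ioo t₀ t₁, IsPDFOf P (X s) (ρ s))
    (hρ_smooth : ContDiffOn ℝ 2 (fun z : ℝ × (Fin (n + 1) → ℝ) => ρ z.1 z.2)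
      (Set.Ioo t₀ t₁ ×ˢ Set.univ))
    (hρ_compact : ∃ K : Set (Fin (n + 1) → ℝ), IsCompact K ∧
      ∀ s ∈ Set.Ioo t₀ t₁, ∀ x, x ∉ K → ρ s x = 0)
    (t : ℝ) (ht : t ∈ Set.Ioo t₀ t₁)
    (δ : ℝ) (hδ : 0 < δ)
    {Ω' : Type*} [MeasurableSpace Ω'] (P' : Measure Ω') [IsProbabilityMeasure P']
    (Z : ℝ → Ω' → (Fin (n + 1) → ℝ)) (u : ℝ → (Fin (n + 1) → ℝ) → ℝ)
    (q : ℝ → ℝ → (Fin n → ℝ) → ℝ)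
    (hfrozen : IsFrozenSystem F B t δ (ρ t) P' Z u q) :
    Integrable (fun ω => driftTerm F t (ρ t) (X t ω)) P ∧
    Integrable (fun ω => noiseTerm B t (ρ t) (X t ω)) P ∧
    IsInformationFlow ρ P' Z q t
      (-(∫ ω, driftTerm F t (ρ t) (X t ω) ∂P)
        + (1 / 2) * ∫ ω, noiseTerm B t (ρ t) (X t ω) ∂P) := by
  obtain ⟨K₀, R, κ, hsub, hd⟩ := exists_isCompactDensityFamily hX hρ hρ_smooth hρ_compact ht
  have hκ := hd.pos
  have hsub' : Set.Icc (t - 2 * κ) (t + 2 * κ) ⊆ Set.Icc t₀ t₁ :=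
    hsub.trans Set.Ioo_subset_Icc_self
  have hc := hd.continuous hd.self_mem
  have hz := hd.eq_zero t hd.self_mem
  obtain ⟨K, p, Λ, C, hb⟩ := hfrozen.exists_isFokkerPlanckBundle hδ hF hB hd fun f hf hfc =>
    hX.integral_mul_deriv_eq hF.continuous hB.continuous hsub' (fun s hs => hρ s (hsub hs))
      ((hρ_smooth.mono (Set.prod_mono hsub (le_refl Set.univ))).of_le one_le_two)
      ⟨by linarith, by linarith⟩ hf hfc
  have hp := hfrozen.contDiff_othersPDF hδ hd
  have cD := continuous_drift_sum (n := n) (hF.slice t) hp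
  have cN := continuous_noise_sum (n := n) (hB.slice t) hp
  have mp : Measurable (fun x : Fin (n + 1) → ℝ => (othersPDF (ρ t) (Fin.tail x))⁻¹) :=
    (hp.continuous.comp (contDiff_tail (k := 0)).continuous).measurable.inv
  have mD : Measurable (driftTerm F t (ρ t)) := by
    rw [funext fun x => driftTerm_eq (F := F) (t := t) (ρ₀ := ρ t) x]
    exact mp.mul cD.measurable
  have mN : Measurable (noiseTerm B t (ρ t)) := by
    rw [funext fun x => noiseTerm_eq (B := B) (t := t) (ρ₀ := ρ t) x]
    exact mp.mul cN.measurable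
  have hXt := (hX.measurable (Set.Ioo_subset_Icc_self ht)).aemeasurable (μ := P)
  have iD : Integrable (fun x => ρ t x * driftTerm F t (ρ t) x) := by
    simp only [driftTerm_eq, ← mul_assoc]
    exact hfrozen.integrable_ratio_mul hδ hc hb cD hz
  have iN : Integrable (fun x => ρ t x * noiseTerm B t (ρ t) x) := by
    simp only [noiseTerm_eq, ← mul_assoc]
    exact hfrozen.integrable_ratio_mul hδ hc hb cN hz
  refine ⟨((hρ t ht).integrable_comp hXt hc.measurable mD).2 iD,
    ((hρ t ht).integrable_comp hXt hc.measurable mN).2 iN, ?_, ?_, _, _,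
    hd.hasDerivAt_othersEntropy, hfrozen.hasDerivWithinAt_frozenEntropy hδ hc hb, ?_⟩
  · filter_upwards [Icc_mem_nhds (show t - 2 * κ < t by linarith) (show t < t + 2 * κ by linarith)]
      with s hs using hd.integrable_othersPDF_mul_log hs
  · filter_upwards [Icc_mem_nhdsGE (show t < t + δ by linarith)] with s hs
    have := hfrozen.frozenEntropy_eq hδ hc hb hs
    exact ⟨this.1, this.2.1⟩
  · rw [(hρ t ht).integral_comp hXt hc.measurable mD, (hρ t ht).integral_comp hXt hc.measurable mN]
    have hzero : ∀ z : ℝ × (Fin n → ℝ), z ∉ firstRange (ρ t) ×ˢ (Set.univ : Set (Fin n → ℝ)) →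
        -(ρ t (Fin.cons z.1 z.2) * driftTerm F t (ρ t) (Fin.cons z.1 z.2))
          + 1 / 2 * (ρ t (Fin.cons z.1 z.2) * noiseTerm B t (ρ t) (Fin.cons z.1 z.2)) = 0 :=
      fun z hzA => by
        rw [eq_zero_of_notMem_firstRange (fun hA => hzA ⟨hA, trivial⟩)]
        simp
    -- On the range, the time derivative of `q` at `t` is the frozen Fokker–Planck operator applied
    -- to the marginal. Divided by the marginal, it is minus the drift term plus half the noise
    -- term. Outside the range the right-hand integrand is zero.
    have e : ∫ z, timeDeriv t (t + δ) (q z.1) t z.2 * (ρ t (Fin.cons z.1 z.2)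
          * (othersPDF (ρ t) z.2)⁻¹) ∂(volume.restrict (firstRange (ρ t))).prod volume
        = ∫ x, (-(ρ t x * driftTerm F t (ρ t) x) + 1 / 2 * (ρ t x * noiseTerm B t (ρ t) x)) := by
      rw [← integral_cons, prod_restrict_eq_restrict,
        ← setIntegral_eq_integral_of_forall_compl_eq_zero hzero]
      refine setIntegral_congr_fun
        ((isOpen_firstRange hc).measurableSet.prod MeasurableSet.univ) fun z hzA => ?_
      rw [hfrozen.timeDeriv_param_initial_eq hδ hF hB hd hzA.1, fokkerPlanck_frozen,
        driftTerm_eq, noiseTerm_eq, Fin.tail_cons]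
      ring
    have e' : ∫ x, (-(ρ t x * driftTerm F t (ρ t) x) + 1 / 2 * (ρ t x * noiseTerm B t (ρ t) x))
        = -(∫ x, ρ t x * driftTerm F t (ρ t) x)
          + 1 / 2 * ∫ x, ρ t x * noiseTerm B t (ρ t) x := by
      rw [← integral_neg, ← integral_const_mul]
      exact integral_add iD.neg (iN.const_mul _)
    -- What remains is the difference of the two rates, in which the integrals of the derivative of
    -- the marginal against its logarithm cancel.
    rw [e, e']
    ring
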